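/- Let $\Bbbk$ be a commutative ring of characteristic not equal to $2$. Let $F$ be an $\mathbb{N}$-graded Frobenius $\Bbbk$-superalgebra, free over $\Bbbk$ with a finite basis $B$ consisting of homogeneous elements, with parity-preserving trace map $\operatorname{tr}\colon F\to\Bbbk$ of degree $-\delta$ ($\delta$ being the maximal degree of elements of $F$); that is, $f\mapsto\big(g\mapsto(-1)^{\bar f\bar g}\operatorname{tr}(gf)\big)$ is an isomorphism $F\to\operatorname{Hom}_\Bbbk(F,\Bbbk)$. Let $\{b^\vee\}_{b\in B}$ be the left dual basis, $\operatorname{tr}(b^\vee c)=\delta_{b,c}$, and let $\psi$ be the Nakayama automorphism, $\operatorname{tr}(fg)=(-1)^{\bar f\bar g}\operatorname{tr}(g\psi(f))$. Assume that $\psi$ has finite order $\theta$, that the characteristic of $\Bbbk$ does not divide $\theta$, and that $F$ has a basis of eigenvectors of $\psi$. For $n\ge 1$ let $\mathcal{A}_n(F)$ be the affine wreath product algebra: the quotient of the free product of algebras $\Bbbk[x_1,\dots,x_n]\star F^{\otimes n}\star\Bbbk S_n$ by the relations $$\mathbf{f}x_i=x_i\psi_i(\mathbf{f}),\quad s_ix_j=x_js_i\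 (j\ne i,i+1),\quad s_ix_i=x_{i+1}s_i-\sum_{b\in B}b_i b^\vee_{i+1},\quad \pi\mathbf{f}={}^{\pi}\mathbf{f}\,\pi,$$ where $f_i\in F^{\otimes n}$ denotes $f$ placed in the $i$-th factor, $\psi_i$ is $\psi$ applied to the $i$-th factor, and ${}^\pi\mathbf f$ is the superpermutation action of $\pi\in S_n$ on $\mathbf f\in F^{\otimes n}$. It is a graded superalgebra in which $x_i$ is even of degree $\delta$, $f_i$ has the degree and parity of $f$, and permutations are even of degree $0$. Put $\mathcal{A}_0(F)=\Bbbk$. For $1\le k\le\theta$ fix $e_k\in\mathbb{N}$ and even elements $c^{(k,1)},\dots,c^{(k,e_k)}\in F$ of degree $k\delta$ with $\psi(c^{(k,j)})=c^{(k,j)}$ and $g\,c^{(k,j)}=c^{(k,j)}\psi^k(g)$ for all $g\in F$; denote this collection by $\mathbf{C}$, and let $d=\sum_{k=1}^{\theta}ke_k$. For $n\ge1$ let $\mathcal{A}_n^{\mathbf C}(F)$ be the quotient of $\mathcal{A}_n(F)$ by the two-sided ideal generated by $\prod_{k=1}^\theta\prod_{j=1}^{e_k}\big(x_1^k-c^{(k,j)}_1\big)$,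 and let $\mathcal{A}_0^{\mathbf C}(F)=\Bbbk$. For a graded superalgebra $A$, let $A\text{-mod}$ be the category of finitely generated $\mathbb{Z}$-graded left $A$-supermodules, whose morphisms are the $A$-linear maps preserving degree and parity. For $n\ge 0$, the natural homomorphism $\mathcal{A}_n^{\mathbf C}(F)\to\mathcal{A}_{n+1}^{\mathbf C}(F)$ ($x_i\mapsto x_i$, $f_i\mapsto f_i$, $\pi\mapsto\pi$) induces functors $$\operatorname{Res}\colon \mathcal{A}_{n+1}^{\mathbf C}(F)\text{-mod}\to\mathcal{A}_n^{\mathbf C}(F)\text{-mod},\qquad \operatorname{Ind}=\mathcal{A}_{n+1}^{\mathbf C}(F)\otimes_{\mathcal{A}_n^{\mathbf C}(F)}-\colon \mathcal{A}_n^{\mathbf C}(F)\text{-mod}\to\mathcal{A}_{n+1}^{\mathbf C}(F)\text{-mod}$$ (both preserve finite generation). The functor $\operatorname{Ind}$ is exact, it is left adjoint to $\operatorname{Res}$, and it is right adjoint to $\operatorname{Res}$ up to degree shift: the functor $M\mapsto(\operatorname{Ind}M)\{d\delta\}$, where $(N\{s\})_{i,\varepsilon}=N_{i+s,\varepsilon}$,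 is right adjoint to $\operatorname{Res}$. -/

import Mathlib

open CategoryTheory
open scoped TensorProduct

universe u

/-- Bidegrees: the integer degree together with the parity. -/
abbrev Bideg : Type := ℤ × ZMod 2

/-- The sign `(-1)^{ε ε'}` attached to the parities of two bidegrees. -/
def Bideg.sign (p q : Bideg) : ℤ := (-1) ^ (p.2 * q.2).val

theorem isInternal_of_coaction {M S : Type*} [AddCommGroup M] [SetLike S M]
    [AddSubmonoidClass S M] (𝓜 : Bideg → S) (c : M →+ (Bideg →₀ M))
    (hc : ∀ p, ∀ m ∈ 𝓜 p, c m = Finsupp.single p m)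
    (hspan : ∀ m, m ∈ AddSubmonoid.closure (⋃ p, (𝓜 p : Set M))) :
    DirectSum.IsInternal 𝓜 := by
  have key : ∀ x : DirectSum Bideg (fun p => 𝓜 p), ∀ q,
      c (DirectSum.coeAddMonoidHom 𝓜 x) q = (x q : M) := by
    intro x q
    induction x using DirectSum.induction_on with
    | zero => simp
    | of p y =>
      rw [DirectSum.coeAddMonoidHom_of, hc p _ y.2]
      by_cases h : p = q
      · subst h; simp
      · rw [Finsupp.single_eq_of_ne (Ne.symm h), DirectSum.of_eq_of_ne _ _ _ (Ne.symm h)]; simp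
    | add x y hx hy => simp [hx, hy]
  refine ⟨?_, ?_⟩
  · intro x y hxy
    refine DFinsupp.ext fun q => Subtype.ext ?_
    have h1 := key x q
    have h2 := key y q
    exact h1.symm.trans ((congrArg (fun z => c z q) hxy).trans h2)
  · intro m
    have : AddSubmonoid.closure (⋃ p, (𝓜 p : Set M)) ≤
        AddMonoidHom.mrange (DirectSum.coeAddMonoidHom 𝓜) := by
      rw [AddSubmonoid.closure_le]
      intro z hz
      obtain ⟨p, hp⟩ := Set.mem_iUnion.1 hz
      exact ⟨DirectSum.of (fun p => 𝓜 p) p ⟨z, hp⟩, by simp⟩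
    exact this (hspan m)

/-- The additive map sending `m = ∑ m_p` to the family of its homogeneous components. -/
noncomputable def coaction {M S : Type*} [AddCommGroup M] [SetLike S M]
    [AddSubmonoidClass S M] (𝓜 : Bideg → S) (h : DirectSum.IsInternal 𝓜) :
    M →+ (Bideg →₀ M) :=
  (DirectSum.toAddMonoid fun p => (Finsupp.singleAddHom p).comp
    (AddSubmonoidClass.subtype (𝓜 p))).comp
    (AddEquiv.ofBijective (DirectSum.coeAddMonoidHom 𝓜) h).symm.toAddMonoidHom

theorem coaction_of_mem {M S : Type*} [AddCommGroup M] [SetLike S M]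
    [AddSubmonoidClass S M] (𝓜 : Bideg → S) (h : DirectSum.IsInternal 𝓜) {p : Bideg} {m : M}
    (hm : m ∈ 𝓜 p) : coaction 𝓜 h m = Finsupp.single p m := by
  have : (AddEquiv.ofBijective (DirectSum.coeAddMonoidHom 𝓜) h).symm m =
      DirectSum.of (fun p => 𝓜 p) p ⟨m, hm⟩ := by
    rw [AddEquiv.symm_apply_eq]
    exact (DirectSum.coeAddMonoidHom_of 𝓜 p ⟨m, hm⟩).symm
  simp [coaction, this]

theorem mem_closure_of_isInternal {M S : Type*} [AddCommGroup M] [SetLike S M]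
    [AddSubmonoidClass S M] (𝓜 : Bideg → S) (h : DirectSum.IsInternal 𝓜) (m : M) :
    m ∈ AddSubmonoid.closure (⋃ p, (𝓜 p : Set M)) := by
  obtain ⟨x, rfl⟩ := h.2 m
  induction x using DirectSum.induction_on with
  | zero => simp
  | of p y =>
    rw [DirectSum.coeAddMonoidHom_of]
    exact AddSubmonoid.subset_closure (Set.mem_iUnion.2 ⟨p, y.2⟩)
  | add x y hx hy => rw [map_add]; exact add_mem hx hy

section GradedModules

variable {k : Type u} [CommRing k] {A : Type u} [Ring A] [Algebra k A]

/-- A `ℤ`-graded left supermodule over the algebra `A` with bigrading `𝒜`. -/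
structure GrSMod (𝒜 : Bideg → Submodule k A) where
  carrier : Type u
  [addCommGroup : AddCommGroup carrier]
  [module : Module A carrier]
  gr : Bideg → AddSubgroup carrier
  isInternal : DirectSum.IsInternal gr
  smul_mem : ∀ {p q : Bideg} {a : A} {m : carrier},
    a ∈ 𝒜 p → m ∈ gr q → a • m ∈ gr (p + q)

attribute [instance] GrSMod.addCommGroup GrSMod.module

namespace GrSMod

/-- Even homomorphisms: `A`-linear maps preserving degree and parity. -/
@[ext]
structure Hom {𝒜 : Bideg → Submodule k A} (M N : GrSMod 𝒜) where
  toLin : M.carrier →ₗ[A] N.carrier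
  map_mem : ∀ {p : Bideg} {m : M.carrier}, m ∈ M.gr p → toLin m ∈ N.gr p

instance (𝒜 : Bideg → Submodule k A) : Category (GrSMod 𝒜) where
  Hom M N := Hom M N
  id M := ⟨LinearMap.id, fun h => h⟩
  comp f g := ⟨g.toLin.comp f.toLin, fun h => g.map_mem (f.map_mem h)⟩

/-- The degree shift: `(M{s})_{i,ε} = M_{i+s,ε}`, with the same action. -/
def shift (𝒜 : Bideg → Submodule k A) (s : ℤ) : GrSMod 𝒜 ⥤ GrSMod 𝒜 where
  obj M :=
    { carrier := M.carrier
      gr := fun p => M.gr (p.1 + s, p.2)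
      isInternal := by
        refine isInternal_of_coaction _
          ((Finsupp.mapDomain.addMonoidHom fun p : Bideg => ((p.1 - s, p.2) : Bideg)).comp
            (coaction M.gr M.isInternal)) (fun p m hm => ?_) (fun m => ?_)
        · simp [coaction_of_mem M.gr M.isInternal hm]
        · refine AddSubmonoid.closure_mono ?_ (mem_closure_of_isInternal M.gr M.isInternal m)
          intro z hz
          obtain ⟨p, hp⟩ := Set.mem_iUnion.1 hz
          refine Set.mem_iUnion.2 ⟨(p.1 - s, p.2), ?_⟩
          simpa using hp
      smul_mem := fun {p q a m} ha hm => by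
        have := M.smul_mem ha hm
        rwa [show p + (q.1 + s, q.2) = ((p + q).1 + s, (p + q).2) from
          Prod.ext (add_assoc _ _ _).symm rfl] at this }
  map f := ⟨f.toLin, fun h => f.map_mem h⟩

/-- The finitely generated graded supermodules. -/
def IsFG (𝒜 : Bideg → Submodule k A) : ObjectProperty (GrSMod 𝒜) :=
  fun M => Module.Finite A M.carrier

end GrSMod

/-- The category `A-mod` of finitely generated graded supermodules, with even homomorphisms. -/
abbrev FGMod (𝒜 : Bideg → Submodule k A) := (GrSMod.IsFG 𝒜).FullSubcategory

/-- The degree shift on finitely generated graded supermodules. -/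
def FGMod.shift (𝒜 : Bideg → Submodule k A) (s : ℤ) : FGMod 𝒜 ⥤ FGMod 𝒜 :=
  ObjectProperty.lift _ ((GrSMod.IsFG 𝒜).ι ⋙ GrSMod.shift 𝒜 s) fun M => M.property

variable {A' : Type u} [Ring A'] [Algebra k A']

/-- The functor between categories of finitely generated graded supermodules induced by a
functor that preserves finite generation. -/
def FGMod.restrict {𝒜 : Bideg → Submodule k A} {𝒜' : Bideg → Submodule k A'}
    (G : GrSMod 𝒜 ⥤ GrSMod 𝒜')
    (hG : ∀ M, GrSMod.IsFG 𝒜 M → GrSMod.IsFG 𝒜' (G.obj M)) : FGMod 𝒜 ⥤ FGMod 𝒜' :=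
  ObjectProperty.lift _ ((GrSMod.IsFG 𝒜).ι ⋙ G) fun M => hG _ M.property

variable {𝒜 : Bideg → Submodule k A} {𝒜' : Bideg → Submodule k A'}

/-- Restriction along a homomorphism of graded superalgebras. -/
def GrSMod.res (φ : A →ₐ[k] A') (hφ : ∀ p, ∀ a ∈ 𝒜 p, φ a ∈ 𝒜' p) :
    GrSMod 𝒜' ⥤ GrSMod 𝒜 where
  obj M :=
    { carrier := M.carrier
      module := Module.compHom M.carrier φ.toRingHom
      gr := M.gr
      isInternal := M.isInternal
      smul_mem := fun {p _ a _} ha hm => M.smul_mem (hφ p a ha) hm }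
  map {M N} f :=
    { toLin :=
        letI := Module.compHom M.carrier φ.toRingHom
        letI := Module.compHom N.carrier φ.toRingHom
        { toFun := f.toLin
          map_add' := f.toLin.map_add
          map_smul' := fun a m => f.toLin.map_smul (φ a) m }
      map_mem := fun h => f.map_mem h }

section Induction

variable (φ : A →ₐ[k] A') (M : Type u) [AddCommGroup M] [Module A M]

/-- The `A'`-submodule of `A' ⊗_ℤ M` spanned by all `a' φ(a) ⊗ m - a' ⊗ a m`. -/
def balancedRel : Submodule A' (A' ⊗[ℤ] M) :=
  Submodule.span A' {z | ∃ (a' : A') (a : A) (m : M),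
    z = (a' * φ a) ⊗ₜ[ℤ] m - a' ⊗ₜ[ℤ] (a • m)}

/-- The tensor product `A' ⊗_A M`, where `A` acts on the right of `A'` through `φ`. -/
abbrev BalTensor : Type u := (A' ⊗[ℤ] M) ⧸ balancedRel φ M

variable {M} in
/-- The element `a' ⊗ m` of `A' ⊗_A M`. -/
def BalTensor.tmul (a' : A') (m : M) : BalTensor φ M :=
  (balancedRel φ M).mkQ (a' ⊗ₜ[ℤ] m)

namespace BalTensor

variable {M}

theorem add_tmul (a b : A') (m : M) : tmul φ (a + b) m = tmul φ a m + tmul φ b m := by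
  simp [tmul, TensorProduct.add_tmul]

theorem tmul_add (a : A') (m n : M) : tmul φ a (m + n) = tmul φ a m + tmul φ a n := by
  simp [tmul, TensorProduct.tmul_add]

theorem smul_tmul' (b a : A') (m : M) : b • tmul φ a m = tmul φ (b * a) m := rfl

theorem tmul_smul (a' : A') (a : A) (m : M) : tmul φ (a' * φ a) m = tmul φ a' (a • m) := by
  rw [← sub_eq_zero, tmul, tmul, ← map_sub, Submodule.mkQ_apply, Submodule.Quotient.mk_eq_zero]
  exact Submodule.subset_span ⟨a', a, m, rfl⟩

@[elab_as_elim]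
theorem induction {P : BalTensor φ M → Prop} (z : BalTensor φ M)
    (h0 : P 0) (ht : ∀ a m, P (tmul φ a m)) (ha : ∀ x y, P x → P y → P (x + y)) : P z := by
  obtain ⟨w, rfl⟩ := (balancedRel φ M).mkQ_surjective z
  induction w using TensorProduct.induction_on with
  | zero => simpa using h0
  | tmul a m => exact ht a m
  | add x y hx hy => rw [map_add]; exact ha _ _ hx hy

theorem lift_aux {N : Type*} [AddCommGroup N] (f : A' →+ M →+ N) (r : ℤ) (a : A') (m : M) :
    f (r • a) m = f a (r • m) := by
  rw [map_zsmul, map_zsmul, AddMonoidHom.zsmul_apply]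

/-- The additive version of the universal property of `A' ⊗_A M`. -/
def lift {N : Type*} [AddCommGroup N] (f : A' →+ M →+ N)
    (hf : ∀ a' a m, f (a' * φ a) m = f a' (a • m)) : BalTensor φ M →+ N :=
  QuotientAddGroup.lift (balancedRel φ M).toAddSubgroup
    (TensorProduct.liftAddHom f (lift_aux f)) <| by
    intro x hx
    have : ∀ b : A', TensorProduct.liftAddHom f (lift_aux f) (b • x) = 0 := by
      refine Submodule.span_induction (p := fun x _ => ∀ b : A',
        TensorProduct.liftAddHom f (lift_aux f) (b • x) = 0) ?_ ?_ ?_ ?_ hx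
      · rintro _ ⟨a', a, m, rfl⟩ b
        rw [smul_sub, TensorProduct.smul_tmul', TensorProduct.smul_tmul', map_sub,
          TensorProduct.liftAddHom_tmul, TensorProduct.liftAddHom_tmul, smul_eq_mul, smul_eq_mul,
          ← mul_assoc, hf, sub_self]
      · intro b; rw [smul_zero, map_zero]
      · intro x y _ _ hx hy b; rw [smul_add, map_add, hx, hy, add_zero]
      · intro c x _ hx b; rw [smul_smul]; exact hx _
    simpa using this 1

theorem lift_tmul {N : Type*} [AddCommGroup N] (f : A' →+ M →+ N)
    (hf : ∀ a' a m, f (a' * φ a) m = f a' (a • m)) (a' : A') (m : M) :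
    lift φ f hf (tmul φ a' m) = f a' m := rfl

/-- Functoriality of `A' ⊗_A M` in `M`. -/
def map {N : Type u} [AddCommGroup N] [Module A N] (f : M →ₗ[A] N) :
    BalTensor φ M →ₗ[A'] BalTensor φ N where
  toFun := lift φ (AddMonoidHom.mk' (fun a' => AddMonoidHom.mk' (fun m => tmul φ a' (f m))
      (fun m n => by rw [map_add, tmul_add]))
      (fun a b => by ext m; exact add_tmul φ a b (f m)))
      (fun a' a m => by
        change tmul φ _ (f m) = tmul φ _ (f (a • m))
        rw [map_smul, tmul_smul])
  map_add' := map_add _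
  map_smul' b z := by
    refine induction φ z (by simp) (fun a m => ?_) (fun x y hx hy => ?_)
    · rfl
    · rw [smul_add, map_add, hx, hy, map_add]; simp

theorem map_tmul {N : Type u} [AddCommGroup N] [Module A N] (f : M →ₗ[A] N) (a' : A') (m : M) :
    map φ f (tmul φ a' m) = tmul φ a' (f m) := rfl

theorem map_id (z : BalTensor φ M) : map φ (LinearMap.id (R := A) (M := M)) z = z :=
  induction φ z (map_zero _) (fun _ _ => rfl) (fun x y hx hy => by rw [map_add, hx, hy])

theorem map_comp {N P : Type u} [AddCommGroup N] [Module A N] [AddCommGroup P] [Module A P]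
    (g : N →ₗ[A] P) (f : M →ₗ[A] N) (z : BalTensor φ M) :
    map φ (g.comp f) z = map φ g (map φ f z) :=
  induction φ z (by simp only [map_zero]) (fun _ _ => rfl)
    (fun x y hx hy => by simp only [map_add, hx, hy])

end BalTensor

end Induction

/-- The grading on `A' ⊗_A M`: the component of bidegree `p` is spanned by the `a' ⊗ m` with
`a'` and `m` homogeneous of bidegrees adding up to `p`. -/
def BalTensor.gr (φ : A →ₐ[k] A') (𝒜' : Bideg → Submodule k A') (M : GrSMod 𝒜) (p : Bideg) :
    AddSubgroup (BalTensor φ M.carrier) :=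
  AddSubgroup.closure {z | ∃ q r : Bideg, ∃ a' ∈ 𝒜' q, ∃ m ∈ M.gr r,
    q + r = p ∧ z = BalTensor.tmul φ a' m}

/-- The map recording the homogeneous components of an element of `A' ⊗_A M`. -/
noncomputable def BalTensor.coactionAux {φ : A →ₐ[k] A'} (h' : DirectSum.IsInternal 𝒜')
    (M : GrSMod 𝒜) : A' →+ M.carrier →+ (Bideg →₀ BalTensor φ M.carrier) :=
  (((Finsupp.liftAddHom fun p => AddMonoidHom.flip (Finsupp.liftAddHom fun q =>
    AddMonoidHom.mk' (fun m => AddMonoidHom.mk'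
      (fun a' => Finsupp.single (p + q) (tmul φ a' m))
      (fun a b => by rw [add_tmul, Finsupp.single_add]))
      (fun m n => by ext1 a; simp [tmul_add]))).comp
    (coaction 𝒜' h')).flip.comp (coaction M.gr M.isInternal)).flip

theorem BalTensor.coactionAux_of_mem {φ : A →ₐ[k] A'} (h' : DirectSum.IsInternal 𝒜')
    (M : GrSMod 𝒜) {p q : Bideg} {a : A'} {m : M.carrier} (ha : a ∈ 𝒜' p) (hm : m ∈ M.gr q) :
    coactionAux (φ := φ) h' M a m = Finsupp.single (p + q) (tmul φ a m) := by
  simp only [coactionAux, AddMonoidHom.flip_apply, AddMonoidHom.comp_apply,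
    coaction_of_mem _ h' ha, coaction_of_mem _ M.isInternal hm, Finsupp.liftAddHom_apply_single,
    AddMonoidHom.mk'_apply]

theorem BalTensor.isInternal {φ : A →ₐ[k] A'} (hφ : ∀ p, ∀ a ∈ 𝒜 p, φ a ∈ 𝒜' p)
    (h : DirectSum.IsInternal 𝒜) [SetLike.GradedMonoid 𝒜'] (h' : DirectSum.IsInternal 𝒜')
    (M : GrSMod 𝒜) : DirectSum.IsInternal (BalTensor.gr φ 𝒜' M) := by
  have ind : ∀ {X : Type u} {S : Type u} [AddCommGroup X] [SetLike S X] [AddSubmonoidClass S X]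
      {𝓜 : Bideg → S} (_ : DirectSum.IsInternal 𝓜) (P : X → Prop), P 0 →
      (∀ p, ∀ x ∈ 𝓜 p, P x) → (∀ x y, P x → P y → P (x + y)) → ∀ x, P x := by
    intro X S _ _ _ 𝓜 hi P h0 hm ha x
    refine AddSubmonoid.closure_induction (motive := fun x _ => P x) ?_ h0
      (fun x y _ _ => ha x y) (mem_closure_of_isInternal 𝓜 hi x)
    intro z hz
    obtain ⟨p, hp⟩ := Set.mem_iUnion.1 hz
    exact hm p z hp
  have bal : ∀ a' a m, coactionAux (φ := φ) h' M (a' * φ a) m =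
      coactionAux (φ := φ) h' M a' (a • m) := by
    intro a' a m
    refine ind h' (fun a' => coactionAux (φ := φ) h' M (a' * φ a) m =
      coactionAux (φ := φ) h' M a' (a • m)) (by simp) (fun p a' ha' => ?_)
      (fun x y hx hy => by simp only [add_mul, map_add, AddMonoidHom.add_apply, hx, hy]) a'
    refine ind h (fun a => coactionAux (φ := φ) h' M (a' * φ a) m =
      coactionAux (φ := φ) h' M a' (a • m)) (by simp) (fun q a ha => ?_)
      (fun x y hx hy => by
        simp only [mul_add, add_smul, map_add, AddMonoidHom.add_apply, hx, hy]) a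
    refine ind M.isInternal (fun m => coactionAux (φ := φ) h' M (a' * φ a) m =
      coactionAux (φ := φ) h' M a' (a • m)) (by simp) (fun r m hm => ?_)
      (fun x y hx hy => by simp only [smul_add, map_add, hx, hy]) m
    rw [coactionAux_of_mem h' M (SetLike.mul_mem_graded ha' (hφ q a ha)) hm,
      coactionAux_of_mem h' M ha' (M.smul_mem ha hm), tmul_smul, add_assoc]
  refine isInternal_of_coaction _ (lift φ (coactionAux h' M) bal) (fun p z hz => ?_) (fun z => ?_)
  · refine AddSubgroup.closure_induction (p := fun z _ => lift φ (coactionAux h' M) bal z =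
      Finsupp.single p z) ?_ (by simp) (fun x y _ _ hx hy => by rw [map_add, hx, hy,
        Finsupp.single_add]) (fun x _ hx => by rw [map_neg, hx, Finsupp.single_neg]) hz
    rintro _ ⟨q, r, a', ha', m, hm, rfl, rfl⟩
    rw [lift_tmul, coactionAux_of_mem h' M ha' hm]
  · refine induction φ z (zero_mem _) (fun a' m => ?_) (fun x y hx hy => add_mem hx hy)
    refine ind h' (fun a' => tmul φ a' m ∈ _) ?_ (fun p a' ha' => ?_)
      (fun x y hx hy => by rw [add_tmul]; exact add_mem hx hy) a'
    · have : tmul φ 0 m = 0 := by simp [tmul]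
      rw [this]; exact zero_mem _
    refine ind M.isInternal (fun m => tmul φ a' m ∈ _) ?_ (fun q m hm => ?_)
      (fun x y hx hy => by rw [tmul_add]; exact add_mem hx hy) m
    · have : tmul φ a' (0 : M.carrier) = 0 := by simp [tmul]
      rw [this]; exact zero_mem _
    exact AddSubmonoid.subset_closure (Set.mem_iUnion.2 ⟨p + q,
      AddSubgroup.subset_closure ⟨p, q, a', ha', m, hm, rfl, rfl⟩⟩)

/-- Induction `M ↦ A' ⊗_A M` along a homomorphism of graded superalgebras. -/
def GrSMod.ind (φ : A →ₐ[k] A') (hφ : ∀ p, ∀ a ∈ 𝒜 p, φ a ∈ 𝒜' p)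
    (h : DirectSum.IsInternal 𝒜) [SetLike.GradedMonoid 𝒜'] (h' : DirectSum.IsInternal 𝒜') :
    GrSMod 𝒜 ⥤ GrSMod 𝒜' where
  obj M :=
    { carrier := BalTensor φ M.carrier
      gr := BalTensor.gr φ 𝒜' M
      isInternal := BalTensor.isInternal hφ h h' M
      smul_mem := fun {p q b z} hb hz => by
        refine AddSubgroup.closure_induction (p := fun z _ => b • z ∈ BalTensor.gr φ 𝒜' M (p + q))
          ?_ (by rw [smul_zero]; exact zero_mem _)
          (fun x y _ _ hx hy => by rw [smul_add]; exact add_mem hx hy)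
          (fun x _ hx => by rw [smul_neg]; exact neg_mem hx) hz
        rintro _ ⟨r, s, a', ha', m, hm, rfl, rfl⟩
        exact AddSubgroup.subset_closure ⟨p + r, s, b * a', SetLike.mul_mem_graded hb ha', m, hm,
          add_assoc _ _ _, rfl⟩ }
  map {M N} f :=
    { toLin := BalTensor.map φ f.toLin
      map_mem := fun {p z} hz => by
        refine AddSubgroup.closure_induction
          (p := fun z _ => BalTensor.map φ f.toLin z ∈ BalTensor.gr φ 𝒜' N p)
          ?_ (by rw [map_zero]; exact zero_mem _)
          (fun x y _ _ hx hy => by rw [map_add]; exact add_mem hx hy)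
          (fun x _ hx => by rw [map_neg]; exact neg_mem hx) hz
        rintro _ ⟨r, s, a', ha', m, hm, rfl, rfl⟩
        exact AddSubgroup.subset_closure ⟨r, s, a', ha', f.toLin m, f.map_mem hm, rfl, rfl⟩ }
  map_id _ := Hom.ext (LinearMap.ext fun z => BalTensor.map_id φ z)
  map_comp f g := Hom.ext (LinearMap.ext fun z => BalTensor.map_comp φ g.toLin f.toLin z)

end GradedModules

/-- An `ℕ`-graded Frobenius superalgebra over `k`, free over `k`, with a homogeneous parity
preserving trace map of degree `-δ` and a (finite) homogeneous basis. -/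
structure FrobSuperalgebra (k : Type u) [CommRing k] where
  carrier : Type u
  [ring : Ring carrier]
  [algebra : Algebra k carrier]
  gr : Bideg → Submodule k carrier
  [gradedAlgebra : GradedAlgebra gr]
  /-- The `ℤ`-grading is concentrated in nonnegative degrees. -/
  gr_neg : ∀ (i : ℤ) (ε : ZMod 2), i < 0 → gr (i, ε) = ⊥
  δ : ℕ
  tr : carrier →ₗ[k] k
  tr_homogeneous : ∀ p : Bideg, p ≠ ((δ : ℤ), 0) → ∀ f ∈ gr p, tr f = 0
  /-- The linear map determined on homogeneous elements by `f ↦ (g ↦ (-1)^{f̄ ḡ} tr (g f))`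
  is an isomorphism. -/
  frob : carrier ≃ₗ[k] Module.Dual k carrier
  frob_apply : ∀ (p q : Bideg), ∀ f ∈ gr p, ∀ g ∈ gr q,
    frob f g = (p.sign q : k) * tr (g * f)
  ι : Type u
  [fintype : Fintype ι]
  [decidableEq : DecidableEq ι]
  basis : Module.Basis ι k carrier
  basisDeg : ι → Bideg
  basis_mem : ∀ b, basis b ∈ gr (basisDeg b)

namespace FrobSuperalgebra

attribute [instance] ring algebra gradedAlgebra fintype decidableEq

variable {k : Type u} [CommRing k] (F : FrobSuperalgebra k)

/-- The top bidegree: degree `δ`, even parity. -/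
def top : Bideg := (F.δ, 0)

/-- The linear map `f ↦ (g ↦ tr (f g))`. -/
noncomputable def trMul : F.carrier →ₗ[k] Module.Dual k F.carrier :=
  (LinearMap.mul k F.carrier).compr₂ F.tr

@[simp]
theorem trMul_apply (f g : F.carrier) : F.trMul f g = F.tr (f * g) := rfl

/-- The Nakayama automorphism `ψ`: `ψ f` is the element of `F` with
`tr (f g) = (-1)^{f̄ ḡ} tr (g (ψ f))` for all `g`. -/
noncomputable def nakayama : F.carrier →ₗ[k] F.carrier :=
  F.frob.symm.toLinearMap ∘ₗ F.trMul

theorem frob_nakayama (f g : F.carrier) : F.frob (F.nakayama f) g = F.tr (f * g) := by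
  simp [nakayama]

theorem hom_ind (P : F.carrier → Prop) (h0 : P 0) (hm : ∀ p, ∀ f ∈ F.gr p, P f)
    (ha : ∀ f g, P f → P g → P (f + g)) (f : F.carrier) : P f :=
  DirectSum.Decomposition.inductionOn F.gr h0 (fun m => hm _ _ m.2) ha f

theorem tr_mul_eq_zero {p q : Bideg} {f g : F.carrier} (hf : f ∈ F.gr p) (hg : g ∈ F.gr q)
    (h : p + q ≠ F.top) : F.tr (f * g) = 0 :=
  F.tr_homogeneous _ h _ (SetLike.mul_mem_graded hf hg)

theorem parity_eq {p q : Bideg} (h : p + q = F.top) : p.2 = q.2 := by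
  have : p.2 + q.2 = 0 := congrArg Prod.snd h
  generalize p.2 = a at *
  generalize q.2 = b at *
  revert a b; decide

theorem frob_apply' {q : Bideg} {g : F.carrier} (hg : g ∈ F.gr q) (f : F.carrier) :
    F.frob f g = (q.sign q : k) * F.tr (g * f) := by
  refine F.hom_ind (fun f => F.frob f g = (q.sign q : k) * F.tr (g * f)) (by simp) ?_ ?_ f
  · intro p f hf
    rw [F.frob_apply p q f hf g hg]
    by_cases h : q + p = F.top
    · rw [Bideg.sign, Bideg.sign, F.parity_eq h]
    · rw [F.tr_mul_eq_zero hg hf h, mul_zero, mul_zero]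
  · intro f f' hf hf'
    simp only [map_add, LinearMap.add_apply, mul_add, hf, hf']

theorem sign_mul_self (p q : Bideg) : ((p.sign q : ℤ) : k) * ((p.sign q : ℤ) : k) = 1 := by
  rw [← Int.cast_mul, Bideg.sign, ← mul_pow]; simp

theorem dual_ext {u v : Module.Dual k F.carrier} (h : ∀ q, ∀ g ∈ F.gr q, u g = v g) : u = v :=
  LinearMap.ext fun g => F.hom_ind (fun g => u g = v g) (by simp) h
    (fun f g hf hg => by rw [map_add, map_add, hf, hg]) g

/-- The homogeneous component of bidegree `p`. -/
noncomputable def proj (p : Bideg) : F.carrier →ₗ[k] F.carrier := GradedAlgebra.proj F.gr p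

theorem proj_mem (p : Bideg) (f : F.carrier) : F.proj p f ∈ F.gr p := by
  simp [proj]

theorem proj_same {p : Bideg} {f : F.carrier} (hf : f ∈ F.gr p) : F.proj p f = f := by
  simp [proj, DirectSum.decompose_of_mem_same _ hf]

theorem proj_ne {p q : Bideg} {f : F.carrier} (hf : f ∈ F.gr p) (h : p ≠ q) :
    F.proj q f = 0 := by
  simp [proj, DirectSum.decompose_of_mem_ne _ hf h]

theorem tr_mul_proj {q : Bideg} {g : F.carrier} (hg : g ∈ F.gr q) (p : Bideg) (f : F.carrier) :
    F.tr (g * F.proj p f) = if q + p = F.top then F.tr (g * f) else 0 := by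
  refine F.hom_ind (fun f => F.tr (g * F.proj p f) =
    if q + p = F.top then F.tr (g * f) else 0) (by simp) ?_ ?_ f
  · intro r f hf
    by_cases hr : r = p
    · subst hr
      rw [F.proj_same hf]
      split_ifs with h
      · rfl
      · exact F.tr_mul_eq_zero hg hf h
    · rw [F.proj_ne hf hr, mul_zero, map_zero]
      split_ifs with h
      · refine (F.tr_mul_eq_zero hg hf fun h' => hr ?_).symm
        exact add_left_cancel (h'.trans h.symm)
      · rfl
  · intro f f' hf hf'
    simp only [map_add, mul_add, hf, hf']
    split_ifs <;> simp

theorem tr_proj_mul {q : Bideg} {g : F.carrier} (hg : g ∈ F.gr q) (p : Bideg) (f : F.carrier) :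
    F.tr (F.proj p f * g) = if p + q = F.top then F.tr (f * g) else 0 := by
  refine F.hom_ind (fun f => F.tr (F.proj p f * g) =
    if p + q = F.top then F.tr (f * g) else 0) (by simp) ?_ ?_ f
  · intro r f hf
    by_cases hr : r = p
    · subst hr
      rw [F.proj_same hf]
      split_ifs with h
      · rfl
      · exact F.tr_mul_eq_zero hf hg h
    · rw [F.proj_ne hf hr, zero_mul, map_zero]
      split_ifs with h
      · refine (F.tr_mul_eq_zero hf hg fun h' => hr ?_).symm
        exact add_right_cancel (h'.trans h.symm)
      · rfl
  · intro f f' hf hf'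
    simp only [map_add, add_mul, hf, hf']
    split_ifs <;> simp

theorem nakayama_mem {p : Bideg} {f : F.carrier} (hf : f ∈ F.gr p) : F.nakayama f ∈ F.gr p := by
  have : F.proj p (F.nakayama f) = F.nakayama f := by
    apply F.frob.injective
    refine F.dual_ext fun q g hg => ?_
    rw [F.frob_apply' hg, F.tr_mul_proj hg]
    by_cases h : q + p = F.top
    · rw [if_pos h, ← F.frob_apply' hg]
    · rw [if_neg h, frob_nakayama, F.tr_mul_eq_zero hf hg (by rwa [add_comm]), mul_zero]
  rw [← this]
  exact F.proj_mem _ _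

theorem trMul_bijective : Function.Bijective F.trMul := by
  have : Module.Finite k F.carrier := Module.Finite.of_basis F.basis
  have : Module.Free k F.carrier := Module.Free.of_basis F.basis
  have hflip : Function.Bijective F.trMul.flip := by
    constructor
    · rw [injective_iff_map_eq_zero]
      intro f hf
      apply F.frob.injective
      rw [map_zero]
      refine F.dual_ext fun q g hg => ?_
      have : F.tr (g * f) = 0 := LinearMap.congr_fun hf g
      rw [F.frob_apply' hg, this, mul_zero]; rfl
    · intro u
      -- twist by the parity involution
      obtain ⟨v, hv⟩ : ∃ v : Module.Dual k F.carrier, ∀ q, ∀ g ∈ F.gr q,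
          v g = (q.sign q : k) * u g := by
        refine ⟨(DirectSum.toModule k Bideg k fun q => ((q.sign q : ℤ) : k) •
          (u ∘ₗ (F.gr q).subtype)) ∘ₗ (DirectSum.decomposeLinearEquiv F.gr).toLinearMap, ?_⟩
        intro q g hg
        lift g to F.gr q using hg
        simp
      refine ⟨F.frob.symm v, F.dual_ext fun q g hg => ?_⟩
      have h1 := F.frob_apply' hg (F.frob.symm v)
      rw [LinearEquiv.apply_symm_apply, hv q g hg] at h1
      have h2 := congrArg (fun z => (q.sign q : k) * z) h1
      simp only [← mul_assoc, sign_mul_self, one_mul] at h2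
      exact h2.symm
  exact (LinearMap.IsPerfPair.of_bijective _ hflip).bijective_right

/-- The left dual basis: `tr (bᵛ c) = δ_{b,c}`. -/
noncomputable def dualBasis (b : F.ι) : F.carrier :=
  (LinearEquiv.ofBijective F.trMul F.trMul_bijective).symm (F.basis.coord b)

theorem tr_dualBasis_mul (b c : F.ι) :
    F.tr (F.dualBasis b * F.basis c) = if b = c then 1 else 0 := by
  have h : F.trMul (F.dualBasis b) = F.basis.coord b :=
    (LinearEquiv.ofBijective F.trMul F.trMul_bijective).apply_symm_apply _
  rw [← trMul_apply, h, Module.Basis.coord_apply, Module.Basis.repr_self, Finsupp.single_apply]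
  simp [eq_comm]

theorem dualBasis_mem (b : F.ι) : F.dualBasis b ∈ F.gr (F.top - F.basisDeg b) := by
  have : F.proj (F.top - F.basisDeg b) (F.dualBasis b) = F.dualBasis b := by
    apply F.trMul_bijective.1
    refine F.basis.ext fun c => ?_
    rw [trMul_apply, trMul_apply, F.tr_proj_mul (F.basis_mem c)]
    split_ifs with h
    · rfl
    · rw [tr_dualBasis_mul, if_neg]
      rintro rfl
      exact h (sub_add_cancel _ _)
  rw [← this]
  exact F.proj_mem _ _

/-- The order `θ` of the Nakayama automorphism (`0` if the order is infinite). -/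
noncomputable def theta : ℕ := orderOf (G := Module.End k F.carrier) F.nakayama

end FrobSuperalgebra

namespace FrobSuperalgebra

variable {k : Type u} [CommRing k] (F : FrobSuperalgebra k) (n : ℕ)

/-- Generators of the affine wreath product algebra: polynomial generators `x_i`, the elements
`f_i` (`f` in the `i`-th tensor factor of `F^{⊗ n}`), and the permutations. -/
inductive WreathGen : Type u
  | x (i : Fin n)
  | f (i : Fin n) (a : F.carrier)
  | s (π : Equiv.Perm (Fin n))

/-- The free algebra on the generators. -/
abbrev WreathFree : Type u := FreeAlgebra k (F.WreathGen n)

variable {n}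

/-- The generator `x_i` of the free algebra. -/
def fx (i : Fin n) : F.WreathFree n := FreeAlgebra.ι k (.x i)

/-- The generator `f_i` of the free algebra. -/
def ff (i : Fin n) (a : F.carrier) : F.WreathFree n := FreeAlgebra.ι k (.f i a)

/-- The generator `π` of the free algebra. -/
def fs (π : Equiv.Perm (Fin n)) : F.WreathFree n := FreeAlgebra.ι k (.s π)

variable (n)

/-- The defining relations of the affine wreath product algebra. The relations `f_*` present the
superalgebra `F^{⊗ n}` (its tensor factors are copies of `F` that supercommute), the relations
`s_one`, `s_mul` present `k S_n`, the relation `x_comm` presents `k[x_1, …, x_n]`, and the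
remaining ones are the relations between these three algebras (it is enough to impose those
involving `F^{⊗ n}` on its generators `f_i`). -/
inductive WreathRel : F.WreathFree n → F.WreathFree n → Prop
  | f_add (i : Fin n) (a b : F.carrier) : WreathRel (F.ff i (a + b)) (F.ff i a + F.ff i b)
  | f_smul (i : Fin n) (r : k) (a : F.carrier) : WreathRel (F.ff i (r • a)) (r • F.ff i a)
  | f_one (i : Fin n) : WreathRel (F.ff i 1) 1
  | f_mul (i : Fin n) (a b : F.carrier) : WreathRel (F.ff i (a * b)) (F.ff i a * F.ff i b)
  | f_supercomm (i j : Fin n) (hij : i ≠ j) (p q : Bideg) (a b : F.carrier)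
      (ha : a ∈ F.gr p) (hb : b ∈ F.gr q) :
      WreathRel (F.ff i a * F.ff j b) ((p.sign q : k) • (F.ff j b * F.ff i a))
  | s_one : WreathRel (F.fs 1) 1
  | s_mul (π σ : Equiv.Perm (Fin n)) : WreathRel (F.fs (π * σ)) (F.fs π * F.fs σ)
  | x_comm (i j : Fin n) : WreathRel (F.fx i * F.fx j) (F.fx j * F.fx i)
  | f_x_self (i : Fin n) (a : F.carrier) :
      WreathRel (F.ff i a * F.fx i) (F.fx i * F.ff i (F.nakayama a))
  | f_x_ne (i j : Fin n) (hij : i ≠ j) (a : F.carrier) :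
      WreathRel (F.ff j a * F.fx i) (F.fx i * F.ff j a)
  | s_x_ne (i i' : Fin n) (hi : (i' : ℕ) = i + 1) (j : Fin n) (hj : j ≠ i) (hj' : j ≠ i') :
      WreathRel (F.fs (Equiv.swap i i') * F.fx j) (F.fx j * F.fs (Equiv.swap i i'))
  | s_x_self (i i' : Fin n) (hi : (i' : ℕ) = i + 1) :
      WreathRel (F.fs (Equiv.swap i i') * F.fx i)
        (F.fx i' * F.fs (Equiv.swap i i') -
          ∑ b : F.ι, F.ff i (F.basis b) * F.ff i' (F.dualBasis b))
  | s_f (π : Equiv.Perm (Fin n)) (i : Fin n) (a : F.carrier) :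
      WreathRel (F.fs π * F.ff i a) (F.ff (π i) a * F.fs π)

/-- The affine wreath product algebra `𝒜_n(F)`. -/
def Affine : Type u := RingQuot (F.WreathRel n)

noncomputable instance : Ring (F.Affine n) := inferInstanceAs (Ring (RingQuot (F.WreathRel n)))

noncomputable instance : Algebra k (F.Affine n) :=
  inferInstanceAs (Algebra k (RingQuot (F.WreathRel n)))

/-- The quotient map from the free algebra. -/
noncomputable def Affine.mk : F.WreathFree n →ₐ[k] F.Affine n := RingQuot.mkAlgHom k (F.WreathRel n)

variable {n}

/-- The element `x_i` of `𝒜_n(F)`. -/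
noncomputable def ax (i : Fin n) : F.Affine n := Affine.mk F n (F.fx i)

/-- The element `f_i` of `𝒜_n(F)`. -/
noncomputable def af (i : Fin n) (a : F.carrier) : F.Affine n := Affine.mk F n (F.ff i a)

/-- The element `π` of `𝒜_n(F)`. -/
noncomputable def as (π : Equiv.Perm (Fin n)) : F.Affine n := Affine.mk F n (F.fs π)

theorem Affine.rel {a b : F.WreathFree n} (h : F.WreathRel n a b) :
    Affine.mk F n a = Affine.mk F n b := RingQuot.mkAlgHom_rel k h

/-- The algebra homomorphism `f ↦ f_i`. -/
noncomputable def afHom (i : Fin n) : F.carrier →ₐ[k] F.Affine n :=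
  AlgHom.ofLinearMap
    { toFun := F.af i
      map_add' := fun a b => (Affine.rel F (.f_add i a b)).trans (map_add _ _ _)
      map_smul' := fun r a => (Affine.rel F (.f_smul i r a)).trans (map_smul _ _ _) }
    ((Affine.rel F (.f_one i)).trans (map_one _))
    (fun a b => (Affine.rel F (.f_mul i a b)).trans (map_mul _ _ _))

@[simp]
theorem afHom_apply (i : Fin n) (a : F.carrier) : F.afHom i a = F.af i a := rfl

/-- The universal property of `𝒜_n(F)`. -/
noncomputable def Affine.lift {R : Type*} [Ring R] [Algebra k R]
    (X : Fin n → R) (Φ : Fin n → F.carrier →ₐ[k] R) (S : Equiv.Perm (Fin n) →* R)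
    (h1 : ∀ i j, i ≠ j → ∀ p q, ∀ a ∈ F.gr p, ∀ b ∈ F.gr q,
      Φ i a * Φ j b = (p.sign q : k) • (Φ j b * Φ i a))
    (h2 : ∀ i j, X i * X j = X j * X i)
    (h3 : ∀ i a, Φ i a * X i = X i * Φ i (F.nakayama a))
    (h4 : ∀ i j, i ≠ j → ∀ a, Φ j a * X i = X i * Φ j a)
    (h5 : ∀ i i' : Fin n, (i' : ℕ) = i + 1 → ∀ j, j ≠ i → j ≠ i' →
      S (Equiv.swap i i') * X j = X j * S (Equiv.swap i i'))
    (h6 : ∀ i i' : Fin n, (i' : ℕ) = i + 1 →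
      S (Equiv.swap i i') * X i = X i' * S (Equiv.swap i i') -
        ∑ b : F.ι, Φ i (F.basis b) * Φ i' (F.dualBasis b))
    (h7 : ∀ π i a, S π * Φ i a = Φ (π i) a * S π) : F.Affine n →ₐ[k] R :=
  RingQuot.liftAlgHom k ⟨FreeAlgebra.lift k (fun g => match g with
    | .x i => X i
    | .f i a => Φ i a
    | .s π => S π), by
      intro a b h
      induction h with
      | f_add i a b => simp [ff]
      | f_smul i r a => simp [ff]
      | f_one i => simp [ff]
      | f_mul i a b => simp [ff]
      | f_supercomm i j hij p q a b ha hb => simpa [ff] using h1 i j hij p q a ha b hb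
      | s_one => simp [fs]
      | s_mul π σ => simp [fs]
      | x_comm i j => simpa [fx] using h2 i j
      | f_x_self i a => simpa [fx, ff] using h3 i a
      | f_x_ne i j hij a => simpa [fx, ff] using h4 i j hij a
      | s_x_ne i i' hi j hj hj' => simpa [fx, fs] using h5 i i' hi j hj hj'
      | s_x_self i i' hi => simpa [fx, fs, ff] using h6 i i' hi
      | s_f π i a => simpa [fs, ff] using h7 π i a⟩

/-- Monomials in homogeneous generators, with their bidegrees: `x_i` has bidegree `(δ, 0)`,
`f_i` has the bidegree of `f`, and permutations have bidegree `0`. -/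
inductive IsMonomial : Bideg → F.Affine n → Prop
  | one : IsMonomial 0 1
  | x_mul (i : Fin n) {p : Bideg} {a : F.Affine n} (h : IsMonomial p a) :
      IsMonomial (F.top + p) (F.ax i * a)
  | f_mul (i : Fin n) {q : Bideg} {f : F.carrier} (hf : f ∈ F.gr q) {p : Bideg} {a : F.Affine n}
      (h : IsMonomial p a) : IsMonomial (q + p) (F.af i f * a)
  | s_mul (π : Equiv.Perm (Fin n)) {p : Bideg} {a : F.Affine n} (h : IsMonomial p a) :
      IsMonomial p (F.as π * a)

variable (n) in
/-- The bigrading on `𝒜_n(F)`. -/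
noncomputable def affineGr (p : Bideg) : Submodule k (F.Affine n) :=
  Submodule.span k {a | F.IsMonomial p a}

theorem IsMonomial.mul {p q : Bideg} {a b : F.Affine n} (ha : F.IsMonomial p a)
    (hb : F.IsMonomial q b) : F.IsMonomial (p + q) (a * b) := by
  induction ha with
  | one => simpa using hb
  | x_mul i _ ih => rw [mul_assoc, add_assoc]; exact .x_mul i ih
  | f_mul i hf _ ih => rw [mul_assoc, add_assoc]; exact .f_mul i hf ih
  | s_mul π _ ih => rw [mul_assoc]; exact .s_mul π ih

instance affineGr_gradedMonoid : SetLike.GradedMonoid (F.affineGr n) where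
  one_mem := Submodule.subset_span .one
  mul_mem p q a b ha hb := by
    refine Submodule.span_induction₂ (p := fun a b _ _ => a * b ∈ F.affineGr n (p + q))
      (fun x y hx hy => Submodule.subset_span (IsMonomial.mul F hx hy))
      ?_ ?_ ?_ ?_ ?_ ?_ ha hb
    · intro y _; rw [zero_mul]; exact zero_mem _
    · intro y _; rw [mul_zero]; exact zero_mem _
    · intro x y z _ _ _ h h'; rw [add_mul]; exact add_mem h h'
    · intro x y z _ _ _ h h'; rw [mul_add]; exact add_mem h h'
    · intro r x y _ _ h; rw [smul_mul_assoc]; exact Submodule.smul_mem _ _ h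
    · intro r x y _ _ h; rw [mul_smul_comm]; exact Submodule.smul_mem _ _ h

theorem ax_mem (i : Fin n) : F.ax i ∈ F.affineGr n F.top := by
  have := IsMonomial.x_mul (F := F) i .one
  rw [mul_one, add_zero] at this
  exact Submodule.subset_span this

theorem af_mem (i : Fin n) {p : Bideg} {f : F.carrier} (hf : f ∈ F.gr p) :
    F.af i f ∈ F.affineGr n p := by
  have := IsMonomial.f_mul (F := F) i hf .one
  rw [mul_one, add_zero] at this
  exact Submodule.subset_span this

theorem as_mem (π : Equiv.Perm (Fin n)) : F.as π ∈ F.affineGr n 0 := by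
  have := IsMonomial.s_mul (F := F) π .one
  rw [mul_one] at this
  exact Submodule.subset_span this

theorem affine_ind (P : F.Affine n → Prop) (h0 : ∀ r, P (algebraMap k _ r))
    (hx : ∀ i, P (F.ax i)) (hf : ∀ i a, P (F.af i a)) (hs : ∀ π, P (F.as π))
    (hadd : ∀ a b, P a → P b → P (a + b)) (hmul : ∀ a b, P a → P b → P (a * b))
    (a : F.Affine n) : P a := by
  obtain ⟨w, rfl⟩ := RingQuot.mkAlgHom_surjective k (F.WreathRel n) a
  induction w using FreeAlgebra.induction with
  | grade0 r => rw [AlgHom.commutes]; exact h0 r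
  | grade1 g =>
    cases g with
    | x i => exact hx i
    | f i a => exact hf i a
    | s π => exact hs π
  | mul a b ha hb => rw [map_mul]; exact hmul _ _ ha hb
  | add a b ha hb => rw [map_add]; exact hadd _ _ ha hb

theorem affine_closure (a : F.Affine n) :
    a ∈ AddSubmonoid.closure (⋃ p, (F.affineGr n p : Set (F.Affine n))) := by
  have sub : ∀ {p a}, a ∈ F.affineGr n p →
      a ∈ AddSubmonoid.closure (⋃ p, (F.affineGr n p : Set (F.Affine n))) :=
    fun {p a} h => AddSubmonoid.subset_closure (Set.mem_iUnion.2 ⟨p, h⟩)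
  refine F.affine_ind (fun a => a ∈ AddSubmonoid.closure
    (⋃ p, (F.affineGr n p : Set (F.Affine n)))) ?_ (fun i => sub (F.ax_mem i)) ?_
    (fun π => sub (F.as_mem π)) (fun a b ha hb => add_mem ha hb) ?_ a
  · intro r
    rw [Algebra.algebraMap_eq_smul_one]
    exact sub (Submodule.smul_mem _ r (SetLike.GradedOne.one_mem (A := F.affineGr n)))
  · intro i a
    refine F.hom_ind (fun a => F.af i a ∈ AddSubmonoid.closure
      (⋃ p, (F.affineGr n p : Set (F.Affine n)))) ?_ (fun p f hf => sub (F.af_mem i hf)) ?_ a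
    · rw [← afHom_apply, map_zero]; exact zero_mem _
    · intro f g hf hg
      rw [← afHom_apply, map_add]; exact add_mem hf hg
  · intro a b ha hb
    induction ha using AddSubmonoid.closure_induction with
    | zero => rw [zero_mul]; exact zero_mem _
    | add x y _ _ hx hy => rw [add_mul]; exact add_mem hx hy
    | mem x hx =>
      induction hb using AddSubmonoid.closure_induction with
      | zero => rw [mul_zero]; exact zero_mem _
      | add y z _ _ hy hz => rw [mul_add]; exact add_mem hy hz
      | mem y hy =>
        obtain ⟨p, hp⟩ := Set.mem_iUnion.1 hx
        obtain ⟨q, hq⟩ := Set.mem_iUnion.1 hy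
        exact sub (SetLike.mul_mem_graded hp hq)

open AddMonoidAlgebra in
/-- The map recording the homogeneous components of `f_i`. -/
noncomputable def coactF (i : Fin n) : F.carrier →ₐ[k] AddMonoidAlgebra (F.Affine n) Bideg :=
  (DirectSum.toAlgebra k (fun p => F.gr p)
    (fun p => (lsingle p : F.Affine n →ₗ[k] AddMonoidAlgebra (F.Affine n) Bideg) ∘ₗ
      (F.afHom i).toLinearMap ∘ₗ (F.gr p).subtype)
    (by
      change single (0 : Bideg) (F.afHom i 1) = 1
      rw [map_one]; rfl)
    (fun {p q} a b => by
      change single (p + q) (F.afHom i (a * b)) =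
        single p (F.afHom i a) * single q (F.afHom i b)
      rw [single_mul_single, map_mul])).comp
  (DirectSum.decomposeAlgEquiv F.gr).toAlgHom

open AddMonoidAlgebra in
theorem coactF_of_mem (i : Fin n) {p : Bideg} {f : F.carrier} (hf : f ∈ F.gr p) :
    F.coactF i f = single p (F.af i f) := by
  lift f to F.gr p using hf
  simp only [coactF, AlgHom.comp_apply]
  change DirectSum.toAlgebra k _ _ _ _ (DirectSum.decompose F.gr (f : F.carrier)) = _
  rw [DirectSum.decompose_coe]
  change DirectSum.toAddMonoid _ (DirectSum.of (fun p => F.gr p) p f) = _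
  rw [DirectSum.toAddMonoid_of]
  rfl

open AddMonoidAlgebra in
variable (n) in
/-- The map recording the homogeneous components of an element of `𝒜_n(F)`. -/
noncomputable def affineCoact : F.Affine n →ₐ[k] AddMonoidAlgebra (F.Affine n) Bideg :=
  Affine.lift F (fun i => single F.top (F.ax i)) (fun i => F.coactF i)
    { toFun := fun π => single 0 (F.as π)
      map_one' := by
        rw [as, Affine.rel F .s_one, map_one]; rfl
      map_mul' := fun π σ => by
        rw [single_mul_single, as, Affine.rel F (.s_mul π σ), map_mul, add_zero]; rfl }
    (by
      intro i j hij p q a ha b hb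
      rw [F.coactF_of_mem i ha, F.coactF_of_mem j hb, single_mul_single, single_mul_single,
        add_comm q p, smul_single]
      congr 1
      simpa [af] using Affine.rel F (.f_supercomm i j hij p q a b ha hb))
    (by
      intro i j
      rw [single_mul_single, single_mul_single]
      congr 1
      simpa [ax] using Affine.rel F (.x_comm i j))
    (by
      intro i a
      refine F.hom_ind (fun a => F.coactF i a * single F.top (F.ax i) =
        single F.top (F.ax i) * F.coactF i (F.nakayama a)) (by simp) (fun p f hf => ?_)
        (fun f g hf hg => by simp only [map_add, add_mul, mul_add, hf, hg]) a
      rw [F.coactF_of_mem i hf, F.coactF_of_mem i (F.nakayama_mem hf), single_mul_single,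
        single_mul_single, add_comm]
      congr 1
      simpa [ax, af] using Affine.rel F (.f_x_self i f))
    (by
      intro i j hij a
      refine F.hom_ind (fun a => F.coactF j a * single F.top (F.ax i) =
        single F.top (F.ax i) * F.coactF j a) (by simp) (fun p f hf => ?_)
        (fun f g hf hg => by simp only [map_add, add_mul, mul_add, hf, hg]) a
      rw [F.coactF_of_mem j hf, single_mul_single, single_mul_single, add_comm]
      congr 1
      simpa [ax, af] using Affine.rel F (.f_x_ne i j hij f))
    (by
      intro i i' hi j hj hj'
      change single 0 _ * single _ _ = single _ _ * single 0 _
      rw [single_mul_single, single_mul_single, add_comm]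
      congr 1
      simpa [ax, as] using Affine.rel F (.s_x_ne i i' hi j hj hj'))
    (by
      intro i i' hi
      change single 0 _ * single _ _ = single _ _ * single 0 _ - _
      have : ∀ b, F.coactF i (F.basis b) * F.coactF i' (F.dualBasis b) =
          single F.top (F.af i (F.basis b) * F.af i' (F.dualBasis b)) := by
        intro b
        rw [F.coactF_of_mem i (F.basis_mem b), F.coactF_of_mem i' (F.dualBasis_mem b),
          single_mul_single, add_sub_cancel]
      rw [single_mul_single, single_mul_single, add_comm, Finset.sum_congr rfl fun b _ => this b]
      have h := Affine.rel F (.s_x_self i i' hi)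
      rw [map_mul, map_sub, map_mul, map_sum] at h
      simp only [map_mul] at h
      change single _ (Affine.mk F n _ * Affine.mk F n _) = _
      rw [h]
      change lsingle (R := k) _ _ = _
      rw [map_sub, map_sum]
      rfl)
    (by
      intro π i a
      change single 0 _ * _ = _ * single 0 _
      refine F.hom_ind (fun a => single 0 (F.as π) * F.coactF i a =
        F.coactF (π i) a * single 0 (F.as π)) (by simp) (fun p f hf => ?_)
        (fun f g hf hg => by simp only [map_add, add_mul, mul_add, hf, hg]) a
      rw [F.coactF_of_mem i hf, F.coactF_of_mem (π i) hf, single_mul_single, single_mul_single,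
        add_comm]
      congr 1
      simpa [as, af] using Affine.rel F (.s_f π i f))

theorem Affine.lift_ax {R : Type*} [Ring R] [Algebra k R]
    (X : Fin n → R) (Φ : Fin n → F.carrier →ₐ[k] R) (S : Equiv.Perm (Fin n) →* R)
    (h1 h2 h3 h4 h5 h6 h7) (i : Fin n) :
    Affine.lift F X Φ S h1 h2 h3 h4 h5 h6 h7 (F.ax i) = X i := by
  exact (RingQuot.liftAlgHom_mkAlgHom_apply k _ _ (F.fx i)).trans (by simp [fx])

theorem Affine.lift_af {R : Type*} [Ring R] [Algebra k R]
    (X : Fin n → R) (Φ : Fin n → F.carrier →ₐ[k] R) (S : Equiv.Perm (Fin n) →* R)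
    (h1 h2 h3 h4 h5 h6 h7) (i : Fin n) (a : F.carrier) :
    Affine.lift F X Φ S h1 h2 h3 h4 h5 h6 h7 (F.af i a) = Φ i a := by
  exact (RingQuot.liftAlgHom_mkAlgHom_apply k _ _ (F.ff i a)).trans (by simp [ff])

theorem Affine.lift_as {R : Type*} [Ring R] [Algebra k R]
    (X : Fin n → R) (Φ : Fin n → F.carrier →ₐ[k] R) (S : Equiv.Perm (Fin n) →* R)
    (h1 h2 h3 h4 h5 h6 h7) (π : Equiv.Perm (Fin n)) :
    Affine.lift F X Φ S h1 h2 h3 h4 h5 h6 h7 (F.as π) = S π := by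
  exact (RingQuot.liftAlgHom_mkAlgHom_apply k _ _ (F.fs π)).trans (by simp [fs])

open AddMonoidAlgebra in
theorem affineCoact_of_mem {p : Bideg} {a : F.Affine n} (ha : a ∈ F.affineGr n p) :
    F.affineCoact n a = single p a := by
  refine Submodule.span_induction (p := fun a _ => F.affineCoact n a = single p a) ?_ (by simp)
    (fun x y _ _ hx hy => by rw [map_add, hx, hy, single_add])
    (fun r x _ hx => by rw [map_smul, hx, smul_single]) ha
  intro a ha
  clear * - ha
  induction ha with
  | one => rw [map_one]; rfl
  | x_mul i _ ih =>
    rw [map_mul, ih, affineCoact, Affine.lift_ax, single_mul_single]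
  | f_mul i hf _ ih =>
    rw [map_mul, ih, affineCoact, Affine.lift_af, coactF_of_mem _ _ hf, single_mul_single]
  | s_mul π _ ih =>
    rw [map_mul, ih, affineCoact, Affine.lift_as]
    change single 0 _ * _ = _
    rw [single_mul_single, zero_add]

/-- `F_ψ^{(m)}`, restricted to even elements: the elements `c` fixed by `ψ` such that
`g c = c ψ^m(g)` for all `g` (the sign `(-1)^{c̄ ḡ}` is trivial for even `c`). -/
def IsTwistedCentral (m : ℕ) (c : F.carrier) : Prop :=
  F.nakayama c = c ∧ ∀ g : F.carrier, g * c = c * (F.nakayama ^ m) g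

/-- The cyclotomic parameter `𝐂`: for `1 ≤ m ≤ θ` a finite list of even elements `c^{(m,j)}` of
degree `m δ` in `F_ψ^{(m)}`. The index `m : Fin θ` stands for the number `m + 1`. -/
structure CycParam where
  e : Fin F.theta → ℕ
  c : (m : Fin F.theta) → Fin (e m) → F.carrier
  c_mem : ∀ (m : Fin F.theta) (j : Fin (e m)), c m j ∈ F.gr ((((m : ℕ) + 1 : ℕ) : ℤ) * F.δ, 0)
  c_central : ∀ (m : Fin F.theta) (j : Fin (e m)), F.IsTwistedCentral ((m : ℕ) + 1) (c m j)

variable {F}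

/-- The level `d = ∑ m e_m`. -/
noncomputable def CycParam.level (C : F.CycParam) : ℕ := ∑ m : Fin F.theta, ((m : ℕ) + 1) * C.e m

/-- The element `χ = ∏_m ∏_j (x_i^m - c^{(m,j)}_i)`; used for the first index `i`. -/
noncomputable def CycParam.chi (C : F.CycParam) (i : Fin n) : F.Affine n :=
  (List.ofFn fun m : Fin F.theta =>
    (List.ofFn fun j : Fin (C.e m) => F.ax i ^ ((m : ℕ) + 1) - F.af i (C.c m j)).prod).prod

variable (n) in
/-- The relation `χ = 0` (where `χ` is formed with `x_1`), imposed when `n > 0`. -/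
def CycParam.Rel (C : F.CycParam) (a b : F.Affine n) : Prop :=
  ∃ h : 0 < n, a = C.chi (⟨0, h⟩ : Fin n) ∧ b = 0

variable (n) in
/-- The cyclotomic wreath product algebra `𝒜_n(F) / ⟨χ⟩`, which is `𝒜_0(F) = k` for `n = 0`. -/
def CycParam.Cyc (C : F.CycParam) : Type u := RingQuot (C.Rel n)

noncomputable instance (C : F.CycParam) : Ring (C.Cyc n) :=
  inferInstanceAs (Ring (RingQuot (C.Rel n)))

noncomputable instance (C : F.CycParam) : Algebra k (C.Cyc n) :=
  inferInstanceAs (Algebra k (RingQuot (C.Rel n)))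

variable (n) in
/-- The quotient map `𝒜_n(F) → 𝒜_n(F) / ⟨χ⟩`. -/
noncomputable def CycParam.quot (C : F.CycParam) : F.Affine n →ₐ[k] C.Cyc n :=
  RingQuot.mkAlgHom k (C.Rel n)

theorem CycParam.quot_chi (C : F.CycParam) (h : 0 < n) : C.quot n (C.chi ⟨0, h⟩) = 0 :=
  (RingQuot.mkAlgHom_rel k (⟨h, rfl, rfl⟩ : C.Rel n _ 0)).trans (map_zero (C.quot n))

theorem CycParam.quot_surjective (C : F.CycParam) : Function.Surjective (C.quot n) :=
  RingQuot.mkAlgHom_surjective k (C.Rel n)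

/-- The universal property of the cyclotomic wreath product algebra. -/
noncomputable def CycParam.lift (C : F.CycParam) {R : Type*} [Ring R] [Algebra k R]
    (g : F.Affine n →ₐ[k] R) (hg : ∀ h : 0 < n, g (C.chi ⟨0, h⟩) = 0) : C.Cyc n →ₐ[k] R :=
  RingQuot.liftAlgHom k ⟨g, by
    rintro _ _ ⟨h, rfl, rfl⟩
    rw [hg h, map_zero]⟩

theorem CycParam.lift_quot (C : F.CycParam) {R : Type*} [Ring R] [Algebra k R]
    (g : F.Affine n →ₐ[k] R) (hg : ∀ h : 0 < n, g (C.chi ⟨0, h⟩) = 0) (a : F.Affine n) :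
    C.lift g hg (C.quot n a) = g a :=
  RingQuot.liftAlgHom_mkAlgHom_apply k _ _ a

variable (n) in
/-- The bigrading inherited by the cyclotomic wreath product algebra. -/
noncomputable def CycParam.cycGr (C : F.CycParam) (p : Bideg) : Submodule k (C.Cyc n) :=
  (F.affineGr n p).map (C.quot n).toLinearMap

theorem list_prod_mem {X : Type*} (l : List X) (f : X → F.Affine n)
    (h : ∀ x ∈ l, ∃ p, f x ∈ F.affineGr n p) : ∃ p, (l.map f).prod ∈ F.affineGr n p := by
  induction l with
  | nil => exact ⟨0, SetLike.GradedOne.one_mem (A := F.affineGr n)⟩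
  | cons x l ih =>
    obtain ⟨p, hp⟩ := h x (by simp)
    obtain ⟨q, hq⟩ := ih fun y hy => h y (by simp [hy])
    exact ⟨p + q, by simpa using SetLike.mul_mem_graded hp hq⟩

theorem CycParam.chi_mem (C : F.CycParam) (i : Fin n) : ∃ p, C.chi i ∈ F.affineGr n p := by
  rw [chi, List.ofFn_eq_map]
  refine list_prod_mem _ _ fun m _ => ?_
  rw [List.ofFn_eq_map]
  refine list_prod_mem _ _ fun j _ => ⟨((((m : ℕ) + 1 : ℕ) : ℤ) * F.δ, 0), ?_⟩
  refine sub_mem ?_ (F.af_mem i (C.c_mem m j))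
  have := SetLike.pow_mem_graded ((m : ℕ) + 1) (F.ax_mem i)
  convert this using 2
  simp [top]

instance CycParam.cycGr_gradedMonoid (C : F.CycParam) : SetLike.GradedMonoid (C.cycGr n) where
  one_mem := ⟨1, SetLike.GradedOne.one_mem (A := F.affineGr n), map_one (C.quot n)⟩
  mul_mem p q := by
    rintro _ _ ⟨a, ha, rfl⟩ ⟨b, hb, rfl⟩
    exact ⟨a * b, SetLike.mul_mem_graded ha hb, map_mul (C.quot n) a b⟩

open AddMonoidAlgebra in
variable (n) in
/-- The map recording the homogeneous components of an element of the cyclotomic quotient. -/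
noncomputable def CycParam.cycCoact (C : F.CycParam) :
    C.Cyc n →ₐ[k] AddMonoidAlgebra (C.Cyc n) Bideg :=
  C.lift ((mapAlgHom Bideg (C.quot n)).comp (F.affineCoact n)) (by
    intro h
    obtain ⟨p, hp⟩ := C.chi_mem (⟨0, h⟩ : Fin n)
    rw [AlgHom.comp_apply, F.affineCoact_of_mem hp]
    change AddMonoidAlgebra.map _ _ = _
    rw [map_single]
    change single p (C.quot n _) = 0
    rw [C.quot_chi, single_zero])

theorem CycParam.cycGr_isInternal (C : F.CycParam) : DirectSum.IsInternal (C.cycGr n) := by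
  refine isInternal_of_coaction _
    (AddMonoidHom.comp
      { toFun := AddMonoidAlgebra.coeff, map_zero' := rfl, map_add' := fun _ _ => rfl }
      (C.cycCoact n).toLinearMap.toAddMonoidHom) ?_ ?_
  · rintro p _ ⟨a, ha, rfl⟩
    change (C.cycCoact n (C.quot n a)).coeff = _
    rw [cycCoact, lift_quot, AlgHom.comp_apply, F.affineCoact_of_mem ha]
    change (AddMonoidAlgebra.map _ _).coeff = _
    rw [AddMonoidAlgebra.map_single]
    rfl
  · intro z
    obtain ⟨a, rfl⟩ := C.quot_surjective z
    refine AddSubmonoid.closure_induction (motive := fun a _ => C.quot n a ∈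
      AddSubmonoid.closure (⋃ p, (C.cycGr n p : Set (C.Cyc n)))) ?_ ?_ ?_ (F.affine_closure a)
    · intro x hx
      obtain ⟨p, hp⟩ := Set.mem_iUnion.1 hx
      exact AddSubmonoid.subset_closure (Set.mem_iUnion.2 ⟨p, x, hp, rfl⟩)
    · rw [map_zero]; exact zero_mem _
    · intro x y _ _ hx hy; rw [map_add]; exact add_mem hx hy

variable (n) in
/-- The embedding `S_n → S_{n+1}` as permutations fixing the last point. -/
noncomputable def permCastSucc : Equiv.Perm (Fin n) →* Equiv.Perm (Fin (n + 1)) :=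
  Equiv.Perm.viaEmbeddingHom Fin.castSuccEmb

theorem permCastSucc_castSucc (π : Equiv.Perm (Fin n)) (i : Fin n) :
    permCastSucc n π i.castSucc = (π i).castSucc :=
  Equiv.Perm.viaEmbedding_apply π Fin.castSuccEmb i

theorem permCastSucc_last (π : Equiv.Perm (Fin n)) :
    permCastSucc n π (Fin.last n) = Fin.last n :=
  Equiv.Perm.viaEmbedding_apply_of_notMem π Fin.castSuccEmb _ (by
    rintro ⟨i, hi⟩
    exact Fin.castSucc_ne_last i hi)

theorem permCastSucc_swap (i j : Fin n) :
    permCastSucc n (Equiv.swap i j) = Equiv.swap i.castSucc j.castSucc := by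
  ext l
  induction l using Fin.lastCases with
  | last =>
    rw [permCastSucc_last, Equiv.swap_apply_of_ne_of_ne (Fin.castSucc_ne_last i).symm
      (Fin.castSucc_ne_last j).symm]
  | cast l =>
    rw [permCastSucc_castSucc]
    simp only [Equiv.swap_apply_def, Fin.castSucc_inj]
    split_ifs <;> rfl

variable (F n) in
/-- The homomorphism `𝒜_n(F) → 𝒜_{n+1}(F)`, `x_i ↦ x_i`, `f_i ↦ f_i`, `π ↦ π`. -/
noncomputable def affineIncl : F.Affine n →ₐ[k] F.Affine (n + 1) :=
  Affine.lift F (fun i => F.ax i.castSucc) (fun i => F.afHom i.castSucc)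
    { toFun := fun π => F.as (permCastSucc n π)
      map_one' := by rw [map_one, as, Affine.rel F .s_one, map_one]
      map_mul' := fun π σ => by
        rw [map_mul, as, Affine.rel F (.s_mul _ _), map_mul]; rfl }
    (by
      intro i j hij p q a ha b hb
      simpa [af] using Affine.rel F
        (.f_supercomm i.castSucc j.castSucc (by simpa using hij) p q a b ha hb))
    (by
      intro i j
      simpa [ax] using Affine.rel F (.x_comm i.castSucc j.castSucc))
    (by
      intro i a
      simpa [ax, af] using Affine.rel F (.f_x_self i.castSucc a))
    (by
      intro i j hij a
      simpa [ax, af] using Affine.rel F (.f_x_ne i.castSucc j.castSucc (by simpa using hij) a))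
    (by
      intro i i' hi j hj hj'
      simpa [ax, as, permCastSucc_swap] using Affine.rel F
        (.s_x_ne i.castSucc i'.castSucc (by simpa using hi) j.castSucc (by simpa using hj)
          (by simpa using hj')))
    (by
      intro i i' hi
      simpa [ax, as, af, permCastSucc_swap] using Affine.rel F
        (.s_x_self i.castSucc i'.castSucc (by simpa using hi)))
    (by
      intro π i a
      simpa [as, af, permCastSucc_castSucc] using Affine.rel F
        (.s_f (permCastSucc n π) i.castSucc a))

theorem affineIncl_mem {p : Bideg} {a : F.Affine n} (ha : a ∈ F.affineGr n p) :
    F.affineIncl n a ∈ F.affineGr (n + 1) p := by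
  refine Submodule.span_induction (p := fun a _ => F.affineIncl n a ∈ F.affineGr (n + 1) p)
    ?_ (by rw [map_zero]; exact zero_mem _)
    (fun x y _ _ hx hy => by rw [map_add]; exact add_mem hx hy)
    (fun r x _ hx => by rw [map_smul]; exact Submodule.smul_mem _ _ hx) ha
  intro a ha
  clear * - ha
  induction ha with
  | one => rw [map_one]; exact SetLike.GradedOne.one_mem (A := F.affineGr (n + 1))
  | x_mul i _ ih =>
    rw [map_mul, affineIncl, Affine.lift_ax]
    exact SetLike.mul_mem_graded (F.ax_mem _) ih
  | f_mul i hf _ ih =>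
    rw [map_mul, affineIncl, Affine.lift_af]
    exact SetLike.mul_mem_graded (F.af_mem _ hf) ih
  | s_mul π _ ih =>
    rw [map_mul, affineIncl, Affine.lift_as]
    have := SetLike.mul_mem_graded (F.as_mem (permCastSucc n π)) ih
    rwa [zero_add] at this

theorem CycParam.affineIncl_chi (C : F.CycParam) (i : Fin n) :
    F.affineIncl n (C.chi i) = C.chi i.castSucc := by
  simp only [chi, map_list_prod, List.map_ofFn]
  congr 2
  funext m
  simp only [Function.comp_apply, map_list_prod, List.map_ofFn]
  congr 2
  funext j
  simp [affineIncl, Affine.lift_ax, Affine.lift_af]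

variable (n) in
/-- The homomorphism `𝒜_n^𝐂(F) → 𝒜_{n+1}^𝐂(F)` with `x_i ↦ x_i`, `f_i ↦ f_i`, `π ↦ π`. -/
noncomputable def CycParam.incl (C : F.CycParam) : C.Cyc n →ₐ[k] C.Cyc (n + 1) :=
  C.lift ((C.quot (n + 1)).comp (F.affineIncl n)) (by
    intro h
    rw [AlgHom.comp_apply, C.affineIncl_chi]
    exact C.quot_chi n.succ_pos)

theorem CycParam.incl_mem (C : F.CycParam) (p : Bideg) :
    ∀ a ∈ C.cycGr n p, C.incl n a ∈ C.cycGr (n + 1) p := by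
  rintro _ ⟨a, ha, rfl⟩
  refine ⟨F.affineIncl n a, affineIncl_mem ha, ?_⟩
  exact (C.lift_quot ((C.quot (n + 1)).comp (F.affineIncl n)) _ a).symm

variable (n) in
/-- The restriction functor from graded `𝒜_{n+1}^𝐂(F)`-supermodules to graded
`𝒜_n^𝐂(F)`-supermodules. -/
noncomputable def CycParam.res (C : F.CycParam) :
    GrSMod (C.cycGr (n + 1)) ⥤ GrSMod (C.cycGr n) :=
  GrSMod.res (C.incl n) C.incl_mem

variable (n) in
/-- The induction functor `M ↦ 𝒜_{n+1}^𝐂(F) ⊗_{𝒜_n^𝐂(F)} M`. -/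
noncomputable def CycParam.ind (C : F.CycParam) :
    GrSMod (C.cycGr n) ⥤ GrSMod (C.cycGr (n + 1)) :=
  GrSMod.ind (C.incl n) C.incl_mem C.cycGr_isInternal C.cycGr_isInternal

end FrobSuperalgebra

/-! Everything follows from one fact: `𝒜_{n+1}^𝐂(F)` is a graded Frobenius extension of `𝒜_n^𝐂(F)`
with a trace of degree `-dδ` (`CycParam.nonempty_gradedFrobExt`). If `A → A'` is such an extension
with dual bases `x_i`, `y_i`, then `z = ∑ x_i ⊗ tr(y_i z)` in `A' ⊗_A M`. This identity gives
exactness of induction, and `g ↦ (n ↦ ∑ x_i ⊗ g(y_i n))` identifies `A`-maps `N → M` with `A'`-maps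
`N → A' ⊗_A M`, so that induction is also right adjoint to restriction, up to the degree of the
trace.

To define the trace one must know that the larger algebra has not collapsed. No basis theorem is
used for this; a module is built by hand. Let `E` be the polynomials in one new variable with
coefficients in `F ⊗ 𝒜_n^𝐂(F)` (`CycParam.strand`). The induced module `E^{n+1}` has one component
for each position of the new strand. The copies of `F` and the permutations act on it by explicit
formulas, the last polynomial generator acts by `StrandRep.lastX`, and the other polynomial
generators are forced by the relation with the simple transpositions. The hard relation is that the
last two polynomial generators commute (`StrandRep.lastX_comm`).

On `E^{n+1}` the element `χ` kills all components but the first, and on the first it is the `d`-th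
power of the new variable up to lower degree. Division with remainder by `χ` therefore splits
`E^{n+1}` into the elements of degree less than `d` and the submodule generated by the image of `χ`
(`IsFiltered.isCompl`). The trace of `z` is obtained by applying `z` to the generator, taking the
remainder, and applying `tr` of `F` to the coefficient of the power `d - 1` in the last component.
It is a bimodule map by `trInd_incl` and `trInd_mapEnd`.

Finally, with `τ_i` the transposition of `i` and the last strand, and `x`, `b`, `bᵛ` placed on the
last strand, the elements `τ_i b x^a` and `x^{d-1-a} bᵛ τ_i` with `a < d` generate the larger
algebra as a right and a left module over the smaller one (`AffineAction.mem_fil_level`). The matrix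
of traces of their products is unitriangular with respect to `a` (`CycParam.trace_gen`). Inverting
it gives dual bases. -/

namespace Bideg

/-! ### Bimultiplicativity of the sign. -/

theorem sign_add_left (p p' q : Bideg) : (p + p').sign q = p.sign q * p'.sign q := by
  simp only [sign, Prod.snd_add]
  generalize p.2 = a; generalize p'.2 = b; generalize q.2 = c
  revert a b c; decide

theorem sign_comm (p q : Bideg) : p.sign q = q.sign p := by
  simp only [sign, mul_comm]

theorem sign_add_right (p q q' : Bideg) : p.sign (q + q') = p.sign q * p.sign q' := by
  rw [sign_comm, sign_add_left, sign_comm q, sign_comm q']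

theorem sign_mul_sign (p q : Bideg) : p.sign q * p.sign q = 1 := by
  simp only [sign]
  generalize p.2 = a; generalize q.2 = c
  revert a c; decide

theorem sign_even_left (i : ℤ) (q : Bideg) : sign (i, 0) q = 1 := by simp [sign]

theorem sign_even_right (i : ℤ) (q : Bideg) : sign q (i, 0) = 1 := by simp [sign]

theorem sign_self_add (p q : Bideg) : (p + q).sign (p + q) = p.sign p * q.sign q := by
  simp only [sign, Prod.snd_add]
  generalize p.2 = a; generalize q.2 = c
  revert a c; decide

end Bideg

/-! ### The Nakayama automorphism and the Casimir element. -/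

namespace FrobSuperalgebra

variable {k : Type u} [CommRing k] (F : FrobSuperalgebra k)

theorem sign_top_right (p : Bideg) : p.sign F.top = 1 := Bideg.sign_even_right _ _

theorem sign_top_left (p : Bideg) : F.top.sign p = 1 := Bideg.sign_even_left _ _

/-- Only the self-sign of `g` appears, and `f` need not be homogeneous: only the components of `f`
whose bidegree complements that of `g` to the even bidegree `F.top` contribute, and these have the
parity of `g`. -/
theorem tr_mul_eq_sign {q : Bideg} {g : F.carrier} (hg : g ∈ F.gr q) (f : F.carrier) :
    F.tr (f * g) = (q.sign q : k) * F.tr (g * F.nakayama f) := by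
  rw [← F.frob_apply' hg, frob_nakayama]

theorem nakayama_eq_of_tr {f f' : F.carrier}
    (h : ∀ q, ∀ g ∈ F.gr q, F.tr (f * g) = (q.sign q : k) * F.tr (g * f')) :
    F.nakayama f = f' := by
  apply F.frob.injective
  refine F.dual_ext fun q g hg => ?_
  rw [frob_nakayama, h q g hg, F.frob_apply' hg]

theorem nakayama_one : F.nakayama 1 = 1 := by
  refine F.nakayama_eq_of_tr fun q g hg => ?_
  rw [one_mul, mul_one]
  by_cases h : q = F.top
  · rw [h, F.sign_top_left]; simp
  · rw [F.tr_homogeneous q h g hg, mul_zero]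

theorem nakayama_mul (a b : F.carrier) : F.nakayama (a * b) = F.nakayama a * F.nakayama b := by
  refine F.hom_ind (fun a => F.nakayama (a * b) = F.nakayama a * F.nakayama b) (by simp) ?_
    (fun f g hf hg => by simp only [add_mul, map_add, hf, hg]) a
  intro p a ha
  refine F.hom_ind (fun b => F.nakayama (a * b) = F.nakayama a * F.nakayama b) (by simp) ?_
    (fun f g hf hg => by simp only [mul_add, map_add, hf, hg]) b
  intro r b hb
  refine F.nakayama_eq_of_tr fun q g hg => ?_
  by_cases h : p + r + q = F.top
  · rw [mul_assoc, F.tr_mul_eq_sign (SetLike.mul_mem_graded hb hg), mul_assoc,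
      F.tr_mul_eq_sign (SetLike.mul_mem_graded hg (F.nakayama_mem ha)), ← mul_assoc, mul_assoc g,
      ← Int.cast_mul]
    congr 2
    -- The total bidegree is `F.top`, which is even, so the self-signs of `p`, `r`, `q` multiply to
    -- `1`; this turns the product of the two accumulated signs into that of `q` alone.
    have h1 := Bideg.sign_self_add (p + r) q
    rw [h, F.sign_top_left, Bideg.sign_self_add] at h1
    have h2 := Bideg.sign_mul_sign q q
    rw [Bideg.sign_self_add, Bideg.sign_self_add]
    calc _ = p.sign p * r.sign r * (q.sign q * q.sign q) := by ring
      _ = (p.sign p * r.sign r) * 1 := by rw [h2]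
      _ = (p.sign p * r.sign r * q.sign q) * q.sign q := by rw [mul_assoc _ (q.sign q) (q.sign q), h2]
      _ = q.sign q := by rw [← h1, one_mul]
  · rw [F.tr_mul_eq_zero (SetLike.mul_mem_graded ha hb) hg h, F.tr_mul_eq_zero hg
      (SetLike.mul_mem_graded (F.nakayama_mem ha) (F.nakayama_mem hb)), mul_zero]
    rwa [add_comm]

theorem nakayama_bijective : Function.Bijective F.nakayama :=
  F.frob.symm.bijective.comp F.trMul_bijective

/-- The Nakayama automorphism as a linear equivalence. -/
noncomputable def nakayamaEquiv : F.carrier ≃ₗ[k] F.carrier :=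
  LinearEquiv.ofBijective F.nakayama F.nakayama_bijective

theorem nakayamaEquiv_apply (a : F.carrier) : F.nakayamaEquiv a = F.nakayama a := rfl

theorem nakayama_symm (a : F.carrier) : F.nakayama (F.nakayamaEquiv.symm a) = a :=
  F.nakayamaEquiv.apply_symm_apply a

theorem symm_nakayama (a : F.carrier) : F.nakayamaEquiv.symm (F.nakayama a) = a :=
  F.nakayamaEquiv.symm_apply_apply a

theorem nakayamaEquiv_symm_mul (a b : F.carrier) : F.nakayamaEquiv.symm (F.nakayama a * b) =
    a * F.nakayamaEquiv.symm b := by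
  apply F.nakayamaEquiv.injective
  rw [LinearEquiv.apply_symm_apply, nakayamaEquiv_apply, nakayama_mul, nakayama_symm]

theorem tr_nakayama (a : F.carrier) : F.tr (F.nakayama a) = F.tr a := by
  have h := F.tr_mul_eq_sign (SetLike.GradedOne.one_mem (A := F.gr)) a
  rw [mul_one, one_mul] at h
  rw [h]
  simp [Bideg.sign]

theorem repr_eq_tr (x : F.carrier) (b : F.ι) : F.basis.repr x b = F.tr (F.dualBasis b * x) := by
  have h : F.trMul (F.dualBasis b) = F.basis.coord b :=
    (LinearEquiv.ofBijective F.trMul F.trMul_bijective).apply_symm_apply _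
  rw [← trMul_apply, h, Module.Basis.coord_apply]

theorem sum_tr_dualBasis_mul (x : F.carrier) :
    ∑ b, F.tr (F.dualBasis b * x) • F.basis b = x := by
  conv_rhs => rw [← F.basis.sum_repr x]
  exact Finset.sum_congr rfl fun b _ => by rw [repr_eq_tr]

theorem sum_tr_mul_basis (x : F.carrier) :
    ∑ b, F.tr (x * F.basis b) • F.dualBasis b = x := by
  apply F.trMul_bijective.1
  refine F.basis.ext fun c => ?_
  rw [map_sum, LinearMap.sum_apply, trMul_apply]
  simp [tr_dualBasis_mul]

/-- Both sides expand, in the basis and in the dual basis respectively, with the same coefficients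
`tr (cᵛ f b)`. Stating it for an arbitrary bilinear map allows `ψ` to be inserted in one of the
factors later. -/
theorem sum_mul_basis {R : Type*} [AddCommGroup R] [Module k R]
    (B : F.carrier →ₗ[k] F.carrier →ₗ[k] R) (f : F.carrier) :
    ∑ b, B (f * F.basis b) (F.dualBasis b) = ∑ b, B (F.basis b) (F.dualBasis b * f) := by
  have h1 : ∀ b, B (f * F.basis b) (F.dualBasis b) = ∑ c, F.tr (F.dualBasis c * f * F.basis b) •
      B (F.basis c) (F.dualBasis b) := by
    intro b
    conv_lhs => rw [← F.sum_tr_dualBasis_mul (f * F.basis b)]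
    simp [map_sum, LinearMap.sum_apply, mul_assoc]
  have h2 : ∀ c, B (F.basis c) (F.dualBasis c * f) = ∑ b, F.tr (F.dualBasis c * f * F.basis b) •
      B (F.basis c) (F.dualBasis b) := by
    intro c
    conv_lhs => rw [← F.sum_tr_mul_basis (F.dualBasis c * f)]
    simp [map_sum]
  rw [Finset.sum_congr rfl fun b _ => h1 b, Finset.sum_congr rfl fun c _ => h2 c, Finset.sum_comm]

section Casimir

variable {R : Type*} [Ring R] [Algebra k R]

/-- Two homomorphisms from `F` with supercommuting images. -/
def SuperCommute (Φ Ψ : F.carrier →ₐ[k] R) : Prop :=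
  ∀ p q, ∀ a ∈ F.gr p, ∀ b ∈ F.gr q, Φ a * Ψ b = (p.sign q : k) • (Ψ b * Φ a)

/-- The image of `∑ b ⊗ bᵛ` under `Φ ⊗ Ψ`. -/
noncomputable def casimir (Φ Ψ : F.carrier →ₐ[k] R) : R :=
  ∑ b, Φ (F.basis b) * Ψ (F.dualBasis b)

variable {F} {Φ Ψ Ω : F.carrier →ₐ[k] R}

theorem SuperCommute.symm (h : F.SuperCommute Φ Ψ) : F.SuperCommute Ψ Φ := by
  intro p q a ha b hb
  rw [h q p b hb a ha, smul_smul, ← Int.cast_mul, Bideg.sign_comm, Bideg.sign_mul_sign, Int.cast_one,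
    one_smul]

theorem SuperCommute.of_even (h : F.SuperCommute Φ Ψ) {i : ℤ} {a : F.carrier}
    (ha : a ∈ F.gr (i, 0)) (b : F.carrier) : Φ a * Ψ b = Ψ b * Φ a := by
  refine F.hom_ind (fun b => Φ a * Ψ b = Ψ b * Φ a) (by simp) (fun q b hb => ?_)
    (fun f g hf hg => by simp only [map_add, mul_add, add_mul, hf, hg]) b
  rw [h _ _ a ha b hb, Bideg.sign_even_left]; simp

variable (F Φ Ψ) in
theorem casimir_mul (g : F.carrier) : F.casimir Φ Ψ * Ψ g = Φ g * F.casimir Φ Ψ := by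
  have := F.sum_mul_basis ((LinearMap.mul k R).compl₁₂ Φ.toLinearMap Ψ.toLinearMap) g
  simp only [LinearMap.compl₁₂_apply, AlgHom.toLinearMap_apply, LinearMap.mul_apply',
    map_mul, ← mul_assoc] at this
  rw [casimir, Finset.sum_mul, Finset.mul_sum, ← this]
  simp only [mul_assoc]

/-- Exchanging the two tensor factors of `∑ b ⊗ bᵛ` amounts to applying `ψ` to the dual basis. Both
sides are combinations of `Φ(c) Ψ(b)` with coefficient `± tr (cᵛ bᵛ)`; the sign from
supercommutation on one side matches the sign in the definition of `ψ` on the other, since `b` and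
`bᵛ` have the same parity. -/
theorem casimir_nakayama (h : F.SuperCommute Φ Ψ) :
    ∑ b, Φ (F.basis b) * Ψ (F.nakayama (F.dualBasis b)) = F.casimir Ψ Φ := by
  have h1 : ∀ b, Ψ (F.basis b) * Φ (F.dualBasis b) =
      ∑ c, ((F.basisDeg b).sign (F.basisDeg b) * F.tr (F.dualBasis c * F.dualBasis b) : k) •
        (Φ (F.basis c) * Ψ (F.basis b)) := by
    intro b
    rw [h.symm _ _ _ (F.basis_mem b) _ (F.dualBasis_mem b)]
    have hs : (F.basisDeg b).sign (F.top - F.basisDeg b) =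
        (F.basisDeg b).sign (F.basisDeg b) := by
      have h1 := Bideg.sign_add_right (F.basisDeg b) (F.top - F.basisDeg b) (F.basisDeg b)
      rw [sub_add_cancel, F.sign_top_right] at h1
      have h2 := Bideg.sign_mul_sign (F.basisDeg b) (F.basisDeg b)
      calc _ = (F.basisDeg b).sign (F.top - F.basisDeg b) *
            ((F.basisDeg b).sign (F.basisDeg b) * (F.basisDeg b).sign (F.basisDeg b)) := by
              rw [h2, mul_one]
        _ = _ := by rw [← mul_assoc, ← h1, one_mul]
    rw [hs]
    conv_lhs => rw [← F.sum_tr_dualBasis_mul (F.dualBasis b)]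
    simp only [map_sum, map_smul, Finset.sum_mul, smul_mul_assoc, Finset.smul_sum, smul_smul]
  have h2 : ∀ c, Φ (F.basis c) * Ψ (F.nakayama (F.dualBasis c)) =
      ∑ b, ((F.basisDeg b).sign (F.basisDeg b) * F.tr (F.dualBasis c * F.dualBasis b) : k) •
        (Φ (F.basis c) * Ψ (F.basis b)) := by
    intro c
    conv_lhs => rw [← F.sum_tr_dualBasis_mul (F.nakayama (F.dualBasis c))]
    simp only [map_sum, map_smul, Finset.mul_sum, mul_smul_comm]
    refine Finset.sum_congr rfl fun b _ => ?_
    congr 1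
    rw [F.tr_mul_eq_sign (F.dualBasis_mem b), ← mul_assoc, ← Int.cast_mul]
    have hs : (F.top - F.basisDeg b).sign (F.top - F.basisDeg b) =
        (F.basisDeg b).sign (F.basisDeg b) := by
      have h1 := Bideg.sign_self_add (F.top - F.basisDeg b) (F.basisDeg b)
      rw [sub_add_cancel, F.sign_top_right] at h1
      have h2 := Bideg.sign_mul_sign (F.basisDeg b) (F.basisDeg b)
      calc _ = (F.top - F.basisDeg b).sign (F.top - F.basisDeg b) *
            ((F.basisDeg b).sign (F.basisDeg b) * (F.basisDeg b).sign (F.basisDeg b)) := by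
              rw [h2, mul_one]
        _ = _ := by rw [← mul_assoc, ← h1, one_mul]
    rw [hs, Bideg.sign_mul_sign, Int.cast_one, one_mul]
  rw [casimir, Finset.sum_congr rfl fun b _ => h1 b, Finset.sum_congr rfl fun c _ => h2 c,
    Finset.sum_comm]

/-- After the factors are exchanged by `casimir_nakayama`, the element `f` can be moved across by
`sum_mul_basis`, and it picks up the `ψ` that sits on the dual basis. -/
theorem mul_casimir (h : F.SuperCommute Φ Ψ) (f : F.carrier) :
    Ψ f * F.casimir Φ Ψ = F.casimir Φ Ψ * Φ (F.nakayama f) := by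
  rw [← casimir_nakayama h.symm]
  have := F.sum_mul_basis ((LinearMap.mul k R).compl₁₂ Ψ.toLinearMap
    (Φ.toLinearMap ∘ₗ F.nakayama)) f
  simp only [LinearMap.compl₁₂_apply, AlgHom.toLinearMap_apply, LinearMap.mul_apply',
    LinearMap.comp_apply, map_mul, nakayama_mul, mul_assoc] at this
  rw [Finset.sum_mul, Finset.mul_sum]
  simpa only [mul_assoc] using this

/-- The signs from passing `b` and `bᵛ` combine to the sign with `F.top`, which is trivial. -/
theorem casimir_commute (h1 : F.SuperCommute Ω Φ) (h2 : F.SuperCommute Ω Ψ) (f : F.carrier) :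
    Ω f * F.casimir Φ Ψ = F.casimir Φ Ψ * Ω f := by
  refine F.hom_ind (fun f => Ω f * F.casimir Φ Ψ = F.casimir Φ Ψ * Ω f) (by simp) ?_
    (fun f g hf hg => by simp only [map_add, mul_add, add_mul, hf, hg]) f
  intro p f hf
  rw [casimir, Finset.mul_sum, Finset.sum_mul]
  refine Finset.sum_congr rfl fun b _ => ?_
  rw [← mul_assoc, h1 _ _ _ hf _ (F.basis_mem b), smul_mul_assoc, mul_assoc,
    h2 _ _ _ hf _ (F.dualBasis_mem b), mul_smul_comm, smul_smul, ← Int.cast_mul,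
    ← Bideg.sign_add_right, add_sub_cancel, F.sign_top_right, Int.cast_one, one_smul, mul_assoc]

end Casimir

end FrobSuperalgebra

/-! ### Recovering all polynomial generators from the last one. -/

/-- The simple transposition exchanging `i` and `i + 1`. -/
abbrev simpleSwap {n : ℕ} (i : Fin n) : Equiv.Perm (Fin (n + 1)) :=
  Equiv.swap i.castSucc i.succ

theorem Fin.exists_castSucc_succ {n : ℕ} {i i' : Fin (n + 1)} (h : (i' : ℕ) = i + 1) :
    ∃ j : Fin n, i = j.castSucc ∧ i' = j.succ :=
  ⟨⟨i, by omega⟩, Fin.ext rfl, Fin.ext (by simpa using h)⟩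

namespace FrobSuperalgebra

variable {k : Type u} [CommRing k] (F : FrobSuperalgebra k)

/-- A homomorphism from the wreath product algebra `F^{⊗ m} ⋊ S_m`. -/
structure WreathRep (m : ℕ) (R : Type*) [Ring R] [Algebra k R] where
  Φ : Fin m → F.carrier →ₐ[k] R
  S : Equiv.Perm (Fin m) →* R
  superComm : ∀ i j, i ≠ j → F.SuperCommute (Φ i) (Φ j)
  s_f : ∀ π i a, S π * Φ i a = Φ (π i) a * S π

variable {F} {R : Type*} [Ring R] [Algebra k R]

namespace WreathRep

section General

variable {m : ℕ} (w : F.WreathRep m R)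

/-- The element `t_{ij} = ∑ b_i bᵛ_j`. -/
noncomputable def t (i j : Fin m) : R := F.casimir (w.Φ i) (w.Φ j)

theorem s_t (π : Equiv.Perm (Fin m)) (i j : Fin m) :
    w.S π * w.t i j = w.t (π i) (π j) * w.S π := by
  simp only [t, casimir, Finset.mul_sum, Finset.sum_mul]
  refine Finset.sum_congr rfl fun b _ => ?_
  rw [← mul_assoc, w.s_f, mul_assoc, w.s_f, mul_assoc]

theorem s_swap_sq (i j : Fin m) : w.S (Equiv.swap i j) * w.S (Equiv.swap i j) = 1 := by
  rw [← map_mul, Equiv.swap_mul_self, map_one]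

theorem t_mul_f (i j : Fin m) (g : F.carrier) : w.t i j * w.Φ j g = w.Φ i g * w.t i j :=
  F.casimir_mul _ _ g

theorem f_mul_t {i j : Fin m} (h : i ≠ j) (g : F.carrier) :
    w.Φ j g * w.t i j = w.t i j * w.Φ i (F.nakayama g) :=
  mul_casimir (w.superComm i j h) g

theorem f_comm_t {i j l : Fin m} (hi : l ≠ i) (hj : l ≠ j) (g : F.carrier) :
    w.Φ l g * w.t i j = w.t i j * w.Φ l g :=
  casimir_commute (w.superComm l i hi) (w.superComm l j hj) g

/-- Moving `x` to the left leaves `ψ` on the dual basis, and `casimir_nakayama` reads this as an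
exchange of the two indices. -/
theorem t_mul_of_twist {i j : Fin m} (h : i ≠ j) {x : R}
    (hi : ∀ a, w.Φ i a * x = x * w.Φ i a) (hj : ∀ a, w.Φ j a * x = x * w.Φ j (F.nakayama a)) :
    w.t i j * x = x * w.t j i := by
  rw [t, t, ← casimir_nakayama (w.superComm i j h), casimir, Finset.sum_mul, Finset.mul_sum]
  refine Finset.sum_congr rfl fun b _ => ?_
  rw [mul_assoc, hj, ← mul_assoc, hi, mul_assoc]

theorem t_comm {i j : Fin m} {x : R}
    (hi : ∀ a, w.Φ i a * x = x * w.Φ i a) (hj : ∀ a, w.Φ j a * x = x * w.Φ j a) :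
    w.t i j * x = x * w.t i j := by
  rw [t, casimir, Finset.sum_mul, Finset.mul_sum]
  refine Finset.sum_congr rfl fun b _ => ?_
  rw [mul_assoc, hj, ← mul_assoc, hi, mul_assoc]

end General

section Last

variable {n : ℕ} (w : F.WreathRep (n + 1) R)

/-- An element that behaves, with respect to `F^{⊗ (n + 1)}` and `S_n`, like the last polynomial
generator. -/
structure IsLastVar (y : R) : Prop where
  f_comm : ∀ j, j ≠ Fin.last n → ∀ a, w.Φ j a * y = y * w.Φ j a
  f_last : ∀ a, w.Φ (Fin.last n) a * y = y * w.Φ (Fin.last n) (F.nakayama a)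
  s_comm : ∀ π : Equiv.Perm (Fin (n + 1)), π (Fin.last n) = Fin.last n → w.S π * y = y * w.S π

/-- All polynomial generators, obtained from the last one. -/
noncomputable def xs (y : R) : Fin (n + 1) → R :=
  Fin.reverseInduction y fun i z =>
    -- This is `s_i x_i = x_{i+1} s_i - t_{i,i+1}` solved for `x_i`; moving `s_i` past `t_{i,i+1}`
    -- exchanges its indices.
    w.S (simpleSwap i) * z * w.S (simpleSwap i) - w.t i.succ i.castSucc * w.S (simpleSwap i)

theorem xs_last (y : R) : w.xs y (Fin.last n) = y := by
  simp [xs]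

theorem xs_castSucc (y : R) (i : Fin n) : w.xs y i.castSucc =
    w.S (simpleSwap i) * w.xs y i.succ * w.S (simpleSwap i) -
      w.t i.succ i.castSucc * w.S (simpleSwap i) := by
  simp [xs]

theorem s_mul_xs_castSucc (y : R) (i : Fin n) : w.S (simpleSwap i) * w.xs y i.castSucc =
    w.xs y i.succ * w.S (simpleSwap i) - w.t i.castSucc i.succ := by
  rw [xs_castSucc, mul_sub, ← mul_assoc, ← mul_assoc, s_swap_sq, one_mul, ← mul_assoc, s_t,
    mul_assoc, s_swap_sq, mul_one, Equiv.swap_apply_left, Equiv.swap_apply_right]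

theorem xs_castSucc_mul_s (y : R) (i : Fin n) : w.xs y i.castSucc * w.S (simpleSwap i) =
    w.S (simpleSwap i) * w.xs y i.succ - w.t i.succ i.castSucc := by
  rw [xs_castSucc, sub_mul, mul_assoc, s_swap_sq, mul_one, mul_assoc, s_swap_sq, mul_one]

theorem xs_succ_mul_s (y : R) (i : Fin n) : w.xs y i.succ * w.S (simpleSwap i) =
    w.S (simpleSwap i) * w.xs y i.castSucc + w.t i.castSucc i.succ := by
  rw [s_mul_xs_castSucc]; abel

variable {w} {y : R} (h : w.IsLastVar y)
include h

/-- Conjugation by `s_i` exchanges the slots `i` and `i + 1`, so the first term inherits the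
commutation rules of `x_{i+1}`. The correction term obeys the same rules because `t_{i+1,i}` carries
`f` from one slot to the other, with a `ψ` in exactly one direction. -/
theorem IsLastVar.f_xs (i : Fin (n + 1)) :
    (∀ j, j ≠ i → ∀ a, w.Φ j a * w.xs y i = w.xs y i * w.Φ j a) ∧
      ∀ a, w.Φ i a * w.xs y i = w.xs y i * w.Φ i (F.nakayama a) := by
  induction i using Fin.reverseInduction with
  | last => rw [xs_last]; exact ⟨h.f_comm, h.f_last⟩
  | cast i ih =>
    obtain ⟨ih1, ih2⟩ := ih
    have hne : i.castSucc ≠ i.succ := (Fin.castSucc_lt_succ).ne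
    have hs : ∀ j a, w.Φ j a * w.S (simpleSwap i) =
        w.S (simpleSwap i) * w.Φ (simpleSwap i j) a := by
      intro j a
      rw [s_f, Equiv.swap_apply_self]
    constructor
    · intro j hj a
      rw [xs_castSucc, mul_sub, sub_mul]
      by_cases hj' : j = i.succ
      · subst hj'
        congr 1
        · rw [← mul_assoc, ← mul_assoc, hs, Equiv.swap_apply_right, mul_assoc (w.S _),
            ih1 _ hne, mul_assoc, mul_assoc, hs, Equiv.swap_apply_left]
          simp only [mul_assoc]
        · rw [← mul_assoc, ← t_mul_f, mul_assoc, hs, Equiv.swap_apply_left, mul_assoc]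
      · have hfix : simpleSwap i j = j := Equiv.swap_apply_of_ne_of_ne hj hj'
        congr 1
        · rw [← mul_assoc, ← mul_assoc, hs, hfix, mul_assoc (w.S _), ih1 _ hj', mul_assoc,
            mul_assoc, hs, hfix]
          simp only [mul_assoc]
        · rw [← mul_assoc, w.f_comm_t hj' hj, mul_assoc, hs, hfix, mul_assoc]
    · intro a
      rw [xs_castSucc, mul_sub, sub_mul]
      congr 1
      · rw [← mul_assoc, ← mul_assoc, hs, Equiv.swap_apply_left, mul_assoc (w.S _), ih2,
          mul_assoc, mul_assoc, hs, Equiv.swap_apply_right]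
        simp only [mul_assoc]
      · rw [← mul_assoc, w.f_mul_t hne.symm, mul_assoc, hs, Equiv.swap_apply_right, mul_assoc]

/-- Descending induction on `j`. If `s_l` is far from `s_j` it commutes with each ingredient of the
recursive formula for `x_j`; if `l = j + 1`, the formula is unfolded twice and the braid relation is
applied. -/
theorem IsLastVar.s_xs (l : Fin n) (j : Fin (n + 1)) (h1 : j ≠ l.castSucc) (h2 : j ≠ l.succ) :
    w.S (simpleSwap l) * w.xs y j = w.xs y j * w.S (simpleSwap l) := by
  -- The adjacent case needs the claim for the generator two places further, so the induction
  -- hypothesis must cover all larger indices.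
  suffices H : ∀ i : Fin (n + 1), ∀ j ≥ i, ∀ l : Fin n, j ≠ l.castSucc → j ≠ l.succ →
      w.S (simpleSwap l) * w.xs y j = w.xs y j * w.S (simpleSwap l) from H j j le_rfl l h1 h2
  intro i
  induction i using Fin.reverseInduction with
  | last =>
    intro j hj l h1 h2
    obtain rfl : j = Fin.last n := le_antisymm (Fin.le_last _) hj
    rw [xs_last]
    exact h.s_comm _ (Equiv.swap_apply_of_ne_of_ne h1 h2)
  | cast i ih =>
    intro j hj l h1 h2
    rcases hj.eq_or_lt with rfl | hj
    swap
    · exact ih j (Fin.castSucc_lt_iff_succ_le.1 hj) l h1 h2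
    have t_fix : ∀ a b : Fin (n + 1), w.S (simpleSwap l) * w.t a b =
      w.t (simpleSwap l a) (simpleSwap l b) * w.S (simpleSwap l) := fun a b => w.s_t _ _ _
    by_cases hl : l.castSucc = i.succ
    · have hx := w.xs_castSucc y l
      rw [hl] at hx
      have hli : i.castSucc ≠ l.succ := h2
      have hil : i.succ ≠ l.succ := by rw [← hl]; exact (Fin.castSucc_lt_succ).ne
      have hii : i.castSucc ≠ i.succ := (Fin.castSucc_lt_succ).ne
      have hc := ih l.succ (by rw [← hl]; exact (Fin.castSucc_lt_succ).le) i hli.symm hil.symm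
      have br : simpleSwap l * simpleSwap i * simpleSwap l =
          simpleSwap i * simpleSwap l * simpleSwap i := by
        rw [simpleSwap, simpleSwap, hl, Equiv.swap_mul_swap_mul_swap hii hli,
          Equiv.swap_comm i.castSucc, Equiv.swap_comm i.succ l.succ,
          Equiv.swap_mul_swap_mul_swap hil.symm hli.symm, Equiv.swap_comm]
      have brR : w.S (simpleSwap l) * w.S (simpleSwap i) * w.S (simpleSwap l) =
          w.S (simpleSwap i) * w.S (simpleSwap l) * w.S (simpleSwap i) := by
        simp only [← map_mul, br]
      have hr := w.s_swap_sq l.castSucc l.succ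
      have hs := w.s_swap_sq i.castSucc i.succ
      have ht1 := w.s_t (simpleSwap i) l.succ i.succ
      have ht2 := w.s_t (simpleSwap l) l.succ i.castSucc
      have ht3 := w.s_t (simpleSwap l) i.succ i.castSucc
      rw [Equiv.swap_apply_of_ne_of_ne hli.symm hil.symm, Equiv.swap_apply_right] at ht1
      rw [Equiv.swap_apply_right, Equiv.swap_apply_of_ne_of_ne h1 h2, hl] at ht2
      rw [← hl, Equiv.swap_apply_left, Equiv.swap_apply_of_ne_of_ne h1 h2, hl] at ht3
      rw [xs_castSucc, hx]
      generalize w.S (simpleSwap l) = r at *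
      generalize w.S (simpleSwap i) = s at *
      generalize w.xs y l.succ = X at *
      -- The formula for `x_i` now has three terms. Commuting with `r` fixes the one containing `X`,
      -- by `e1`, and exchanges the two correction terms, by `e2` and `e3`.
      have e1 : r * (s * (r * X * r) * s) = s * (r * X * r) * s * r := by
        calc _ = (r * s * r) * X * r * s := by simp only [mul_assoc]
          _ = s * r * (s * X) * r * s := by rw [brR]; simp only [mul_assoc]
          _ = s * r * X * (s * r * s) := by rw [hc]; simp only [mul_assoc]
          _ = _ := by rw [← brR]; simp only [mul_assoc]
      have e2 : r * (s * (w.t l.succ i.succ * r) * s) = w.t i.succ i.castSucc * s * r := by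
        calc _ = r * (s * w.t l.succ i.succ) * r * s := by simp only [mul_assoc]
          _ = (r * w.t l.succ i.castSucc) * s * r * s := by rw [ht1]; simp only [mul_assoc]
          _ = w.t i.succ i.castSucc * (r * s * r) * s := by rw [ht2]; simp only [mul_assoc]
          _ = w.t i.succ i.castSucc * s * r * (s * s) := by rw [brR]; simp only [mul_assoc]
          _ = _ := by rw [hs, mul_one]
      have e3 : s * (w.t l.succ i.succ * r) * s * r = r * (w.t i.succ i.castSucc * s) := by
        calc _ = (s * w.t l.succ i.succ) * r * s * r := by simp only [mul_assoc]
          _ = w.t l.succ i.castSucc * (s * r * s) * r := by rw [ht1]; simp only [mul_assoc]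
          _ = w.t l.succ i.castSucc * r * s * (r * r) := by rw [← brR]; simp only [mul_assoc]
          _ = _ := by rw [hr, mul_one, ← ht3, mul_assoc]
      simp only [mul_sub, sub_mul]
      rw [e1, e2, e3]
      abel
    · have e1 : simpleSwap l i.castSucc = i.castSucc := Equiv.swap_apply_of_ne_of_ne h1 h2
      have e2 : simpleSwap l i.succ = i.succ := Equiv.swap_apply_of_ne_of_ne (Ne.symm hl) (by
        intro h; exact h1 (congrArg Fin.castSucc (Fin.succ_injective _ h)))
      have hc : w.S (simpleSwap l) * w.S (simpleSwap i) = w.S (simpleSwap i) * w.S (simpleSwap l) := by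
        rw [← map_mul, ← map_mul, Equiv.mul_swap_eq_swap_mul, e1, e2]
      have hx := ih i.succ le_rfl l (Ne.symm hl) (by
        intro h; exact h1 (congrArg Fin.castSucc (Fin.succ_injective _ h)))
      rw [xs_castSucc, mul_sub, sub_mul]
      congr 1
      · rw [← mul_assoc, ← mul_assoc, hc, mul_assoc (w.S _), hx, mul_assoc, mul_assoc, hc]
        simp only [mul_assoc]
      · rw [← mul_assoc, t_fix, e1, e2, mul_assoc, hc, mul_assoc]

/-- Commutation of the last two generators suffices: going down, each further `x_i` is made of
`s_i`, `x_{i+1}` and `t_{i+1,i}`, all of which commute with the generators of larger index already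
treated. The equation `i.succ = Fin.last n` makes the hypothesis vacuous when there is only one
strand. -/
theorem IsLastVar.xs_comm
    (hc : ∀ i : Fin n, i.succ = Fin.last n → Commute y (w.xs y i.castSucc)) (i j : Fin (n + 1)) :
    Commute (w.xs y i) (w.xs y j) := by
  suffices H : ∀ j i : Fin (n + 1), i < j → Commute (w.xs y j) (w.xs y i) by
    rcases lt_trichotomy i j with hij | rfl | hij
    · exact (H j i hij).symm
    · exact Commute.refl _
    · exact H i j hij
  intro j
  induction j using Fin.reverseInduction with
  | last =>
    intro i
    induction i using Fin.reverseInduction with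
    | last => intro h; exact (lt_irrefl _ h).elim
    | cast i ih =>
      intro _
      rw [xs_last] at ih ⊢
      by_cases hi : i.succ = Fin.last n
      · exact hc i hi
      · have e1 : Commute y (w.S (simpleSwap i)) := (h.s_comm _ (Equiv.swap_apply_of_ne_of_ne
          (Fin.castSucc_ne_last i).symm (Ne.symm hi))).symm
        have e2 : Commute y (w.xs y i.succ) := ih (Fin.lt_last_iff_ne_last.2 hi)
        have e3 : Commute y (w.t i.succ i.castSucc) :=
          (w.t_comm (h.f_comm _ hi) (h.f_comm _ (Fin.castSucc_ne_last i))).symm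
        rw [xs_castSucc]
        exact ((e1.mul_right e2).mul_right e1).sub_right (e3.mul_right e1)
  | cast j ih =>
    intro i hi
    have n1 : i ≠ j.castSucc := hi.ne
    have n2 : i ≠ j.succ := (hi.trans Fin.castSucc_lt_succ).ne
    have e1 : Commute (w.S (simpleSwap j)) (w.xs y i) := h.s_xs j i n1 n2
    have e2 := ih i (hi.trans Fin.castSucc_lt_succ)
    have e3 : Commute (w.t j.succ j.castSucc) (w.xs y i) :=
      w.t_comm ((h.f_xs i).1 _ n2.symm) ((h.f_xs i).1 _ n1.symm)
    rw [xs_castSucc]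
    exact ((e1.mul_left e2).mul_left e1).sub_left (e3.mul_left e1)

/-- The homomorphism from the affine wreath product algebra given by a wreath product
representation and a suitable image of the last polynomial generator. -/
noncomputable def IsLastVar.toAffine
    (hc : ∀ i : Fin n, i.succ = Fin.last n → Commute y (w.xs y i.castSucc)) :
    F.Affine (n + 1) →ₐ[k] R :=
  Affine.lift F (w.xs y) w.Φ w.S
    (fun i j hij p q a ha b hb => w.superComm i j hij p q a ha b hb)
    (fun i j => h.xs_comm hc i j)
    (fun i a => (h.f_xs i).2 a)
    (fun i j hij a => (h.f_xs i).1 j hij.symm a)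
    (fun i i' hi j hj hj' => by
      obtain ⟨l, rfl, rfl⟩ := Fin.exists_castSucc_succ hi
      exact h.s_xs l j hj hj')
    (fun i i' hi => by
      obtain ⟨l, rfl, rfl⟩ := Fin.exists_castSucc_succ hi
      exact w.s_mul_xs_castSucc y l)
    w.s_f

theorem IsLastVar.toAffine_ax
    (hc : ∀ i : Fin n, i.succ = Fin.last n → Commute y (w.xs y i.castSucc)) (i : Fin (n + 1)) :
    h.toAffine hc (F.ax i) = w.xs y i :=
  Affine.lift_ax F _ _ _ _ _ _ _ _ _ _ i

theorem IsLastVar.toAffine_af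
    (hc : ∀ i : Fin n, i.succ = Fin.last n → Commute y (w.xs y i.castSucc)) (i : Fin (n + 1))
    (a : F.carrier) : h.toAffine hc (F.af i a) = w.Φ i a :=
  Affine.lift_af F _ _ _ _ _ _ _ _ _ _ i a

theorem IsLastVar.toAffine_as
    (hc : ∀ i : Fin n, i.succ = Fin.last n → Commute y (w.xs y i.castSucc))
    (π : Equiv.Perm (Fin (n + 1))) : h.toAffine hc (F.as π) = w.S π :=
  Affine.lift_as F _ _ _ _ _ _ _ _ _ _ π

end Last

end WreathRep

end FrobSuperalgebra

/-! ### Deleting a point from a permutation. -/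

section Perm

variable {n : ℕ}

/-- The permutation induced by `π` on the complements of `i` and `π i`. -/
def indPerm (π : Equiv.Perm (Fin (n + 1))) (i : Fin (n + 1)) : Equiv.Perm (Fin n) :=
  ((finSuccAboveEquiv i).trans (π.subtypeEquiv (p := (· ≠ i)) (q := (· ≠ π i))
    fun _ => (π.injective.ne_iff).symm)).trans (finSuccAboveEquiv (π i)).symm

theorem succAbove_indPerm (π : Equiv.Perm (Fin (n + 1))) (i : Fin (n + 1)) (j : Fin n) :
    (π i).succAbove (indPerm π i j) = π (i.succAbove j) := by
  have h := (finSuccAboveEquiv (π i)).apply_symm_apply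
    (π.subtypeEquiv (p := (· ≠ i)) (q := (· ≠ π i)) (fun _ => (π.injective.ne_iff).symm)
      (finSuccAboveEquiv i j))
  exact congrArg Subtype.val h

theorem indPerm_eq {π : Equiv.Perm (Fin (n + 1))} {i : Fin (n + 1)} {σ : Equiv.Perm (Fin n)}
    (h : ∀ j, (π i).succAbove (σ j) = π (i.succAbove j)) : indPerm π i = σ := by
  ext j
  rw [(Fin.succAbove_right_injective (p := π i)).eq_iff.1
    ((succAbove_indPerm π i j).trans (h j).symm)]

theorem indPerm_one (i : Fin (n + 1)) : indPerm 1 i = 1 := indPerm_eq fun _ => rfl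

/-- The cocycle identity that makes `StrandRep.permOp` multiplicative in the permutation. -/
theorem indPerm_mul (π σ : Equiv.Perm (Fin (n + 1))) (i : Fin (n + 1)) :
    indPerm (π * σ) i = indPerm π (σ i) * indPerm σ i := by
  refine indPerm_eq fun j => ?_
  rw [Equiv.Perm.mul_apply, Equiv.Perm.mul_apply, Equiv.Perm.mul_apply, succAbove_indPerm,
    succAbove_indPerm]

theorem indPerm_permCastSucc (σ : Equiv.Perm (Fin n)) :
    indPerm (FrobSuperalgebra.permCastSucc n σ) (Fin.last n) = σ := by
  refine indPerm_eq fun j => ?_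
  rw [FrobSuperalgebra.permCastSucc_last, Fin.succAbove_last, 
    FrobSuperalgebra.permCastSucc_castSucc]

theorem eq_permCastSucc {π : Equiv.Perm (Fin (n + 1))} (h : π (Fin.last n) = Fin.last n) :
    π = FrobSuperalgebra.permCastSucc n (indPerm π (Fin.last n)) := by
  ext j
  induction j using Fin.lastCases with
  | last => rw [h, FrobSuperalgebra.permCastSucc_last]
  | cast j =>
    have := succAbove_indPerm π (Fin.last n) j
    rw [h, Fin.succAbove_last] at this
    rw [FrobSuperalgebra.permCastSucc_castSucc, this]

/-- The embedding `S_n → S_{n+1}` as permutations fixing the first point. -/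
noncomputable def permSucc (n : ℕ) : Equiv.Perm (Fin n) →* Equiv.Perm (Fin (n + 1)) :=
  Equiv.Perm.viaEmbeddingHom (Fin.succEmb n)

theorem permSucc_succ (π : Equiv.Perm (Fin n)) (i : Fin n) :
    permSucc n π i.succ = (π i).succ :=
  Equiv.Perm.viaEmbedding_apply π (Fin.succEmb n) i

theorem permSucc_zero (π : Equiv.Perm (Fin n)) : permSucc n π 0 = 0 :=
  Equiv.Perm.viaEmbedding_apply_of_notMem π (Fin.succEmb n) _ (by
    rintro ⟨i, hi⟩
    exact Fin.succ_ne_zero i hi)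

theorem permSucc_swap (i j : Fin n) :
    permSucc n (Equiv.swap i j) = Equiv.swap i.succ j.succ := by
  ext l
  induction l using Fin.cases with
  | zero =>
    rw [permSucc_zero, Equiv.swap_apply_of_ne_of_ne (Fin.succ_ne_zero i).symm
      (Fin.succ_ne_zero j).symm]
  | succ l =>
    rw [permSucc_succ]
    simp only [Equiv.swap_apply_def, Fin.succ_inj]
    split_ifs <;> rfl

theorem eq_permSucc {π : Equiv.Perm (Fin (n + 1))} (h : π 0 = 0) :
    π = permSucc n (indPerm π 0) := by
  ext j
  induction j using Fin.cases with
  | zero => rw [h, permSucc_zero]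
  | succ j =>
    have := succAbove_indPerm π 0 j
    rw [h, Fin.succAbove_zero] at this
    rw [permSucc_succ, this]

theorem perm_induction {P : Equiv.Perm (Fin (n + 1)) → Prop} (h1 : P 1)
    (hs : ∀ i σ, P σ → P (simpleSwap i * σ)) (σ : Equiv.Perm (Fin (n + 1))) : P σ := by
  have : σ ∈ Submonoid.closure (Set.range fun i : Fin n => Equiv.swap i.castSucc i.succ) := by
    rw [Equiv.Perm.mclosure_swap_castSucc_succ]; trivial
  induction this using Submonoid.closure_induction_left with
  | one => exact h1
  | mul_left x hx y _ ih =>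
    obtain ⟨i, rfl⟩ := hx
    exact hs i y ih

end Perm

/-! ### Relations in the affine wreath product algebra. -/

namespace FrobSuperalgebra

variable {k : Type u} [CommRing k] {F : FrobSuperalgebra k} {n : ℕ}

section Relations

theorem as_one : F.as (1 : Equiv.Perm (Fin n)) = 1 := (Affine.rel F .s_one).trans (map_one _)

theorem as_mul (π σ : Equiv.Perm (Fin n)) : F.as (π * σ) = F.as π * F.as σ :=
  (Affine.rel F (.s_mul π σ)).trans (map_mul _ _ _)

theorem ax_comm (i j : Fin n) : F.ax i * F.ax j = F.ax j * F.ax i := by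
  simpa [ax] using Affine.rel F (.x_comm i j)

theorem af_mul_ax_self (i : Fin n) (a : F.carrier) :
    F.af i a * F.ax i = F.ax i * F.af i (F.nakayama a) := by
  simpa [ax, af] using Affine.rel F (.f_x_self i a)

theorem af_mul_ax_ne {i j : Fin n} (hij : i ≠ j) (a : F.carrier) :
    F.af j a * F.ax i = F.ax i * F.af j a := by
  simpa [ax, af] using Affine.rel F (.f_x_ne i j hij a)

theorem as_mul_af (π : Equiv.Perm (Fin n)) (i : Fin n) (a : F.carrier) :
    F.as π * F.af i a = F.af (π i) a * F.as π := by
  simpa [as, af] using Affine.rel F (.s_f π i a)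

variable (F n) in
/-- The wreath product algebra inside the affine wreath product algebra. -/
noncomputable def affRep : F.WreathRep n (F.Affine n) where
  Φ i := F.afHom i
  S := { toFun := F.as, map_one' := as_one, map_mul' := as_mul }
  superComm i j hij p q a ha b hb := by
    simpa [af] using Affine.rel F (.f_supercomm i j hij p q a b ha hb)
  s_f π i a := as_mul_af π i a

theorem affRep_S (π : Equiv.Perm (Fin n)) : (F.affRep n).S π = F.as π := rfl

theorem affRep_Φ (i : Fin n) (a : F.carrier) : (F.affRep n).Φ i a = F.af i a := rfl

theorem as_mul_ax_ne {i : Fin n} {j : Fin (n + 1)} (h1 : j ≠ i.castSucc) (h2 : j ≠ i.succ) :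
    F.as (simpleSwap i) * F.ax j = F.ax j * F.as (simpleSwap i) := by
  simpa [ax, as] using Affine.rel F (.s_x_ne i.castSucc i.succ (by simp) j h1 h2)

theorem as_mul_ax_castSucc (i : Fin n) : F.as (simpleSwap i) * F.ax i.castSucc =
    F.ax i.succ * F.as (simpleSwap i) - (F.affRep (n + 1)).t i.castSucc i.succ := by
  have h := Affine.rel F (.s_x_self i.castSucc i.succ (by simp))
  rw [map_mul, map_sub, map_mul, map_sum] at h
  simp only [map_mul] at h
  exact h

theorem ax_castSucc_mul_as (i : Fin n) : F.ax i.castSucc * F.as (simpleSwap i) =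
    F.as (simpleSwap i) * F.ax i.succ - (F.affRep (n + 1)).t i.succ i.castSucc := by
  have h1 := (F.affRep (n + 1)).s_swap_sq i.castSucc i.succ
  have h2 := (F.affRep (n + 1)).s_t (simpleSwap i) i.castSucc i.succ
  rw [Equiv.swap_apply_left, Equiv.swap_apply_right] at h2
  rw [affRep_S] at h1 h2
  have h := congrArg (fun z => F.as (simpleSwap i) * z * F.as (simpleSwap i))
    (as_mul_ax_castSucc (F := F) i)
  simp only [mul_sub, sub_mul] at h
  rw [h2, mul_assoc ((F.affRep (n + 1)).t _ _), h1, mul_one, ← mul_assoc, h1, one_mul,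
    ← mul_assoc, mul_assoc _ (F.as (simpleSwap i)) (F.as (simpleSwap i)), h1, mul_one] at h
  exact h

theorem as_mul_ax_succ (i : Fin n) : F.as (simpleSwap i) * F.ax i.succ =
    F.ax i.castSucc * F.as (simpleSwap i) + (F.affRep (n + 1)).t i.succ i.castSucc := by
  rw [ax_castSucc_mul_as]; abel

/-- A permutation fixing the last point is a product of simple transpositions not involving it, and
these commute with the last polynomial generator on the nose, without Casimir terms. -/
theorem as_mul_ax_last {π : Equiv.Perm (Fin (n + 1))} (h : π (Fin.last n) = Fin.last n) :
    F.as π * F.ax (Fin.last n) = F.ax (Fin.last n) * F.as π := by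
  rw [eq_permCastSucc h]
  generalize indPerm π (Fin.last n) = σ
  cases n with
  | zero => rw [Subsingleton.elim σ 1, map_one, as_one, one_mul, mul_one]
  | succ n =>
    induction σ using perm_induction with
    | h1 => rw [map_one, as_one, one_mul, mul_one]
    | hs i σ ih =>
      have := as_mul_ax_ne (F := F) (i := i.castSucc) (j := Fin.last (n + 1))
        (Fin.castSucc_ne_last _).symm (by
          rw [← Fin.castSucc_succ]; exact (Fin.castSucc_ne_last _).symm)
      rw [map_mul, as_mul, mul_assoc, ih, ← mul_assoc, permCastSucc_swap, Fin.castSucc_succ, this,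
        mul_assoc]

theorem as_mul_ax_zero {π : Equiv.Perm (Fin (n + 1))} (h : π 0 = 0) :
    F.as π * F.ax 0 = F.ax 0 * F.as π := by
  rw [eq_permSucc h]
  generalize indPerm π 0 = σ
  cases n with
  | zero => rw [Subsingleton.elim σ 1, map_one, as_one, one_mul, mul_one]
  | succ n =>
    induction σ using perm_induction with
    | h1 => rw [map_one, as_one, one_mul, mul_one]
    | hs i σ ih =>
      have := as_mul_ax_ne (F := F) (i := i.succ) (j := 0)
        (by rw [← Fin.succ_castSucc]; exact (Fin.succ_ne_zero _).symm) (Fin.succ_ne_zero _).symm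
      rw [map_mul, as_mul, mul_assoc, ih, ← mul_assoc, permSucc_swap, Fin.succ_castSucc, this,
        mul_assoc]

end Relations

end FrobSuperalgebra

/-! ### The module induced from one additional strand. -/

namespace FrobSuperalgebra

variable {k : Type u} [CommRing k] {F : FrobSuperalgebra k} {n : ℕ}

variable (F n) in
/-- A module over the tensor product of `𝒜_n(F)` and the affine algebra of one more strand. -/
structure StrandRep (E : Type*) [AddCommGroup E] [Module k E] where
  ρ : F.Affine n →ₐ[k] Module.End k E
  X : Module.End k E
  Φ : F.carrier →ₐ[k] Module.End k E
  x_comm : ∀ a, X * ρ a = ρ a * X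
  f_x : ∀ a, Φ a * X = X * Φ (F.nakayama a)
  f_ax : ∀ a i, Φ a * ρ (F.ax i) = ρ (F.ax i) * Φ a
  f_as : ∀ a π, Φ a * ρ (F.as π) = ρ (F.as π) * Φ a
  superComm : ∀ i, F.SuperCommute Φ (ρ.comp (F.afHom i))

namespace StrandRep

variable {E : Type*} [AddCommGroup E] [Module k E] (D : StrandRep F n E)

/-- The action of the `j`-th copy of `F` when the new strand is in position `i`. -/
noncomputable def slot (i j : Fin (n + 1)) : F.carrier →ₐ[k] Module.End k E :=
  i.insertNth (α := fun _ => F.carrier →ₐ[k] Module.End k E) D.Φ (fun l => D.ρ.comp (F.afHom l)) j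

theorem slot_self (i : Fin (n + 1)) : D.slot i i = D.Φ := by simp [slot]

theorem slot_succAbove (i : Fin (n + 1)) (l : Fin n) :
    D.slot i (i.succAbove l) = D.ρ.comp (F.afHom l) := by simp [slot]

/-- The action of `x_j` on the leading component when the new strand is in position `i`. -/
noncomputable def slotX (i j : Fin (n + 1)) : Module.End k E :=
  i.insertNth (α := fun _ => Module.End k E) D.X (fun l => D.ρ (F.ax l)) j

theorem slotX_self (i : Fin (n + 1)) : D.slotX i i = D.X := by simp [slotX]

theorem slotX_succAbove (i : Fin (n + 1)) (l : Fin n) :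
    D.slotX i (i.succAbove l) = D.ρ (F.ax l) := by simp [slotX]

/-- The action of permutations on the induced module. -/
noncomputable def permOp (π : Equiv.Perm (Fin (n + 1))) : Module.End k (Fin (n + 1) → E) :=
  -- Component `i` stands for `w_i ⊗ E`, where `w_i` is the shuffle sending the last point to `i`
  -- and preserving the order of the others. Since `π w_i = w_{π i} (indPerm π i)`, the old strands
  -- are permuted by `indPerm`.
  LinearMap.pi fun i => D.ρ (F.as (indPerm π (π⁻¹ i))) ∘ₗ LinearMap.proj (π⁻¹ i)

theorem permOp_apply (π : Equiv.Perm (Fin (n + 1))) (v : Fin (n + 1) → E) (i : Fin (n + 1)) :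
    D.permOp π v (π i) = D.ρ (F.as (indPerm π i)) (v i) := by
  simp [permOp]

theorem permOp_single (π : Equiv.Perm (Fin (n + 1))) (i : Fin (n + 1)) (e : E) :
    D.permOp π (Pi.single i e) = Pi.single (π i) (D.ρ (F.as (indPerm π i)) e) := by
  funext j
  obtain ⟨j, rfl⟩ := π.surjective j
  rw [permOp_apply]
  by_cases h : j = i
  · subst h; simp
  · rw [Pi.single_eq_of_ne h, Pi.single_eq_of_ne (π.injective.ne h), map_zero]

theorem ρ_as_cancel (σ : Equiv.Perm (Fin n)) (e : E) : D.ρ (F.as σ) (D.ρ (F.as σ⁻¹) e) = e := by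
  rw [← Module.End.mul_apply, ← map_mul, ← as_mul, mul_inv_cancel, as_one, map_one,
    Module.End.one_apply]

theorem single_eq_permOp (π : Equiv.Perm (Fin (n + 1))) (i : Fin (n + 1)) (e : E) :
    Pi.single (π i) e = D.permOp π (Pi.single i (D.ρ (F.as (indPerm π i)⁻¹) e)) := by
  rw [permOp_single, ρ_as_cancel]

theorem slot_perm (π : Equiv.Perm (Fin (n + 1))) (i j : Fin (n + 1)) (a : F.carrier) :
    D.ρ (F.as (indPerm π i)) * D.slot i j a = D.slot (π i) (π j) a *
      D.ρ (F.as (indPerm π i)) := by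
  rcases Fin.eq_self_or_eq_succAbove i j with rfl | ⟨l, rfl⟩
  · rw [slot_self, slot_self, f_as]
  · rw [slot_succAbove, ← succAbove_indPerm, slot_succAbove]
    change D.ρ _ * D.ρ (F.af l a) = D.ρ (F.af _ a) * D.ρ _
    rw [← map_mul, ← map_mul, as_mul_af]

theorem slot_superComm (i j l : Fin (n + 1)) (h : j ≠ l) :
    F.SuperCommute (D.slot i j) (D.slot i l) := by
  rcases Fin.eq_self_or_eq_succAbove i j with rfl | ⟨j, rfl⟩
  · rcases Fin.eq_self_or_eq_succAbove j l with rfl | ⟨l, rfl⟩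
    · exact (h rfl).elim
    · rw [slot_self, slot_succAbove]; exact D.superComm l
  · rcases Fin.eq_self_or_eq_succAbove i l with rfl | ⟨l, rfl⟩
    · rw [slot_self, slot_succAbove]; exact (D.superComm j).symm
    · rw [slot_succAbove, slot_succAbove]
      intro p q a ha b hb
      have := (F.affRep n).superComm j l (by rintro rfl; exact h rfl) p q a ha b hb
      change D.ρ (F.af j a) * D.ρ (F.af l b) = _ • (D.ρ (F.af l b) * D.ρ (F.af j a))
      rw [← map_mul, ← map_mul, ← map_smul]
      exact congrArg D.ρ this

/-- The wreath product representation on the induced module. -/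
noncomputable def wreath : F.WreathRep (n + 1) (Module.End k (Fin (n + 1) → E)) where
  Φ j := AlgHom.ofLinearMap
    { toFun := fun a => LinearMap.pi fun i => D.slot i j a ∘ₗ LinearMap.proj i
      map_add' := fun a b => LinearMap.ext fun v => by funext i; simp
      map_smul' := fun r a => LinearMap.ext fun v => by funext i; simp }
    (LinearMap.ext fun v => by funext i; simp)
    (fun a b => LinearMap.ext fun v => by funext i; simp)
  S :=
    { toFun := D.permOp
      map_one' := by
        refine LinearMap.ext fun v => ?_; funext i
        have := D.permOp_apply 1 v i
        rw [indPerm_one, as_one, map_one] at this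
        exact this
      map_mul' := fun π σ => by
        refine LinearMap.ext fun v => ?_; funext i
        obtain ⟨i, rfl⟩ := (π * σ).surjective i
        rw [permOp_apply, Module.End.mul_apply, Equiv.Perm.mul_apply, permOp_apply, permOp_apply,
          indPerm_mul, as_mul, map_mul, Module.End.mul_apply] }
  superComm j l h p q a ha b hb := by
    refine LinearMap.ext fun v => ?_; funext i
    have := D.slot_superComm i j l h p q a ha b hb
    exact LinearMap.congr_fun this (v i)
  s_f π j a := by
    refine LinearMap.ext fun v => ?_; funext i
    obtain ⟨i, rfl⟩ := π.surjective i
    have h1 := D.permOp_apply π (fun i => D.slot i j a (v i)) i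
    have h2 := D.permOp_apply π v i
    have h3 := LinearMap.congr_fun (D.slot_perm π i j a) (v i)
    change D.permOp π (fun i => D.slot i j a (v i)) (π i) =
      D.slot (π i) (π j) a (D.permOp π v (π i))
    rw [h1, h2]
    exact h3

theorem wreath_S (π : Equiv.Perm (Fin (n + 1))) : D.wreath.S π = D.permOp π := rfl

theorem wreath_Φ (j : Fin (n + 1)) (a : F.carrier) (v : Fin (n + 1) → E) (i : Fin (n + 1)) :
    D.wreath.Φ j a v i = D.slot i j a (v i) := rfl

theorem wreath_Φ_single (j : Fin (n + 1)) (a : F.carrier) (i : Fin (n + 1)) (e : E) :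
    D.wreath.Φ j a (Pi.single i e) = Pi.single i (D.slot i j a e) := by
  funext l
  rw [wreath_Φ]
  by_cases h : l = i
  · subst h; simp
  · rw [Pi.single_eq_of_ne h, Pi.single_eq_of_ne h, map_zero]

/-- The projection to the component in which the new strand is in the last position. -/
noncomputable def lastProj (n : ℕ) (E : Type*) [AddCommGroup E] [Module k E] :
    Module.End k (Fin (n + 1) → E) :=
  LinearMap.single k (fun _ => E) (Fin.last n) ∘ₗ LinearMap.proj (Fin.last n)

theorem lastProj_apply (v : Fin (n + 1) → E) :
    lastProj (k := k) n E v = Pi.single (Fin.last n) (v (Fin.last n)) := rfl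

/-- The diagonal part of the last polynomial generator. -/
noncomputable def diagOp : Module.End k (Fin (n + 1) → E) :=
  LinearMap.pi fun i => D.slotX i (Fin.last n) ∘ₗ LinearMap.proj i

theorem diagOp_apply (v : Fin (n + 1) → E) (i : Fin (n + 1)) :
    D.diagOp v i = D.slotX i (Fin.last n) (v i) := rfl

/-- The operator by which the last polynomial generator acts on the induced module. -/
noncomputable def lastX : Module.End k (Fin (n + 1) → E) :=
  -- When the last generator is moved to the right past the shuffle `w_i`, its strand crosses only
  -- the new strand. So there is a single Casimir term for each `i`, and its permutation `swap i
  -- last * w_i` fixes the last point, which puts the result into the last component before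
  -- `t_{i,last}` acts.
  D.diagOp + ∑ i ∈ Finset.univ.erase (Fin.last n),
    D.wreath.t i (Fin.last n) * (lastProj n E * D.wreath.S (Equiv.swap i (Fin.last n)))

theorem lastProj_f (j : Fin (n + 1)) (a : F.carrier) :
    lastProj n E * D.wreath.Φ j a = D.wreath.Φ j a * lastProj n E := by
  refine LinearMap.ext fun v => ?_
  rw [Module.End.mul_apply, Module.End.mul_apply, lastProj_apply, lastProj_apply, wreath_Φ_single,
    wreath_Φ]

theorem lastProj_s {π : Equiv.Perm (Fin (n + 1))} (h : π (Fin.last n) = Fin.last n) :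
    lastProj n E * D.wreath.S π = D.wreath.S π * lastProj n E := by
  refine LinearMap.ext fun v => ?_
  have := D.permOp_apply π v (Fin.last n)
  rw [h] at this
  rw [Module.End.mul_apply, Module.End.mul_apply, lastProj_apply, lastProj_apply, wreath_S,
    permOp_single, this, h]

theorem eq_last_of_succAbove {i : Fin (n + 2)} {l : Fin (n + 1)}
    (h : i.succAbove l = Fin.last (n + 1)) : l = Fin.last n := by
  have hi : i ≠ Fin.last (n + 1) := by
    rintro rfl
    rw [Fin.succAbove_last] at h
    exact Fin.castSucc_ne_last _ h
  exact (Fin.succAbove_eq_last_iff hi).1 h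

/-- The diagonal part and the correction are treated separately. In the correction, `lastProj`
commutes with the copies of `F` and with the permutations fixing the last point, so that only the
rules for the Casimir elements and the transpositions are left. -/
theorem isLastVar_lastX : D.wreath.IsLastVar D.lastX where
  f_comm j hj a := by
    rw [lastX, mul_add, add_mul, Finset.mul_sum, Finset.sum_mul]
    congr 1
    · refine LinearMap.ext fun v => ?_; funext i
      change D.slot i j a (D.slotX i (Fin.last n) (v i)) =
        D.slotX i (Fin.last n) (D.slot i j a (v i))
      rw [← Module.End.mul_apply, ← Module.End.mul_apply]
      congr 1
      rcases Fin.eq_self_or_eq_succAbove i j with rfl | ⟨j, rfl⟩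
      · rcases Fin.eq_self_or_eq_succAbove j (Fin.last n) with h | ⟨l, h⟩
        · exact (hj h.symm).elim
        · rw [h, slot_self, slotX_succAbove, f_ax]
      · rcases Fin.eq_self_or_eq_succAbove i (Fin.last n) with h | ⟨l, h⟩
        · rw [slot_succAbove, h, slotX_self]
          exact (D.x_comm _).symm
        · have : l ≠ j := by rintro rfl; exact hj h.symm
          rw [slot_succAbove, h, slotX_succAbove]
          change D.ρ (F.af j a) * _ = _ * D.ρ (F.af j a)
          rw [← map_mul, ← map_mul, af_mul_ax_ne this]
    · refine Finset.sum_congr rfl fun i hi => ?_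
      rw [mul_assoc (D.wreath.t _ _), mul_assoc (lastProj n E), D.wreath.s_f]
      by_cases h : j = i
      · subst h
        rw [Equiv.swap_apply_left, ← mul_assoc, ← D.wreath.t_mul_f, mul_assoc,
          ← mul_assoc (D.wreath.Φ _ _), ← lastProj_f, mul_assoc]
      · rw [Equiv.swap_apply_of_ne_of_ne h hj, ← mul_assoc, D.wreath.f_comm_t h hj, mul_assoc,
          ← mul_assoc (D.wreath.Φ _ _), ← lastProj_f, mul_assoc]
  f_last a := by
    rw [lastX, mul_add, add_mul, Finset.mul_sum, Finset.sum_mul]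
    congr 1
    · refine LinearMap.ext fun v => ?_; funext i
      change D.slot i _ a (D.slotX i (Fin.last n) (v i)) =
        D.slotX i (Fin.last n) (D.slot i _ _ (v i))
      rw [← Module.End.mul_apply, ← Module.End.mul_apply]
      congr 1
      rcases Fin.eq_self_or_eq_succAbove i (Fin.last n) with h | ⟨l, h⟩
      · rw [h, slot_self, slotX_self, f_x]
      · rw [h, slot_succAbove, slotX_succAbove]
        change D.ρ (F.af l a) * _ = _ * D.ρ (F.af l _)
        rw [← map_mul, ← map_mul, af_mul_ax_self]
    · refine Finset.sum_congr rfl fun i hi => ?_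
      rw [mul_assoc (D.wreath.t _ _), mul_assoc (lastProj n E), D.wreath.s_f,
        Equiv.swap_apply_right, ← mul_assoc, D.wreath.f_mul_t (Finset.ne_of_mem_erase hi),
        mul_assoc, ← mul_assoc (D.wreath.Φ _ _), ← lastProj_f, mul_assoc]
  s_comm π hπ := by
    rw [lastX, mul_add, add_mul, Finset.mul_sum, Finset.sum_mul]
    congr 1
    · refine LinearMap.ext fun v => ?_; funext i
      obtain ⟨i, rfl⟩ := π.surjective i
      rw [Module.End.mul_apply, Module.End.mul_apply, wreath_S, permOp_apply, diagOp_apply,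
        diagOp_apply, permOp_apply, ← Module.End.mul_apply, ← Module.End.mul_apply]
      congr 1
      rcases Fin.eq_self_or_eq_succAbove i (Fin.last n) with h | ⟨l, h⟩
      · subst h
        rw [hπ, slotX_self, x_comm]
      · have h' : (π i).succAbove (indPerm π i l) = Fin.last n := by
          rw [succAbove_indPerm, ← h, hπ]
        conv_rhs => rw [← h']
        rw [h, slotX_succAbove, slotX_succAbove, ← map_mul, ← map_mul]
        congr 1
        cases n with
        | zero => exact l.elim0
        | succ n =>
          have e1 := eq_last_of_succAbove h.symm
          have e2 := eq_last_of_succAbove h'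
          rw [e2, e1, as_mul_ax_last (by rw [← e1, e2, e1])]
    -- Conjugation by `π` sends the summand of `i` to that of `π i`.
    · refine Finset.sum_equiv π (fun i => ?_) (fun i hi => ?_)
      · simp only [Finset.mem_erase, Finset.mem_univ, and_true]
        conv_rhs => rw [← hπ]
        exact π.injective.ne_iff.symm
      · rw [← mul_assoc, D.wreath.s_t, hπ, mul_assoc, ← mul_assoc (D.wreath.S π), ← D.lastProj_s hπ,
          mul_assoc (lastProj n E), ← map_mul, Equiv.mul_swap_eq_swap_mul, hπ, map_mul]
        simp only [mul_assoc]

/-- The embedding of the component in which the new strand is in the last position. -/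
abbrev lastIncl (n : ℕ) {E : Type*} [AddCommGroup E] (e : E) : Fin (n + 1) → E :=
  Pi.single (M := fun _ => E) (Fin.last n) e

theorem permOp_lastIncl {π : Equiv.Perm (Fin (n + 1))} (h : π (Fin.last n) = Fin.last n) (e : E) :
    D.permOp π (lastIncl n e) = lastIncl n (D.ρ (F.as (indPerm π (Fin.last n))) e) := by
  rw [permOp_single, h]

theorem permOp_castSucc_lastIncl (σ : Equiv.Perm (Fin n)) (e : E) :
    D.permOp (permCastSucc n σ) (lastIncl n e) = lastIncl n (D.ρ (F.as σ) e) := by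
  rw [permOp_lastIncl _ (permCastSucc_last σ), indPerm_permCastSucc]

theorem f_castSucc_lastIncl (j : Fin n) (a : F.carrier) (e : E) :
    D.wreath.Φ j.castSucc a (lastIncl n e) = lastIncl n (D.ρ (F.af j a) e) := by
  have h := D.slot_succAbove (Fin.last n) j
  rw [Fin.succAbove_last] at h
  rw [wreath_Φ_single, h]; rfl

theorem f_last_lastIncl (a : F.carrier) (e : E) :
    D.wreath.Φ (Fin.last n) a (lastIncl n e) = lastIncl n (D.Φ a e) := by
  rw [wreath_Φ_single, slot_self]

theorem t_castSucc_lastIncl (i j : Fin n) (e : E) :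
    D.wreath.t i.castSucc j.castSucc (lastIncl n e) =
      lastIncl n (D.ρ ((F.affRep n).t i j) e) := by
  have hs : ∀ (s : Finset F.ι) (g : F.ι → E), ∑ b ∈ s, lastIncl n (g b) =
      lastIncl n (∑ b ∈ s, g b) := fun s g =>
    (map_sum (LinearMap.single k (fun _ => E) (Fin.last n)) g s).symm
  rw [WreathRep.t, WreathRep.t, casimir, casimir, LinearMap.sum_apply, map_sum,
    LinearMap.sum_apply, ← hs]
  refine Finset.sum_congr rfl fun b _ => ?_
  rw [Module.End.mul_apply, f_castSucc_lastIncl, f_castSucc_lastIncl, map_mul]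
  rfl

theorem lastX_single_of_ne {i : Fin (n + 1)} (h : i ≠ Fin.last n) (e : E) :
    D.lastX (Pi.single i e) = Pi.single i (D.slotX i (Fin.last n) e) +
      D.wreath.t i (Fin.last n)
        (D.permOp (Equiv.swap i (Fin.last n)) (Pi.single i e)) := by
  have h1 : D.diagOp (Pi.single i e) = Pi.single i (D.slotX i (Fin.last n) e) := by
    funext l
    rw [diagOp_apply]
    by_cases h : l = i
    · subst h; simp
    · rw [Pi.single_eq_of_ne h, Pi.single_eq_of_ne h, map_zero]
  rw [lastX, LinearMap.add_apply, h1, LinearMap.sum_apply,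
    Finset.sum_eq_single_of_mem i (Finset.mem_erase.2 ⟨h, Finset.mem_univ _⟩)]
  · rw [Module.End.mul_apply, Module.End.mul_apply, wreath_S, permOp_single,
      Equiv.swap_apply_left, lastProj_apply, Pi.single_eq_same]
  · intro j hj hji
    rw [Module.End.mul_apply, Module.End.mul_apply, wreath_S, permOp_single,
      Equiv.swap_apply_of_ne_of_ne hji.symm h, lastProj_apply, Pi.single_eq_of_ne h.symm,
      Pi.single_zero, map_zero]

theorem lastX_lastIncl (e : E) : D.lastX (lastIncl n e) = lastIncl n (D.X e) := by
  have h1 : D.diagOp (lastIncl n e) = lastIncl n (D.X e) := by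
    funext l
    change D.slotX l (Fin.last n) ((Pi.single (Fin.last n) e : Fin (n + 1) → E) l) =
      (Pi.single (Fin.last n) (D.X e) : Fin (n + 1) → E) l
    by_cases h : l = Fin.last n
    · subst h; simp [slotX_self]
    · rw [Pi.single_eq_of_ne h, Pi.single_eq_of_ne h, map_zero]
  rw [lastX, LinearMap.add_apply, h1, LinearMap.sum_apply, Finset.sum_eq_zero, add_zero]
  intro j hj
  rw [Module.End.mul_apply, Module.End.mul_apply, wreath_S, permOp_single,
    Equiv.swap_apply_right, lastProj_apply, Pi.single_eq_of_ne (Finset.ne_of_mem_erase hj).symm,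
    Pi.single_zero, map_zero]

/-- Exchanging the new strand with its neighbour does not change the order of the old strands. -/
theorem indPerm_simpleSwap_last {i : Fin n} (h : i.succ = Fin.last n) :
    indPerm (simpleSwap i) (Fin.last n) = 1 := by
  refine indPerm_eq fun j => ?_
  have hs : simpleSwap i (Fin.last n) = i.castSucc := by rw [← h, Equiv.swap_apply_right]
  rw [hs, Equiv.Perm.one_apply, Fin.succAbove_last]
  by_cases hj : j = i
  · subst hj; rw [Fin.succAbove_castSucc_self, Equiv.swap_apply_left]
  · have : j < i := by
      refine lt_of_le_of_ne ?_ hj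
      have := congrArg Fin.val h
      rw [Fin.val_succ, Fin.val_last] at this
      rw [Fin.le_def]; omega
    rw [Fin.succAbove_of_castSucc_lt _ _ (Fin.castSucc_lt_castSucc_iff.2 this),
      Equiv.swap_apply_of_ne_of_ne]
    · exact fun h => hj (Fin.castSucc_injective _ h)
    · rw [h]; exact Fin.castSucc_ne_last j

/-- The neighbour of the last generator is computed from `lastX` on the two last positions, where
the Casimir term of `lastX` cancels that of the recursion. Below it, the recursion defining `xs` is
the one satisfied by the `x_i` inside `𝒜_n(F)`. -/
theorem xs_castSucc_lastIncl (i : Fin n) (e : E) :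
    D.wreath.xs D.lastX i.castSucc (lastIncl n e) = lastIncl n (D.ρ (F.ax i) e) := by
  obtain _ | n := n
  · exact i.elim0
  induction i using Fin.reverseInduction generalizing e with
  | last =>
    have h : (Fin.last n).succ = Fin.last (n + 1) := Fin.succ_last n
    have hs : ∀ e : E, D.permOp (simpleSwap (Fin.last n)) (lastIncl (n + 1) e) =
        Pi.single (Fin.last n).castSucc e := by
      intro e
      rw [permOp_single, indPerm_simpleSwap_last h, as_one, map_one, ← h, Equiv.swap_apply_right]
      rfl
    have hs' : ∀ e : E, D.permOp (simpleSwap (Fin.last n)) (Pi.single (Fin.last n).castSucc e) =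
        lastIncl (n + 1) e := by
      intro e
      rw [← hs, ← Module.End.mul_apply, ← wreath_S, WreathRep.s_swap_sq, Module.End.one_apply]
    have hX : D.slotX (Fin.last n).castSucc (Fin.last (n + 1)) = D.ρ (F.ax (Fin.last n)) := by
      rw [← h, ← Fin.succAbove_castSucc_self, slotX_succAbove]
    have ht := LinearMap.congr_fun (D.wreath.s_t (simpleSwap (Fin.last n))
      (Fin.last n).castSucc (Fin.last n).succ) (lastIncl (n + 1) e)
    rw [Equiv.swap_apply_left, Equiv.swap_apply_right, Module.End.mul_apply,
      Module.End.mul_apply] at ht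
    rw [WreathRep.xs_castSucc, h, WreathRep.xs_last, LinearMap.sub_apply, Module.End.mul_apply,
      Module.End.mul_apply, Module.End.mul_apply, wreath_S, hs,
      D.lastX_single_of_ne (Fin.castSucc_ne_last _), map_add, hX, ← h, hs', hs', ← wreath_S, ht,
      wreath_S, hs, add_sub_cancel_right]
  | cast i ih =>
    have hs : ∀ e : E, D.wreath.S (simpleSwap i.castSucc) (lastIncl (n + 1) e) =
        lastIncl (n + 1) (D.ρ (F.as (simpleSwap i)) e) := by
      intro e
      rw [wreath_S, ← permOp_castSucc_lastIncl, permCastSucc_swap, Fin.castSucc_succ]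
    rw [WreathRep.xs_castSucc, LinearMap.sub_apply, Module.End.mul_apply,
      Module.End.mul_apply, Module.End.mul_apply, hs, Fin.succ_castSucc, ih, hs,
      t_castSucc_lastIncl, ← Pi.single_sub, ← Module.End.mul_apply, ← Module.End.mul_apply,
      ← Module.End.mul_apply, ← map_mul, ← map_mul, ← map_mul, ← LinearMap.sub_apply, ← map_sub]
    congr 3
    have h1 := ax_castSucc_mul_as (F := F) i
    have h2 := congrArg (· * F.as (simpleSwap i)) h1
    have h3 := (F.affRep (n + 1)).s_swap_sq i.castSucc i.succ
    rw [affRep_S] at h3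
    simp only [mul_assoc, sub_mul] at h2
    rw [h3, mul_one] at h2
    rw [h2, mul_assoc]

/-- The commutator `Z` of the last two generators vanishes on the last component, where they act by
the commuting operators `X` and `ρ(x)`. It anticommutes with the transposition `s` of the last two
strands, so it also vanishes on the next-to-last component. For the other components, moving `Z`
past simple transpositions turns it into commutators of earlier generators, which vanish on the last
component because they come from `𝒜_n(F)`. -/
theorem lastX_comm (i : Fin n) (hi : i.succ = Fin.last n) :
    Commute D.lastX (D.wreath.xs D.lastX i.castSucc) := by
  have hY := D.isLastVar_lastX
  set w := D.wreath with hw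
  set Y := D.lastX with hYdef
  set Y' := w.xs Y i.castSucc with hY'
  set s := w.S (simpleSwap i) with hs
  have hne : i.castSucc ≠ i.succ := (Fin.castSucc_lt_succ).ne
  have e1 : Y' * s = s * Y - w.t i.succ i.castSucc := by
    have := w.xs_castSucc_mul_s Y i
    rwa [hi, w.xs_last, ← hi] at this
  have e2 : Y * s = s * Y' + w.t i.castSucc i.succ := by
    have := w.xs_succ_mul_s Y i
    rwa [hi, w.xs_last, ← hi] at this
  have e3 : w.t i.castSucc i.succ * Y = Y * w.t i.succ i.castSucc := by
    rw [hi]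
    exact w.t_mul_of_twist (by rw [← hi]; exact hne) (hY.f_comm _ (by rw [← hi]; exact hne))
      hY.f_last
  have e4 : w.t i.succ i.castSucc * Y' = Y' * w.t i.castSucc i.succ :=
    w.t_mul_of_twist hne.symm ((hY.f_xs _).1 _ hne.symm) (hY.f_xs _).2
  -- The Casimir terms produced by moving `s` through `Y * Y'` and `Y' * Y` cancel by `e3` and `e4`.
  have hZs : (Y * Y' - Y' * Y) * s = - (s * (Y * Y' - Y' * Y)) := by
    have a1 : Y * (Y' * s) = (Y * s) * Y - Y * w.t i.succ i.castSucc := by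
      rw [e1, mul_sub, mul_assoc]
    have a2 : Y' * (Y * s) = (Y' * s) * Y' + Y' * w.t i.castSucc i.succ := by
      rw [e2, mul_add, mul_assoc]
    rw [sub_mul, mul_assoc, mul_assoc, a1, a2, e1, e2, add_mul, sub_mul, e3, e4, mul_sub,
      mul_assoc, mul_assoc]
    abel
  have hι : ∀ (l : Fin n) (e : E), w.xs Y l.castSucc (lastIncl n e) =
    lastIncl n (D.ρ (F.ax l) e) := D.xs_castSucc_lastIncl
  have hY1 : ∀ e : E, Y (lastIncl n e) = lastIncl n (D.X e) := D.lastX_lastIncl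
  have hZι : ∀ e : E, (Y * Y' - Y' * Y) (lastIncl n e) = 0 := by
    intro e
    rw [LinearMap.sub_apply, Module.End.mul_apply, Module.End.mul_apply, hY', hι, hY1, hY1, hι,
      ← Module.End.mul_apply, D.x_comm, Module.End.mul_apply, sub_self]
  suffices hZ : Y * Y' - Y' * Y = 0 from sub_eq_zero.1 hZ
  have hind : ∀ (T : Module.End k (Fin (n + 1) → E)),
      (∀ j e, T (Pi.single j e) = 0) → T = 0 := fun T hT =>
    LinearMap.pi_ext' fun j => LinearMap.ext fun e => hT j e
  refine hind _ fun j e => ?_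
  by_cases hj : j = Fin.last n
  · subst hj; exact hZι e
  have key : ∀ e : E, (Y * Y' - Y' * Y) (s (lastIncl n e)) = 0 := by
    intro e
    rw [← Module.End.mul_apply, hZs, LinearMap.neg_apply, Module.End.mul_apply, hZι, map_zero,
      neg_zero]
  by_cases hji : j = i.castSucc
  · subst hji
    have hsl : simpleSwap i (Fin.last n) = i.castSucc := by rw [← hi, Equiv.swap_apply_right]
    rw [← hsl, D.single_eq_permOp]
    exact key _
  -- the remaining positions are reached from the second to last by permutations fixing the last two
  obtain ⟨n, rfl⟩ : ∃ m, n = m + 1 := ⟨n - 1, by have := i.2; omega⟩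
  obtain rfl : i = Fin.last n := Fin.succ_injective _ (hi.trans (Fin.succ_last n).symm)
  obtain ⟨l, rfl⟩ : ∃ l : Fin n, j = l.castSucc.castSucc := by
    induction j using Fin.lastCases with
    | last => exact (hj rfl).elim
    | cast j =>
      induction j using Fin.lastCases with
      | last => exact (hji rfl).elim
      | cast l => exact ⟨l, rfl⟩
  obtain ⟨m, rfl⟩ : ∃ m, n = m + 1 := ⟨n - 1, by have := l.2; omega⟩
  set i' : Fin (m + 2) := (Fin.last m).castSucc with hi'
  have hi's : i'.succ = (Fin.last (m + 1)).castSucc := by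
    rw [hi', Fin.succ_castSucc, Fin.succ_last]
  set s' := w.S (simpleSwap i') with hs'
  set X'' := w.xs Y i'.castSucc with hX''
  have ne1 : i'.castSucc ≠ (Fin.last (m + 1)).castSucc := by
    rw [← hi's]; exact (Fin.castSucc_lt_succ).ne
  have ne2 : i'.castSucc ≠ (Fin.last (m + 1)).succ := by
    rw [Fin.succ_last]; exact Fin.castSucc_ne_last _
  have f1 : s * X'' = X'' * s := hY.s_xs (Fin.last (m + 1)) i'.castSucc ne1 ne2
  have f2 : Y' * s' = s' * X'' + w.t i'.castSucc i'.succ := by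
    have := w.xs_succ_mul_s Y i'
    rwa [hi's, ← hY', ← hi's] at this
  have n1 : Fin.last (m + 2) ≠ i'.castSucc := (Fin.castSucc_ne_last _).symm
  have n2 : Fin.last (m + 2) ≠ i'.succ := by rw [hi's]; exact (Fin.castSucc_ne_last _).symm
  have f3 : s' * Y = Y * s' := hY.s_comm _ (Equiv.swap_apply_of_ne_of_ne n1 n2)
  have f4 : w.t i'.castSucc i'.succ * Y = Y * w.t i'.castSucc i'.succ :=
    w.t_comm (hY.f_comm _ n1.symm) (hY.f_comm _ n2.symm)
  have f5 : w.t (Fin.last (m + 1)).castSucc (Fin.last (m + 1)).succ * X'' =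
      X'' * w.t (Fin.last (m + 1)).castSucc (Fin.last (m + 1)).succ :=
    w.t_comm ((hY.f_xs _).1 _ ne1.symm) ((hY.f_xs _).1 _ ne2.symm)
  -- Passing `s'` and then `s` replaces the commutator `[Y, Y']` first by `[Y, X'']` and then by
  -- `[Y', X'']`, a commutator of two old generators on the last component.
  have g1 : (Y * Y' - Y' * Y) * s' = s' * (Y * X'' - X'' * Y) := by
    have a1 : Y * (Y' * s') = (Y * s') * X'' + Y * w.t i'.castSucc i'.succ := by
      rw [f2, mul_add, mul_assoc]
    have a2 : Y' * (Y * s') = (Y' * s') * Y := by rw [← f3, mul_assoc]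
    rw [sub_mul, mul_assoc, mul_assoc, a1, a2, ← f3, f2, add_mul, f4, mul_sub, mul_assoc,
      mul_assoc]
    abel
  have g2 : (Y * X'' - X'' * Y) * s = s * (Y' * X'' - X'' * Y') := by
    have a1 : Y * (X'' * s) = (Y * s) * X'' := by rw [← f1, mul_assoc]
    have a2 : X'' * (Y * s) = (X'' * s) * Y' +
        X'' * w.t (Fin.last (m + 1)).castSucc (Fin.last (m + 1)).succ := by
      rw [e2, mul_add, mul_assoc]
    rw [sub_mul, mul_assoc, mul_assoc, a1, a2, ← f1, e2, add_mul, f5, mul_sub, mul_assoc,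
      mul_assoc]
    abel
  have g3 : ∀ e : E, (Y' * X'' - X'' * Y') (lastIncl _ e) = 0 := by
    intro e
    rw [LinearMap.sub_apply, Module.End.mul_apply, Module.End.mul_apply, hY', hX'', hι, hι, hι, hι,
      ← Module.End.mul_apply, ← map_mul, ax_comm, map_mul, Module.End.mul_apply, sub_self]
  have key2 : ∀ e : E, (Y * Y' - Y' * Y) (s' (s (lastIncl _ e))) = 0 := by
    intro e
    rw [← Module.End.mul_apply, g1, Module.End.mul_apply, ← Module.End.mul_apply _ s, g2,
      Module.End.mul_apply, g3, map_zero, map_zero]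
  -- The product `s' * s` reaches only the third position from the end; `τ` carries it to any
  -- earlier one, and it fixes the last two points, hence commutes with `Y` and `Y'`.
  set τ : Equiv.Perm (Fin (m + 1 + 1 + 1)) := Equiv.swap l.castSucc.castSucc i'.castSucc with hτ
  have nl : ∀ l : Fin (m + 1), (Fin.last (m + 1)).castSucc ≠ l.castSucc.castSucc := fun l h =>
    Fin.castSucc_ne_last l (Fin.castSucc_injective _ h).symm
  have τ1 : τ (Fin.last (m + 2)) = Fin.last (m + 2) :=
    Equiv.swap_apply_of_ne_of_ne (Fin.castSucc_ne_last _).symm (Fin.castSucc_ne_last _).symm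
  have τ2 : τ (Fin.last (m + 1)).castSucc = (Fin.last (m + 1)).castSucc :=
    Equiv.swap_apply_of_ne_of_ne (nl l) (nl _)
  have c1 : w.S τ * Y = Y * w.S τ := hY.s_comm τ τ1
  have c2 : w.S τ * s = s * w.S τ := by
    have τ3 : τ (Fin.last (m + 1)).succ = (Fin.last (m + 1)).succ := by rw [hi]; exact τ1
    rw [hs, ← map_mul, ← map_mul, Equiv.mul_swap_eq_swap_mul, τ2, τ3]
  have c3 : w.S τ * Y' = Y' * w.S τ := by
    have hx := w.xs_castSucc Y (Fin.last (m + 1))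
    rw [hi, w.xs_last, ← hs, ← hY'] at hx
    have ht := w.s_t τ (Fin.last (m + 2)) (Fin.last (m + 1)).castSucc
    rw [τ2, τ1] at ht
    have c1' : Commute (w.S τ) Y := c1
    have c2' : Commute (w.S τ) s := c2
    have c4' : Commute (w.S τ) (w.t (Fin.last (m + 2)) (Fin.last (m + 1)).castSucc) := ht
    rw [hx]
    exact ((c2'.mul_right c1').mul_right c2').sub_right (c4'.mul_right c2')
  have c4 : (Y * Y' - Y' * Y) * w.S τ = w.S τ * (Y * Y' - Y' * Y) := by
    have c1' : Commute (w.S τ) Y := c1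
    have c3' : Commute (w.S τ) Y' := c3
    exact ((c1'.mul_right c3').sub_right (c3'.mul_right c1')).symm
  have p1 : simpleSwap (Fin.last (m + 1)) (Fin.last (m + 2)) = i'.succ := by
    rw [hi's]
    exact (congrArg _ hi.symm).trans (Equiv.swap_apply_right _ _)
  have p : (τ * (simpleSwap i' * simpleSwap (Fin.last (m + 1)))) (Fin.last (m + 2)) =
      l.castSucc.castSucc := by
    rw [Equiv.Perm.mul_apply, Equiv.Perm.mul_apply, p1, Equiv.swap_apply_right, hτ,
      Equiv.swap_apply_right]
  rw [← p, D.single_eq_permOp, ← wreath_S, map_mul, map_mul, ← Module.End.mul_apply, ← mul_assoc,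
    c4, mul_assoc, Module.End.mul_apply, Module.End.mul_apply, Module.End.mul_apply]
  exact (congrArg _ (key2 _)).trans (map_zero _)

/-- The action of `𝒜_{n+1}(F)` on the induced module. -/
noncomputable def indAction : F.Affine (n + 1) →ₐ[k] Module.End k (Fin (n + 1) → E) :=
  D.isLastVar_lastX.toAffine D.lastX_comm

theorem indAction_as (π : Equiv.Perm (Fin (n + 1))) : D.indAction (F.as π) = D.permOp π := by
  rw [indAction, WreathRep.IsLastVar.toAffine_as, wreath_S]

theorem indAction_af (j : Fin (n + 1)) (a : F.carrier) :
    D.indAction (F.af j a) = D.wreath.Φ j a := by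
  rw [indAction, WreathRep.IsLastVar.toAffine_af]

theorem indAction_ax_last : D.indAction (F.ax (Fin.last n)) = D.lastX := by
  rw [indAction, WreathRep.IsLastVar.toAffine_ax, WreathRep.xs_last]

theorem indAction_incl (a : F.Affine n) (e : E) :
    D.indAction (F.affineIncl n a) (lastIncl n e) = lastIncl n (D.ρ a e) := by
  revert e
  refine F.affine_ind (fun a => ∀ e, D.indAction (F.affineIncl n a) (lastIncl n e) =
    lastIncl n (D.ρ a e)) ?_ ?_ ?_ ?_ ?_ ?_ a
  · intro r e
    simp only [AlgHom.commutes, Module.algebraMap_end_apply]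
    exact (Pi.single_smul _ _ _).symm
  · intro i e
    rw [affineIncl, Affine.lift_ax, ← D.xs_castSucc_lastIncl]
    rw [indAction, WreathRep.IsLastVar.toAffine_ax]
  · intro i a e
    rw [affineIncl, Affine.lift_af, afHom_apply, indAction_af, f_castSucc_lastIncl]
  · intro π e
    rw [affineIncl, Affine.lift_as]
    change D.indAction (F.as (permCastSucc n π)) _ = _
    rw [indAction_as, permOp_castSucc_lastIncl]
  · intro a b ha hb e
    simp only [map_add, LinearMap.add_apply, ha, hb]
    exact (Pi.single_add _ _ _).symm
  · intro a b ha hb e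
    rw [map_mul, map_mul, Module.End.mul_apply, hb, ha, map_mul, Module.End.mul_apply]

end StrandRep

end FrobSuperalgebra

/-! ### The wreath product subalgebra and the element `χ`. -/

namespace FrobSuperalgebra

variable {k : Type u} [CommRing k] {F : FrobSuperalgebra k} {n : ℕ}

variable (F n) in
/-- The subalgebra of `𝒜_n(F)` generated by the copies of `F` and the permutations. -/
noncomputable def wreathSub : Subalgebra k (F.Affine n) :=
  Algebra.adjoin k ({z | ∃ π, z = F.as π} ∪ {z | ∃ i a, z = F.af i a})

theorem as_mem_wreathSub (π : Equiv.Perm (Fin n)) : F.as π ∈ F.wreathSub n :=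
  Algebra.subset_adjoin (Or.inl ⟨π, rfl⟩)

theorem af_mem_wreathSub (i : Fin n) (a : F.carrier) : F.af i a ∈ F.wreathSub n :=
  Algebra.subset_adjoin (Or.inr ⟨i, a, rfl⟩)

theorem t_mem_wreathSub (i j : Fin n) : (F.affRep n).t i j ∈ F.wreathSub n :=
  sum_mem fun _ _ => mul_mem (af_mem_wreathSub _ _) (af_mem_wreathSub _ _)

theorem wreathSub_ind {P : F.Affine n → Prop} (h0 : ∀ r, P (algebraMap k _ r))
    (hf : ∀ i a, P (F.af i a)) (hs : ∀ π, P (F.as π))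
    (hadd : ∀ a b, P a → P b → P (a + b)) (hmul : ∀ a b, P a → P b → P (a * b))
    {a : F.Affine n} (ha : a ∈ F.wreathSub n) : P a := by
  refine Algebra.adjoin_induction (p := fun a _ => P a) ?_ h0 (fun a b _ _ => hadd a b)
    (fun a b _ _ => hmul a b) ha
  rintro _ (⟨π, rfl⟩ | ⟨i, a, rfl⟩)
  exacts [hs π, hf i a]

/-- Permutations permute the `x_j` up to terms without polynomial generators. For a simple
transposition the defect is a Casimir element up to sign or zero, and the defect of a product is
expressed through the defects of its factors. -/
theorem ax_mul_as_sub_mem (π : Equiv.Perm (Fin (n + 1))) (j : Fin (n + 1)) :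
    F.ax (π j) * F.as π - F.as π * F.ax j ∈ F.wreathSub (n + 1) := by
  have simple : ∀ (i : Fin n) (j : Fin (n + 1)), F.ax (simpleSwap i j) * F.as (simpleSwap i) -
      F.as (simpleSwap i) * F.ax j ∈ F.wreathSub (n + 1) := by
    intro i j
    by_cases h1 : j = i.castSucc
    · subst h1
      rw [Equiv.swap_apply_left, as_mul_ax_castSucc, sub_sub_cancel]
      exact t_mem_wreathSub _ _
    by_cases h2 : j = i.succ
    · subst h2
      rw [Equiv.swap_apply_right, as_mul_ax_succ, sub_add_cancel_left]
      exact neg_mem (t_mem_wreathSub _ _)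
    · rw [Equiv.swap_apply_of_ne_of_ne h1 h2, as_mul_ax_ne h1 h2, sub_self]
      exact zero_mem _
  induction π using perm_induction generalizing j with
  | h1 => rw [as_one, Equiv.Perm.one_apply, mul_one, one_mul, sub_self]; exact zero_mem _
  | hs i σ ih =>
    have : F.ax ((simpleSwap i * σ) j) * F.as (simpleSwap i * σ) - F.as (simpleSwap i * σ) * F.ax j
        = (F.ax (simpleSwap i (σ j)) * F.as (simpleSwap i) - F.as (simpleSwap i) * F.ax (σ j)) *
          F.as σ + F.as (simpleSwap i) * (F.ax (σ j) * F.as σ - F.as σ * F.ax j) := by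
      rw [as_mul, Equiv.Perm.mul_apply]; noncomm_ring
    rw [this]
    exact add_mem (mul_mem (simple i _) (as_mem_wreathSub _))
      (mul_mem (as_mem_wreathSub _) (ih j))

/-- The affine algebra is generated by one polynomial generator and the wreath product
subalgebra. -/
theorem affine_ind_of_index (l : Fin (n + 1)) {P : F.Affine (n + 1) → Prop}
    (h0 : ∀ r, P (algebraMap k _ r))
    (hx : P (F.ax l)) (hf : ∀ i a, P (F.af i a)) (hs : ∀ π, P (F.as π))
    (hadd : ∀ a b, P a → P b → P (a + b)) (hmul : ∀ a b, P a → P b → P (a * b))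
    (a : F.Affine (n + 1)) : P a := by
  refine F.affine_ind P h0 (fun i => ?_) hf hs hadd hmul a
  have hW : ∀ z ∈ F.wreathSub (n + 1), P z := fun z => wreathSub_ind h0 hf hs hadd hmul
  set π := Equiv.swap i l
  have e : F.ax i = F.as π * F.ax l * F.as π + (F.ax i * F.as π - F.as π * F.ax l) * F.as π := by
    have := (F.affRep (n + 1)).s_swap_sq i l
    rw [affRep_S] at this
    rw [sub_mul, mul_assoc (F.ax i), this, mul_one, add_sub_cancel]
  rw [e]
  refine hadd _ _ (hmul _ _ (hmul _ _ (hs _) hx) (hs _)) (hmul _ _ (hW _ ?_) (hs _))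
  have := ax_mul_as_sub_mem (F := F) π l
  rwa [Equiv.swap_apply_right] at this

theorem affine_ind_zero {P : F.Affine n → Prop} (h0 : ∀ r, P (algebraMap k _ r))
    (hx : ∀ h : 0 < n, P (F.ax ⟨0, h⟩)) (hf : ∀ i a, P (F.af i a)) (hs : ∀ π, P (F.as π))
    (hadd : ∀ a b, P a → P b → P (a + b)) (hmul : ∀ a b, P a → P b → P (a * b))
    (a : F.Affine n) : P a := by
  obtain _ | n := n
  · exact F.affine_ind P h0 (fun i => i.elim0) hf hs hadd hmul a
  · exact affine_ind_of_index 0 h0 (hx n.succ_pos) hf hs hadd hmul a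

/-- An induction principle for the element `χ`. -/
theorem CycParam.chi_ind (C : F.CycParam) (i : Fin n) {P : F.Affine n → ℕ → Prop}
    (h1 : P 1 0) (hmul : ∀ z w l m, P z l → P w m → P (z * w) (l + m))
    (hfac : ∀ (m : Fin F.theta) j, P (F.ax i ^ ((m : ℕ) + 1) - F.af i (C.c m j)) (m + 1)) :
    P (C.chi i) C.level := by
  have hlist : ∀ {X : Type} (l : List X) (f : X → F.Affine n) (g : X → ℕ),
      (∀ x, P (f x) (g x)) → P (l.map f).prod (l.map g).sum := by
    intro X l f g h
    induction l with
    | nil => exact h1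
    | cons x l ih =>
      rw [List.map_cons, List.map_cons, List.prod_cons, List.sum_cons]
      exact hmul _ _ _ _ (h x) ih
  -- The second argument of `P` adds up the degrees of the factors of `χ` in `x_i`; their total is
  -- the level.
  rw [chi, List.ofFn_eq_map, level, ← List.sum_ofFn, List.ofFn_eq_map]
  refine hlist _ _ _ fun m => ?_
  have : ((m : ℕ) + 1) * C.e m = ((List.finRange (C.e m)).map fun _ => (m : ℕ) + 1).sum := by
    simp [mul_comm]
  rw [List.ofFn_eq_map, this]
  exact hlist _ _ _ fun j => hfac m j

/-- For `j = i` this rests on the `c^{(m,j)}` being fixed by `ψ`. -/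
theorem CycParam.ax_mul_chi (C : F.CycParam) (i j : Fin n) :
    F.ax j * C.chi i = C.chi i * F.ax j := by
  refine C.chi_ind i (P := fun z _ => Commute (F.ax j) z) (.one_right _)
    (fun _ _ _ _ h h' => h.mul_right h') fun m l => ?_
  refine (Commute.pow_right (ax_comm j i) _).sub_right ?_
  change _ * _ = _ * _
  by_cases h : j = i
  · subst h
    rw [af_mul_ax_self, (C.c_central m l).1]
  · rw [af_mul_ax_ne h]

theorem CycParam.as_mul_chi (C : F.CycParam) {π : Equiv.Perm (Fin (n + 1))} (h : π 0 = 0) :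
    F.as π * C.chi 0 = C.chi 0 * F.as π := by
  refine C.chi_ind 0 (P := fun z _ => Commute (F.as π) z) (.one_right _)
    (fun _ _ _ _ h h' => h.mul_right h') fun m l => ?_
  refine (Commute.pow_right (as_mul_ax_zero h) _).sub_right ?_
  change _ * _ = _ * _
  rw [as_mul_af, h]

theorem af_mul_ax_pow (i : Fin n) (a : F.carrier) (m : ℕ) :
    F.af i a * F.ax i ^ m = F.ax i ^ m * F.af i ((F.nakayama ^ m) a) := by
  induction m generalizing a with
  | zero => simp
  | succ m ih =>
    rw [pow_succ, pow_succ, ← mul_assoc, ih, mul_assoc, af_mul_ax_self, mul_assoc,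
      ← Module.End.mul_apply, ← pow_succ', pow_succ]

/-- In slot `i` both `x_i^m` and `c^{(m,j)}` twist `f` by the same power `ψ^m`, so each factor of
`χ` can be passed; in the other slots evenness of `c^{(m,j)}` is used. Only the existence of the
twisted element matters later. -/
theorem CycParam.exists_af_mul_chi (C : F.CycParam) (i j : Fin n) (a : F.carrier) :
    ∃ a', F.af j a * C.chi i = C.chi i * F.af j a' := by
  refine C.chi_ind i (P := fun z _ => ∀ a, ∃ a', F.af j a * z = z * F.af j a') ?_ ?_ ?_ a
  · exact fun a => ⟨a, by rw [mul_one, one_mul]⟩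
  · intro z w _ _ hz hw a
    obtain ⟨a₁, h₁⟩ := hz a
    obtain ⟨a₂, h₂⟩ := hw a₁
    exact ⟨a₂, by rw [← mul_assoc, h₁, mul_assoc, h₂, mul_assoc]⟩
  · intro m l a
    by_cases h : i = j
    · subst h
      refine ⟨(F.nakayama ^ ((m : ℕ) + 1)) a, ?_⟩
      have : F.af i a * F.af i (C.c m l) =
          F.af i (C.c m l) * F.af i ((F.nakayama ^ ((m : ℕ) + 1)) a) := by
        simp only [← afHom_apply, ← map_mul]
        rw [(C.c_central m l).2]
      rw [mul_sub, sub_mul, af_mul_ax_pow, this]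
    · refine ⟨a, ?_⟩
      have h1 : Commute (F.af j a) (F.ax i) := af_mul_ax_ne h a
      have h2 : Commute (F.af j a) (F.af i (C.c m l)) :=
        (((F.affRep n).superComm i j h).of_even (C.c_mem m l) a).symm
      exact (h1.pow_right _).sub_right h2

/-- Multiplication by `χ` shifts a filtration, and is given by the `d`-fold shift along towers of
elements for which this holds for `x_i`. -/
theorem CycParam.chi_filtration (C : F.CycParam) (i : Fin n) {V : Type*} [AddCommGroup V] [Module k V]
    (α : F.Affine n →ₗ[k] Module.End k V) (h1 : α 1 = 1)
    (hα : (∀ z w, α (z * w) = α z * α w) ∨ ∀ z w, α (z * w) = α w * α z)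
    {G : ℕ → Submodule k V} (hG : Monotone G) (hx : ∀ a, ∀ v ∈ G a, α (F.ax i) v ∈ G (a + 1))
    (hf : ∀ c a, ∀ v ∈ G a, α (F.af i c) v ∈ G a) {T : Set (ℕ → V)}
    (hT : ∀ e ∈ T, ∀ a, e a ∈ G (a + 1) ∧ α (F.ax i) (e a) - e (a + 1) ∈ G (a + 1)) :
    (∀ a, ∀ v ∈ G a, α (C.chi i) v ∈ G (a + C.level)) ∧
      ∀ e ∈ T, ∀ a, α (C.chi i) (e a) - e (a + C.level) ∈ G (a + C.level) := by
  have h1' : (∀ a, ∀ v ∈ G a, α 1 v ∈ G (a + 0)) ∧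
      ∀ e ∈ T, ∀ a, α 1 (e a) - e (a + 0) ∈ G (a + 0) := by
    simp only [h1, add_zero, Module.End.one_apply, sub_self, zero_mem, implies_true, and_true]
    exact fun _ _ h => h
  have hmul : ∀ z w l m, ((∀ a, ∀ v ∈ G a, α z v ∈ G (a + l)) ∧
      ∀ e ∈ T, ∀ a, α z (e a) - e (a + l) ∈ G (a + l)) → ((∀ a, ∀ v ∈ G a, α w v ∈ G (a + m)) ∧
      ∀ e ∈ T, ∀ a, α w (e a) - e (a + m) ∈ G (a + m)) →
      ((∀ a, ∀ v ∈ G a, α (z * w) v ∈ G (a + (l + m))) ∧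
      ∀ e ∈ T, ∀ a, α (z * w) (e a) - e (a + (l + m)) ∈ G (a + (l + m))) := by
    have key : ∀ (z w : Module.End k V) l m, ((∀ a, ∀ v ∈ G a, z v ∈ G (a + l)) ∧
        ∀ e ∈ T, ∀ a, z (e a) - e (a + l) ∈ G (a + l)) → ((∀ a, ∀ v ∈ G a, w v ∈ G (a + m)) ∧
        ∀ e ∈ T, ∀ a, w (e a) - e (a + m) ∈ G (a + m)) →
        ((∀ a, ∀ v ∈ G a, (z * w) v ∈ G (a + (l + m))) ∧
        ∀ e ∈ T, ∀ a, (z * w) (e a) - e (a + (l + m)) ∈ G (a + (l + m))) := by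
      rintro z w l m ⟨hz1, hz2⟩ ⟨hw1, hw2⟩
      have e1 : ∀ a, a + (l + m) = a + m + l := fun a => by omega
      refine ⟨fun a v hv => ?_, fun e he a => ?_⟩
      · rw [e1]; exact hz1 _ _ (hw1 _ _ hv)
      · rw [e1, Module.End.mul_apply, ← sub_add_sub_cancel _ (z (e (a + m))), ← map_sub]
        exact add_mem (hz1 _ _ (hw2 e he a)) (hz2 e he _)
    intro z w l m hz hw
    rcases hα with hα | hα
    · rw [hα]; exact key _ _ _ _ hz hw
    · rw [hα, add_comm l m]; exact key _ _ _ _ hw hz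
  have hpow : ∀ m, (∀ a, ∀ v ∈ G a, α (F.ax i ^ m) v ∈ G (a + m)) ∧
      ∀ e ∈ T, ∀ a, α (F.ax i ^ m) (e a) - e (a + m) ∈ G (a + m) := by
    intro m
    induction m with
    | zero => rw [pow_zero]; exact h1'
    | succ m ih => rw [pow_succ]; exact hmul _ _ _ _ ih ⟨hx, fun e he a => (hT e he a).2⟩
  refine C.chi_ind i (P := fun z m => (∀ a, ∀ v ∈ G a, α z v ∈ G (a + m)) ∧
    ∀ e ∈ T, ∀ a, α z (e a) - e (a + m) ∈ G (a + m)) h1' hmul ?_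
  · intro m l
    obtain ⟨hz1, hz2⟩ : (∀ a, ∀ v ∈ G a, α (F.ax i ^ ((m : ℕ) + 1)) v ∈ G (a + (m + 1))) ∧
        ∀ e ∈ T, ∀ a, α (F.ax i ^ ((m : ℕ) + 1)) (e a) - e (a + (m + 1)) ∈ G (a + (m + 1)) :=
      hpow _
    refine ⟨fun a v hv => ?_, fun e he a => ?_⟩
    · rw [map_sub]
      -- The constant term of the factor does not raise the degree, so it is absorbed by
      -- monotonicity.
      exact sub_mem (hz1 _ _ hv) (hG (Nat.le_add_right _ _) (hf _ _ _ hv))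
    · rw [map_sub, LinearMap.sub_apply, sub_right_comm]
      exact sub_mem (hz2 e he a) (hG (by omega) (hf _ _ _ (hT e he a).1))

/-! ### Bounding degrees modulo `χ`, for left and right actions alike. -/

variable (F n) in
/-- A left or right action of `𝒜_{n+1}(F)`, with the permutations acting from the left. -/
structure AffineAction (V : Type*) [AddCommGroup V] [Module k V] where
  α : F.Affine (n + 1) →ₗ[k] Module.End k V
  one : α 1 = 1
  mul : (∀ z w, α (z * w) = α z * α w) ∨ ∀ z w, α (z * w) = α w * α z
  S : Equiv.Perm (Fin (n + 1)) →* Module.End k V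
  exists_as : ∀ σ, ∃ π, α (F.as σ) = S π
  f_S : ∀ j a π, ∃ j', α (F.af j a) * S π = S π * α (F.af j' a)
  x_S : ∀ j π, ∃ w ∈ F.wreathSub (n + 1), α (F.ax j) * S π - S π * α (F.ax (π⁻¹ j)) = α w

namespace AffineAction

variable {V : Type*} [AddCommGroup V] [Module k V]

/-- A left action. -/
noncomputable def ofHom (α : F.Affine (n + 1) →ₐ[k] Module.End k V) : F.AffineAction n V where
  α := α.toLinearMap
  one := map_one α
  mul := Or.inl (map_mul α)
  S := (α : F.Affine (n + 1) →* Module.End k V).comp (F.affRep (n + 1)).S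
  exists_as σ := ⟨σ, rfl⟩
  f_S j a π := ⟨π⁻¹ j, by
    change α _ * α (F.as π) = α (F.as π) * α _
    rw [← map_mul, ← map_mul, as_mul_af, show π (π⁻¹ j) = j from π.apply_symm_apply j]⟩
  x_S j π := ⟨_, ax_mul_as_sub_mem π (π⁻¹ j), by
    rw [show π (π⁻¹ j) = j from π.apply_symm_apply j]
    change α _ * α (F.as π) - α (F.as π) * α _ = α _
    rw [map_sub, map_mul, map_mul]⟩

/-- A right action. -/
noncomputable def ofAntiHom (α : F.Affine (n + 1) →ₗ[k] Module.End k V) (h1 : α 1 = 1)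
    (hmul : ∀ z w, α (z * w) = α w * α z) : F.AffineAction n V where
  α := α
  one := h1
  mul := Or.inr hmul
  -- Right multiplication reverses products; inverting the permutation restores a left action.
  S :=
    { toFun := fun π => α (F.as π⁻¹)
      map_one' := by rw [inv_one, as_one, h1]
      map_mul' := fun π σ => by rw [mul_inv_rev, as_mul, hmul] }
  exists_as σ := ⟨σ⁻¹, by change _ = α (F.as (σ⁻¹)⁻¹); rw [inv_inv]⟩
  f_S j a π := ⟨π⁻¹ j, by
    change α _ * α (F.as π⁻¹) = α (F.as π⁻¹) * α _
    rw [← hmul, ← hmul, as_mul_af]⟩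
  x_S j π := ⟨_, neg_mem (ax_mul_as_sub_mem π⁻¹ j), by
    change α _ * α (F.as π⁻¹) - α (F.as π⁻¹) * α _ = α _
    rw [map_neg, map_sub, hmul, hmul, neg_sub]⟩

variable (A : F.AffineAction n V)

theorem f_x (i j : Fin (n + 1)) (a : F.carrier) :
    ∃ a', A.α (F.af j a) * A.α (F.ax i) = A.α (F.ax i) * A.α (F.af j a') := by
  rcases A.mul with h | h
  · by_cases hij : i = j
    · subst hij
      exact ⟨F.nakayama a, by rw [← h, ← h, af_mul_ax_self]⟩
    · exact ⟨a, by rw [← h, ← h, af_mul_ax_ne hij]⟩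
  · by_cases hij : i = j
    · subst hij
      exact ⟨F.nakayamaEquiv.symm a, by rw [← h, ← h, af_mul_ax_self, nakayama_symm]⟩
    · exact ⟨a, by rw [← h, ← h, af_mul_ax_ne hij]⟩

theorem x_comm (i j : Fin (n + 1)) : Commute (A.α (F.ax i)) (A.α (F.ax j)) := by
  change _ * _ = _ * _
  rcases A.mul with h | h <;> rw [← h, ← h, ax_comm]

theorem wreathSub_mem {W : Submodule k V} (hf : ∀ j a, ∀ v ∈ W, A.α (F.af j a) v ∈ W)
    (hS : ∀ π, ∀ v ∈ W, A.S π v ∈ W) {w : F.Affine (n + 1)} (hw : w ∈ F.wreathSub (n + 1)) :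
    ∀ v ∈ W, A.α w v ∈ W := by
  refine wreathSub_ind (P := fun w => ∀ v ∈ W, A.α w v ∈ W) ?_ hf ?_ ?_ ?_ hw
  · intro r v hv
    rw [Algebra.algebraMap_eq_smul_one, map_smul, A.one]
    exact W.smul_mem _ hv
  · intro π v hv
    obtain ⟨σ, hσ⟩ := A.exists_as π
    rw [hσ]; exact hS _ _ hv
  · intro a b ha hb v hv
    rw [map_add]; exact add_mem (ha v hv) (hb v hv)
  · intro a b ha hb v hv
    rcases A.mul with h | h <;> rw [h]
    exacts [ha _ (hb v hv), hb _ (ha v hv)]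

/-- The filtration by the degree in the last polynomial generator. -/
def fil (V₀ : Submodule k V) (a : ℕ) : Submodule k V :=
  Submodule.span k {v | ∃ π, ∃ b < a, ∃ v₀ ∈ V₀, v = A.S π ((A.α (F.ax (Fin.last n)) ^ b) v₀)}

variable {A} {V₀ : Submodule k V}

theorem mem_fil (π) {a b : ℕ} (h : b < a) {v : V} (hv : v ∈ V₀) :
    A.S π ((A.α (F.ax (Fin.last n)) ^ b) v) ∈ A.fil V₀ a :=
  Submodule.subset_span ⟨π, b, h, v, hv, rfl⟩

theorem fil_mono : Monotone (A.fil V₀) := fun a b h => Submodule.span_mono <| by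
  rintro _ ⟨π, c, hc, v, hv, rfl⟩
  exact ⟨π, c, hc.trans_le h, v, hv, rfl⟩

theorem fil_le {a : ℕ} {W : Submodule k V} (T : Module.End k V)
    (h : ∀ π, ∀ b < a, ∀ v ∈ V₀, T (A.S π ((A.α (F.ax (Fin.last n)) ^ b) v)) ∈ W) :
    ∀ v ∈ A.fil V₀ a, T v ∈ W := by
  have : A.fil V₀ a ≤ W.comap T := Submodule.span_le.2 <| by
    rintro _ ⟨π, b, hb, v, hv, rfl⟩
    exact h π b hb v hv
  exact this

theorem S_mem_fil (π) (a : ℕ) : ∀ v ∈ A.fil V₀ a, A.S π v ∈ A.fil V₀ a :=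
  fil_le _ fun σ b hb v hv => by
    rw [← Module.End.mul_apply, ← map_mul]; exact mem_fil _ hb hv

theorem f_pow (j : Fin (n + 1)) (a : F.carrier) (b : ℕ) : ∃ a',
    A.α (F.af j a) * A.α (F.ax (Fin.last n)) ^ b =
      A.α (F.ax (Fin.last n)) ^ b * A.α (F.af j a') := by
  induction b generalizing a with
  | zero => exact ⟨a, by simp⟩
  | succ b ih =>
    obtain ⟨a₁, h₁⟩ := ih a
    obtain ⟨a₂, h₂⟩ := A.f_x (Fin.last n) j a₁
    exact ⟨a₂, by rw [pow_succ, ← mul_assoc, h₁, mul_assoc, h₂, mul_assoc]⟩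

section

variable (hf : ∀ j a, ∀ v ∈ V₀, A.α (F.af j a) v ∈ V₀)
include hf

theorem f_mem_fil (j : Fin (n + 1)) (c : F.carrier) (a : ℕ) :
    ∀ v ∈ A.fil V₀ a, A.α (F.af j c) v ∈ A.fil V₀ a :=
  fil_le _ fun σ b hb v hv => by
    obtain ⟨j', hj⟩ := A.f_S j c σ
    obtain ⟨c', hc⟩ := A.f_pow j' c b
    rw [← Module.End.mul_apply, hj, Module.End.mul_apply, ← Module.End.mul_apply _ (_ ^ b), hc]
    exact mem_fil _ hb (hf _ _ _ hv)

/-- The error of moving `x_j` past a permutation lies in the wreath product subalgebra, whose action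
does not raise the degree. -/
theorem x_S_mem_fil (π : Equiv.Perm (Fin (n + 1))) (j : Fin (n + 1)) (b : ℕ) (v) (hv : v ∈ V₀) :
    A.α (F.ax j) (A.S π ((A.α (F.ax (Fin.last n)) ^ b) v)) -
      A.S π (A.α (F.ax (π⁻¹ j)) ((A.α (F.ax (Fin.last n)) ^ b) v)) ∈ A.fil V₀ (b + 1) := by
  obtain ⟨w, hw, h⟩ := A.x_S j π
  have := LinearMap.congr_fun h ((A.α (F.ax (Fin.last n)) ^ b) v)
  rw [LinearMap.sub_apply, Module.End.mul_apply, Module.End.mul_apply] at this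
  rw [this]
  refine A.wreathSub_mem (fun j a => f_mem_fil hf j a _) (fun π => S_mem_fil π _) hw _ ?_
  have := mem_fil (A := A) 1 (Nat.lt_succ_self b) hv
  rwa [map_one] at this

variable (hx : ∀ j, j ≠ Fin.last n → ∀ v ∈ V₀, A.α (F.ax j) v ∈ V₀)
include hx

theorem x_mem_fil (j : Fin (n + 1)) (a : ℕ) :
    ∀ v ∈ A.fil V₀ a, A.α (F.ax j) v ∈ A.fil V₀ (a + 1) :=
  fil_le _ fun σ b hb v hv => by
    rw [← sub_add_cancel (A.α (F.ax j) _)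
      (A.S σ (A.α (F.ax (σ⁻¹ j)) ((A.α (F.ax (Fin.last n)) ^ b) v)))]
    refine add_mem (fil_mono (by omega) (x_S_mem_fil hf σ j b v hv)) ?_
    by_cases h : σ⁻¹ j = Fin.last n
    · rw [h, ← Module.End.mul_apply (A.α _), ← pow_succ']
      exact mem_fil _ (by omega) hv
    · rw [← Module.End.mul_apply (A.α _), ((A.x_comm (σ⁻¹ j) _).pow_right b).eq, Module.End.mul_apply]
      exact mem_fil _ (by omega) (hx _ h _ hv)

variable (C : F.CycParam) (hχ : A.α (C.chi 0) = 0)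
include hχ

/-- Division by a monic polynomial: since `χ` has leading term `x^d` and acts by zero, a power of
exponent at least `d` is congruent to terms of lower degree. -/
theorem fil_le_of_chi (a : ℕ) : A.fil V₀ a ≤ A.fil V₀ C.level := by
  induction a with
  | zero => exact fil_mono (Nat.zero_le _)
  | succ a ih =>
    rcases Nat.lt_or_ge a C.level with h | h
    · exact fil_mono h
    refine fil_le (W := A.fil V₀ C.level) LinearMap.id fun π b hb v hv => ?_
    rcases Nat.lt_or_ge b a with h' | h'
    · exact ih (mem_fil _ h' hv)
    obtain rfl : b = a := by omega
    -- The element `χ` is formed with the first polynomial generator, but the filtration uses the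
    -- last one. After applying `S σ`, the first generator raises the exponent by one up to lower
    -- terms, as `chi_filtration` requires.
    set σ := Equiv.swap (Fin.last n) 0
    obtain ⟨c, rfl⟩ := Nat.exists_eq_add_of_le' h
    have key := (C.chi_filtration 0 A.α A.one A.mul (fil_mono (V₀ := V₀))
      (x_mem_fil hf hx 0) (f_mem_fil hf 0)
      (T := {fun b => A.S σ ((A.α (F.ax (Fin.last n)) ^ b) v)}) (by
        rintro _ rfl b
        refine ⟨mem_fil _ (by omega) hv, ?_⟩
        have := x_S_mem_fil hf σ 0 b v hv
        rwa [show σ⁻¹ 0 = Fin.last n by rw [Equiv.swap_inv, Equiv.swap_apply_right],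
          ← Module.End.mul_apply (A.α (F.ax (Fin.last n))), ← pow_succ'] at this)).2 _ rfl c
    rw [hχ, LinearMap.zero_apply, zero_sub, neg_mem_iff] at key
    have h2 := S_mem_fil (π * σ⁻¹) _ _ (ih key)
    rwa [← Module.End.mul_apply, ← map_mul, inv_mul_cancel_right] at h2

/-- If `χ` acts by zero, the filtration stabilizes at the level. -/
theorem mem_fil_level (z : F.Affine (n + 1)) (v : V) (hv : v ∈ V₀) :
    A.α z v ∈ A.fil V₀ C.level := by
  have h0 : v ∈ A.fil V₀ C.level := by
    refine fil_le_of_chi hf hx C hχ 1 ?_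
    have := mem_fil (A := A) 1 Nat.zero_lt_one hv
    rwa [map_one, pow_zero] at this
  suffices H : ∀ v ∈ A.fil V₀ C.level, A.α z v ∈ A.fil V₀ C.level from H v h0
  refine F.affine_ind (fun z => ∀ v ∈ A.fil V₀ C.level, A.α z v ∈ A.fil V₀ C.level) ?_ ?_ ?_ ?_ ?_ ?_ z
  · intro r v hv
    rw [Algebra.algebraMap_eq_smul_one, map_smul, A.one]
    exact Submodule.smul_mem _ _ hv
  · exact fun i v hv => fil_le_of_chi hf hx C hχ _ (x_mem_fil hf hx i _ v hv)
  · exact fun i a => f_mem_fil hf i a _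
  · intro π v hv
    obtain ⟨σ, hσ⟩ := A.exists_as π
    rw [hσ]; exact S_mem_fil _ _ _ hv
  · intro a b ha hb v hv
    rw [map_add]; exact add_mem (ha v hv) (hb v hv)
  · intro a b ha hb v hv
    rcases A.mul with h | h <;> rw [h]
    exacts [ha _ (hb v hv), hb _ (ha v hv)]

end

end AffineAction

end FrobSuperalgebra

/-! ### Division with remainder by `χ` in the induced module. -/

namespace FrobSuperalgebra

variable {k : Type u} [CommRing k] {F : FrobSuperalgebra k} {n : ℕ}

namespace StrandRep

variable {E : Type*} [AddCommGroup E] [Module k E] {D : StrandRep F n E}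

variable (D) in
/-- A filtration of a strand representation by the degree in the new polynomial generator, together
with the cyclotomic condition on the old generators. -/
structure IsFiltered (C : F.CycParam) (G : ℕ → Submodule k E) : Prop where
  mono : Monotone G
  -- `G a` stands for degree less than `a`, so `G 1` consists of the constants.
  zero : G 0 = ⊥
  exhaust : ∀ e, ∃ a, e ∈ G a
  ρ_mem : ∀ z a, ∀ e ∈ G a, D.ρ z e ∈ G a
  Φ_mem : ∀ c a, ∀ e ∈ G a, D.Φ c e ∈ G a
  X_mem : ∀ a, ∀ e ∈ G a, D.X e ∈ G (a + 1)
  of_X_mem : ∀ a e, D.X e ∈ G (a + 1) → e ∈ G a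
  exists_pow : ∀ a, ∀ e ∈ G (a + 1), ∃ e₀ ∈ G 1, e - (D.X ^ a) e₀ ∈ G a
  chi : ∀ h : 0 < n, D.ρ (C.chi ⟨0, h⟩) = 0

/-- The induced filtration of the induced module. -/
def fil (n : ℕ) (G : ℕ → Submodule k E) (a : ℕ) : Submodule k (Fin (n + 1) → E) :=
  Submodule.pi Set.univ fun _ => G a

theorem mem_fil {G : ℕ → Submodule k E} {a : ℕ} {v : Fin (n + 1) → E} :
    v ∈ fil n G a ↔ ∀ i, v i ∈ G a := by simp [fil]

theorem single_mem_fil {G : ℕ → Submodule k E} {a : ℕ} (i : Fin (n + 1)) {e : E} (he : e ∈ G a) :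
    Pi.single i e ∈ fil n G a := by
  rw [mem_fil]
  intro j
  by_cases h : j = i
  · subst h; rwa [Pi.single_eq_same]
  · rw [Pi.single_eq_of_ne h]; exact zero_mem _

theorem fil_ind {G : ℕ → Submodule k E} {a : ℕ} {M : Type*} [AddCommGroup M] [Module k M]
    {W : Submodule k M} (T : (Fin (n + 1) → E) →ₗ[k] M)
    (h : ∀ i, ∀ e ∈ G a, T (Pi.single i e) ∈ W) : ∀ v ∈ fil n G a, T v ∈ W := by
  intro v hv
  rw [← Finset.univ_sum_single v, map_sum]
  exact sum_mem fun i _ => h i _ (mem_fil.1 hv i)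

/-- The part of the filtration whose last component has lower degree. -/
def lowFil (n : ℕ) (G : ℕ → Submodule k E) (a : ℕ) : Submodule k (Fin (n + 1) → E) :=
  -- For `a = 0` the truncated subtraction gives `G 0` again, which is zero in a filtered
  -- representation.
  fil n G a ⊓ (G (a - 1)).comap (LinearMap.proj (Fin.last n))

theorem single_mem_lowFil {G : ℕ → Submodule k E} {i : Fin (n + 1)} (hi : i ≠ Fin.last n) {a : ℕ} {e : E} (he : e ∈ G a) :
    Pi.single i e ∈ lowFil n G a := by
  refine ⟨single_mem_fil i he, ?_⟩
  change (Pi.single i e : Fin (n + 1) → E) (Fin.last n) ∈ G (a - 1)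
  rw [Pi.single_eq_of_ne hi.symm]; exact zero_mem _

variable (D) in
/-- The submodule of the induced module generated by the image of `χ`. -/
noncomputable def chiSub (C : F.CycParam) : Submodule k (Fin (n + 1) → E) :=
  -- Translates by permutations suffice: `χ` commutes with the polynomial generators and can be
  -- moved past the copies of `F`.
  Submodule.span k {v | ∃ π w, v = D.permOp π (D.indAction (C.chi 0) w)}

theorem indAction_ax_castSucc_lastIncl (l : Fin n) (e : E) :
    D.indAction (F.ax l.castSucc) (lastIncl n e) = lastIncl n (D.ρ (F.ax l) e) := by
  rw [← indAction_incl, affineIncl, Affine.lift_ax]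

theorem indAction_ax_last_lastIncl (e : E) :
    D.indAction (F.ax (Fin.last n)) (lastIncl n e) = lastIncl n (D.X e) := by
  rw [indAction_ax_last, lastX_lastIncl]

variable (D) in
/-- The action on the induced module, as a left action. -/
noncomputable abbrev action : F.AffineAction n (Fin (n + 1) → E) := .ofHom D.indAction

theorem action_S (π : Equiv.Perm (Fin (n + 1))) : D.action.S π = D.permOp π := D.indAction_as π

theorem x_permOp (j : Fin (n + 1)) (π : Equiv.Perm (Fin (n + 1))) : ∃ w ∈ F.wreathSub (n + 1),
    ∀ v, D.indAction (F.ax j) (D.permOp π v) =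
      D.permOp π (D.indAction (F.ax (π⁻¹ j)) v) + D.indAction w v := by
  obtain ⟨w, hw, h⟩ := D.action.x_S j π
  refine ⟨w, hw, fun v => ?_⟩
  have := LinearMap.congr_fun h v
  rw [action_S, LinearMap.sub_apply, sub_eq_iff_eq_add'] at this
  exact this

theorem wreathSub_stable {W : Submodule k (Fin (n + 1) → E)}
    (hf : ∀ j a, ∀ v ∈ W, D.wreath.Φ j a v ∈ W) (hS : ∀ π, ∀ v ∈ W, D.permOp π v ∈ W)
    {w : F.Affine (n + 1)} (hw : w ∈ F.wreathSub (n + 1)) {v} (hv : v ∈ W) :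
    D.indAction w v ∈ W := by
  refine D.action.wreathSub_mem (W := W) (fun j a v hv => ?_) (fun π v hv => ?_) hw v hv
  · have := hf j a v hv
    rwa [← indAction_af] at this
  · rw [action_S]; exact hS π v hv

theorem chi_mem_chiSub (C : F.CycParam) (v) : D.indAction (C.chi 0) v ∈ D.chiSub C := by
  refine Submodule.subset_span ⟨1, v, ?_⟩
  rw [← wreath_S, map_one]; rfl

theorem chiSub_le (C : F.CycParam) {W : Submodule k (Fin (n + 1) → E)}
    (T : Module.End k (Fin (n + 1) → E))
    (h : ∀ π w, T (D.permOp π (D.indAction (C.chi 0) w)) ∈ W) : ∀ v ∈ D.chiSub C, T v ∈ W := by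
  have : D.chiSub C ≤ W.comap T := Submodule.span_le.2 <| by
    rintro _ ⟨π, w, rfl⟩
    exact h π w
  exact this

theorem permOp_mem_chiSub (C : F.CycParam) (π) : ∀ v ∈ D.chiSub C, D.permOp π v ∈ D.chiSub C :=
  chiSub_le C _ fun σ w => by
    refine Submodule.subset_span ⟨π * σ, w, ?_⟩
    rw [← wreath_S, ← wreath_S, ← wreath_S, map_mul]; rfl

theorem f_mem_chiSub (C : F.CycParam) (j a) : ∀ v ∈ D.chiSub C, D.wreath.Φ j a v ∈ D.chiSub C :=
  chiSub_le C _ fun σ w => by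
    obtain ⟨a', ha⟩ := C.exists_af_mul_chi 0 (σ⁻¹ j) a
    refine Submodule.subset_span ⟨σ, D.wreath.Φ (σ⁻¹ j) a' w, ?_⟩
    have h1 := D.wreath.s_f σ (σ⁻¹ j) a
    rw [show σ (σ⁻¹ j) = j from σ.apply_symm_apply j] at h1
    have h2 := congrArg D.indAction ha
    rw [map_mul, map_mul, indAction_af, indAction_af] at h2
    rw [← Module.End.mul_apply (D.indAction _), ← h2, ← wreath_S, ← Module.End.mul_apply, ← h1]
    rfl

/-- The submodule generated by the image of `χ` is stable. -/
theorem indAction_mem_chiSub (C : F.CycParam) (z) :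
    ∀ v ∈ D.chiSub C, D.indAction z v ∈ D.chiSub C := by
  refine F.affine_ind (fun z => ∀ v ∈ D.chiSub C, D.indAction z v ∈ D.chiSub C) ?_ ?_ ?_ ?_ ?_ ?_ z
  · intro r v hv
    rw [AlgHom.commutes]
    exact Submodule.smul_mem _ _ hv
  · intro i
    refine chiSub_le C _ fun π w => ?_
    obtain ⟨z, hz, h⟩ := D.x_permOp i π
    rw [h]
    refine add_mem ?_ (wreathSub_stable (f_mem_chiSub C) (permOp_mem_chiSub C) hz
      (chi_mem_chiSub C w))
    refine permOp_mem_chiSub C π _ ?_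
    rw [← Module.End.mul_apply, ← map_mul, C.ax_mul_chi, map_mul]
    exact chi_mem_chiSub C _
  · intro i a
    rw [indAction_af]; exact f_mem_chiSub C i a
  · intro π
    rw [indAction_as]; exact permOp_mem_chiSub C π
  · intro a b ha hb v hv
    rw [map_add]; exact add_mem (ha v hv) (hb v hv)
  · intro a b ha hb v hv
    rw [map_mul]; exact ha _ (hb v hv)

/-- Every element concentrated in one position comes from the last position. -/
theorem single_eq_permOp_last (i : Fin (n + 1)) (e : E) : ∃ e',
    e = D.ρ (F.as (indPerm (Equiv.swap i (Fin.last n)) (Fin.last n))) e' ∧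
    Pi.single i e = D.permOp (Equiv.swap i (Fin.last n)) (lastIncl n e') := by
  refine ⟨_, (D.ρ_as_cancel _ e).symm, ?_⟩
  have := D.single_eq_permOp (Equiv.swap i (Fin.last n)) (Fin.last n) e
  rwa [Equiv.swap_apply_right] at this

variable {C : F.CycParam} {G : ℕ → Submodule k E}

namespace IsFiltered

variable (h : D.IsFiltered C G)
include h

theorem fil_mono : Monotone (fil n G) := fun _ _ hab _ hv =>
  mem_fil.2 fun i => h.mono hab (mem_fil.1 hv i)

theorem lowFil_mono : Monotone (lowFil n G) := fun _ _ hab _ hv =>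
  ⟨h.fil_mono hab hv.1, h.mono (Nat.sub_le_sub_right hab 1) hv.2⟩

theorem fil_le_lowFil (a : ℕ) : fil n G a ≤ lowFil n G (a + 1) := fun _ hv =>
  ⟨h.fil_mono a.le_succ hv, mem_fil.1 hv _⟩

theorem of_ρ_mem {σ : Equiv.Perm (Fin n)} {a : ℕ} {e : E} (he : D.ρ (F.as σ) e ∈ G a) :
    e ∈ G a := by
  have := h.ρ_mem (F.as σ⁻¹) _ _ he
  have e1 := D.ρ_as_cancel σ⁻¹ e
  rw [inv_inv] at e1
  rwa [e1] at this

theorem permOp_mem_fil (π) (a : ℕ) : ∀ v ∈ fil n G a, D.permOp π v ∈ fil n G a :=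
  fil_ind _ fun i e he => by
    rw [permOp_single]; exact single_mem_fil _ (h.ρ_mem _ _ _ he)

theorem slot_mem (i j : Fin (n + 1)) (c : F.carrier) (a : ℕ) (e : E) (he : e ∈ G a) :
    D.slot i j c e ∈ G a := by
  rcases Fin.eq_self_or_eq_succAbove i j with rfl | ⟨l, rfl⟩
  · rw [slot_self]; exact h.Φ_mem _ _ _ he
  · rw [slot_succAbove]; exact h.ρ_mem _ _ _ he

theorem f_mem_fil (j) (c : F.carrier) (a : ℕ) : ∀ v ∈ fil n G a, D.wreath.Φ j c v ∈ fil n G a :=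
  fil_ind _ fun i e he => by
    rw [wreath_Φ_single]; exact single_mem_fil _ (h.slot_mem _ _ _ _ _ he)

theorem f_mem_lowFil (j) (c : F.carrier) (a : ℕ) (v) (hv : v ∈ lowFil n G a) :
    D.wreath.Φ j c v ∈ lowFil n G a :=
  ⟨h.f_mem_fil j c a v hv.1, h.slot_mem _ j c _ _ hv.2⟩

/-- In component `i` the generator `x_j` with `j ≠ i` belongs to an old strand. Transporting to the
last component by a transposition costs an element of the wreath product subalgebra, and there `x_j`
acts through `ρ`; neither raises the degree. -/
theorem x_single_mem {i j : Fin (n + 1)} (hij : i ≠ j) {a : ℕ} {e : E} (he : e ∈ G a) :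
    D.indAction (F.ax j) (Pi.single i e) ∈ fil n G a := by
  obtain ⟨e', rfl, h'⟩ := D.single_eq_permOp_last i e
  obtain ⟨w, hw, hx⟩ := D.x_permOp j (Equiv.swap i (Fin.last n))
  have he' := single_mem_fil (Fin.last n) (h.of_ρ_mem he)
  rw [h', hx]
  refine add_mem (h.permOp_mem_fil _ _ _ ?_) (wreathSub_stable (fun j c => h.f_mem_fil j c a)
    (fun π => h.permOp_mem_fil π a) hw he')
  obtain ⟨l, hl⟩ : ∃ l : Fin n, (Equiv.swap i (Fin.last n))⁻¹ j = l.castSucc := by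
    refine Fin.exists_castSucc_eq.2 ?_ |>.imp fun _ => Eq.symm
    rw [Equiv.swap_inv, Ne, Equiv.swap_apply_eq_iff, Equiv.swap_apply_right]
    exact hij.symm
  rw [hl, indAction_ax_castSucc_lastIncl]
  exact single_mem_fil _ (h.ρ_mem _ _ _ (h.of_ρ_mem he))

/-- The same transport, for the generator belonging to the new strand, which acts by `X` on the last
component. -/
theorem x_single_sub_mem (i : Fin (n + 1)) {a : ℕ} {e : E} (he : e ∈ G a) :
    D.indAction (F.ax i) (Pi.single i e) - Pi.single i (D.X e) ∈ fil n G a := by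
  obtain ⟨e', rfl, h'⟩ := D.single_eq_permOp_last i e
  obtain ⟨w, hw, hx⟩ := D.x_permOp i (Equiv.swap i (Fin.last n))
  have he' := single_mem_fil (Fin.last n) (h.of_ρ_mem he)
  rw [h', hx, Equiv.swap_inv, Equiv.swap_apply_left, indAction_ax_last_lastIncl, permOp_single,
    Equiv.swap_apply_right, ← Module.End.mul_apply, ← Module.End.mul_apply, D.x_comm,
    add_sub_cancel_left]
  exact wreathSub_stable (fun j c => h.f_mem_fil j c a) (fun π => h.permOp_mem_fil π a) hw he'

theorem x_sub_mem (j : Fin (n + 1)) (a : ℕ) : ∀ v ∈ fil n G a,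
    D.indAction (F.ax j) v - Pi.single j (D.X (v j)) ∈ fil n G a :=
  fil_ind (D.indAction (F.ax j) - LinearMap.single k (fun _ => E) j ∘ₗ D.X ∘ₗ LinearMap.proj j)
    fun i e he => by
      change D.indAction (F.ax j) (Pi.single i e) -
        Pi.single j (D.X ((Pi.single i e : Fin (n + 1) → E) j)) ∈ _
      by_cases hij : i = j
      · subst hij
        rw [Pi.single_eq_same]; exact h.x_single_sub_mem i he
      · rw [Pi.single_eq_of_ne (Ne.symm hij), map_zero, Pi.single_zero, sub_zero]
        exact h.x_single_mem hij he

theorem x_mem_fil (j : Fin (n + 1)) (a : ℕ) (v) (hv : v ∈ fil n G a) :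
    D.indAction (F.ax j) v ∈ fil n G (a + 1) := by
  rw [← sub_add_cancel (D.indAction (F.ax j) v)]
  exact add_mem (h.fil_mono a.le_succ (h.x_sub_mem j a v hv))
    (single_mem_fil _ (h.X_mem _ _ (mem_fil.1 hv j)))

/-- Only component `j` gains a degree, and it is not the last one. -/
theorem x_mem_lowFil_of_ne {j : Fin (n + 1)} (hj : j ≠ Fin.last n) (a : ℕ) (v)
    (hv : v ∈ fil n G a) : D.indAction (F.ax j) v ∈ lowFil n G (a + 1) := by
  rw [← sub_add_cancel (D.indAction (F.ax j) v)]
  exact add_mem (h.fil_le_lowFil _ (h.x_sub_mem j a v hv))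
    (single_mem_lowFil hj (h.X_mem _ _ (mem_fil.1 hv j)))

theorem x_mem_lowFil (j : Fin (n + 1)) (a : ℕ) (v) (hv : v ∈ lowFil n G a) :
    D.indAction (F.ax j) v ∈ lowFil n G (a + 1) := by
  by_cases hj : j = Fin.last n
  · subst hj
    rw [← sub_add_cancel (D.indAction _ v)]
    refine add_mem (h.fil_le_lowFil _ (h.x_sub_mem _ a v hv.1))
      ⟨single_mem_fil _ (h.X_mem _ _ (mem_fil.1 hv.1 _)), ?_⟩
    change (Pi.single (Fin.last n) _ : Fin (n + 1) → E) (Fin.last n) ∈ G a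
    rw [Pi.single_eq_same]
    have h2 : v (Fin.last n) ∈ G (a - 1) := hv.2
    -- For `a = 0` the bound `a - 1` is again `0`, and the component vanishes instead of having its
    -- degree raised.
    obtain _ | a := a
    · rw [Nat.zero_sub, h.zero, Submodule.mem_bot] at h2
      rw [h2, map_zero]; exact zero_mem _
    · exact h.X_mem _ _ h2
  · exact h.x_mem_lowFil_of_ne hj a v hv.1

theorem chi_mem_fil (a : ℕ) (v) (hv : v ∈ fil n G a) :
    D.indAction (C.chi 0) v ∈ fil n G (a + C.level) := by
  refine (C.chi_filtration 0 D.action.α D.action.one D.action.mul h.fil_mono (h.x_mem_fil 0)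
    (fun c a v hv => ?_) (T := ∅) (by simp)).1 a v hv
  have := h.f_mem_fil 0 c a v hv
  rwa [← indAction_af] at this

theorem X_pow_mem (m a : ℕ) (e) (he : e ∈ G a) : (D.X ^ m) e ∈ G (a + m) := by
  induction m with
  | zero => exact he
  | succ m ih => rw [pow_succ']; exact h.X_mem _ _ ih

theorem of_X_pow_mem (m a : ℕ) (e) (he : (D.X ^ m) e ∈ G (a + m)) : e ∈ G a := by
  induction m with
  | zero => exact he
  | succ m ih => rw [pow_succ'] at he; exact ih (h.of_X_mem _ _ he)

/-- Up to lower degree, `e` is `X^a` of a constant `e₀`. The elements `X^b e₀` in the first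
component form a tower for `chi_filtration`, along which `χ` is a shift by `d`. -/
theorem chi_single_sub_mem (a : ℕ) (e) (he : e ∈ G (a + 1)) :
    D.indAction (C.chi 0) (Pi.single 0 e) - Pi.single 0 ((D.X ^ C.level) e) ∈
      fil n G (a + C.level) := by
  obtain ⟨e₀, he₀, hlow⟩ := h.exists_pow a e he
  have key := (C.chi_filtration 0 D.action.α D.action.one D.action.mul h.fil_mono (h.x_mem_fil 0)
    (fun c a v hv => by
      have := h.f_mem_fil 0 c a v hv
      rwa [← indAction_af] at this) (T := {fun a => Pi.single 0 ((D.X ^ a) e₀)}) (by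
      rintro _ rfl b
      have hb : (D.X ^ b) e₀ ∈ G (b + 1) := by
        rw [add_comm]; exact h.X_pow_mem _ _ _ he₀
      refine ⟨single_mem_fil _ hb, ?_⟩
      have := h.x_single_sub_mem 0 hb
      rwa [← Module.End.mul_apply, ← pow_succ'] at this)).2 _ rfl a
  have h1 := h.chi_mem_fil _ _ (single_mem_fil 0 hlow)
  have h2 := single_mem_fil (n := n) 0 (h.X_pow_mem C.level _ _ hlow)
  have h3 := add_mem key (sub_mem h1 h2)
  rw [Pi.single_sub, map_sub, map_sub, Pi.single_sub, ← Module.End.mul_apply, ← pow_add,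
    add_comm C.level] at h3
  convert h3 using 1
  change _ = D.indAction (C.chi 0) _ - _ + _
  abel

/-- If the new strand is not in the first position, the first strand is an old one. After a
transposition fixing the first point, and hence commuting with `χ`, the element acts on the last
component through `ρ`, where it is zero by assumption. -/
theorem chi_single_of_ne {i : Fin (n + 1)} (hi : i ≠ 0) (e : E) :
    D.indAction (C.chi 0) (Pi.single i e) = 0 := by
  have hn : 0 < n := by
    rcases Nat.eq_zero_or_pos n with rfl | hn
    · exact (hi (Fin.ext (by have := i.2; rw [Fin.val_zero]; omega))).elim
    · exact hn
  obtain ⟨e', rfl, h'⟩ := D.single_eq_permOp_last i e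
  have hπ : Equiv.swap i (Fin.last n) 0 = 0 :=
    Equiv.swap_apply_of_ne_of_ne hi.symm fun h0 => by
      have := congrArg Fin.val h0
      rw [Fin.val_zero, Fin.val_last] at this
      omega
  have hχ : C.chi (0 : Fin (n + 1)) = F.affineIncl n (C.chi ⟨0, hn⟩) := by
    rw [C.affineIncl_chi]; rfl
  rw [h', ← indAction_as, ← Module.End.mul_apply, ← map_mul, ← C.as_mul_chi hπ, map_mul,
    Module.End.mul_apply, hχ, indAction_incl, h.chi, LinearMap.zero_apply, lastIncl,
    Pi.single_zero, map_zero]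

/-- A normal form in which leading terms can be read off. The image of `χ` depends on the first
component only, and permutations fixing the first point commute with `χ`, so one transposition for
each coset is enough. -/
theorem exists_of_mem_chiSub {v} (hv : v ∈ D.chiSub C) : ∃ w : Fin (n + 1) → E,
    v = ∑ i, D.permOp (Equiv.swap 0 i) (D.indAction (C.chi 0) (Pi.single 0 (w i))) := by
  refine Submodule.span_induction (p := fun v _ => ∃ w : Fin (n + 1) → E,
    v = ∑ i, D.permOp (Equiv.swap 0 i) (D.indAction (C.chi 0) (Pi.single 0 (w i))))
    ?_ ⟨0, by simp⟩ ?_ ?_ hv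
  · rintro _ ⟨π, w, rfl⟩
    have h1 : D.indAction (C.chi 0) w = D.indAction (C.chi 0) (Pi.single 0 (w 0)) := by
      conv_lhs => rw [← Finset.univ_sum_single w]
      rw [map_sum, Finset.sum_eq_single_of_mem 0 (Finset.mem_univ _)]
      exact fun i _ hi => h.chi_single_of_ne hi _
    set τ := (Equiv.swap 0 (π 0))⁻¹ * π with hτ
    have hτ0 : τ 0 = 0 := by
      rw [hτ, Equiv.Perm.mul_apply, Equiv.swap_inv, Equiv.swap_apply_right]
    have hπ : π = Equiv.swap 0 (π 0) * τ := by rw [hτ, mul_inv_cancel_left]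
    refine ⟨Pi.single (π 0) (D.ρ (F.as (indPerm τ 0)) (w 0)), ?_⟩
    rw [Finset.sum_eq_single_of_mem (π 0) (Finset.mem_univ _), Pi.single_eq_same, h1]
    · conv_lhs => rw [hπ, ← wreath_S, map_mul, wreath_S, wreath_S, Module.End.mul_apply,
        ← indAction_as _ τ, ← Module.End.mul_apply (D.indAction _), ← map_mul, C.as_mul_chi hτ0,
        map_mul, Module.End.mul_apply, indAction_as, permOp_single, hτ0]
    · intro i _ hi
      rw [Pi.single_eq_of_ne hi, Pi.single_zero, map_zero, map_zero]
  · rintro _ _ _ _ ⟨w, rfl⟩ ⟨w', rfl⟩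
    exact ⟨w + w', by simp [Pi.single_add, Finset.sum_add_distrib]⟩
  · rintro r _ _ ⟨w, rfl⟩
    exact ⟨r • w, by simp [Pi.single_smul, Finset.smul_sum]⟩

theorem exists_mem_fil (v : Fin (n + 1) → E) : ∃ a, v ∈ fil n G a := by
  choose a ha using fun i => h.exhaust (v i)
  exact ⟨Finset.univ.sup a, mem_fil.2 fun i =>
    h.mono (Finset.le_sup (f := a) (Finset.mem_univ i)) (ha i)⟩

/-- In the normal form, component `i` has leading part `X^d` applied to `w i`, up to an invertible
permutation of the old strands. If the sum has degree less than `d`, this lowers the degree bound of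
`w` step by step until `w = 0`. -/
theorem disjoint_fil_chiSub : Disjoint (fil n G C.level) (D.chiSub C) := by
  rw [Submodule.disjoint_def]
  intro v hv hv'
  obtain ⟨w, rfl⟩ := h.exists_of_mem_chiSub hv'
  have key : ∀ a, w ∈ fil n G a → w = 0 := by
    intro a
    induction a with
    | zero =>
      intro hw
      funext i
      have := mem_fil.1 hw i
      rwa [h.zero, Submodule.mem_bot] at this
    | succ a ih =>
      intro hw
      refine ih (mem_fil.2 fun i => h.of_X_pow_mem C.level a _ (h.of_ρ_mem
        (σ := indPerm (Equiv.swap 0 i) 0) ?_))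
      have h1 : ∑ i, (D.permOp (Equiv.swap 0 i) (D.indAction (C.chi 0) (Pi.single 0 (w i))) -
          D.permOp (Equiv.swap 0 i) (Pi.single 0 ((D.X ^ C.level) (w i)))) ∈
          fil n G (a + C.level) := sum_mem fun i _ => by
        rw [← map_sub]
        exact h.permOp_mem_fil _ _ _ (h.chi_single_sub_mem a _ (mem_fil.1 hw i))
      rw [Finset.sum_sub_distrib, Submodule.sub_mem_iff_right _ (h.fil_mono (Nat.le_add_left _ _) hv)] at h1
      have h2 := mem_fil.1 h1 i
      rw [Finset.sum_apply, Finset.sum_eq_single_of_mem i (Finset.mem_univ _), permOp_single,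
        Equiv.swap_apply_left, Pi.single_eq_same] at h2
      · exact h2
      · intro j _ hj
        rw [permOp_single, Equiv.swap_apply_left, Pi.single_eq_of_ne hj.symm]
  obtain ⟨a, ha⟩ := h.exists_mem_fil w
  rw [key a ha]
  simp

/-- The division algorithm. Modulo lower degree, the top term is `X^d` applied to some `e₁` in the
first component, transported by a permutation; replace it by the image under `χ` of `e₁` and use
induction on the degree. -/
theorem fil_le_sup (a : ℕ) : fil n G a ≤ fil n G C.level ⊔ D.chiSub C := by
  have hS : ∀ π, ∀ v ∈ fil n G C.level ⊔ D.chiSub C,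
      D.permOp π v ∈ fil n G C.level ⊔ D.chiSub C := by
    intro π v hv
    obtain ⟨x, hx, y, hy, rfl⟩ := Submodule.mem_sup.1 hv
    rw [map_add]
    exact add_mem (Submodule.mem_sup_left (h.permOp_mem_fil π _ _ hx))
      (Submodule.mem_sup_right (permOp_mem_chiSub C π _ hy))
  induction a with
  | zero => exact (h.fil_mono (Nat.zero_le _)).trans le_sup_left
  | succ a ih =>
    rcases Nat.lt_or_ge a C.level with ha | ha
    · exact (h.fil_mono ha).trans le_sup_left
    obtain ⟨c, rfl⟩ := Nat.exists_eq_add_of_le' ha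
    refine fil_ind (n := n) (M := Fin (n + 1) → E) LinearMap.id fun i e he => ?_
    obtain ⟨e₀, he₀, hlow⟩ := h.exists_pow _ e he
    have h1 := ih (single_mem_fil i hlow)
    rw [Pi.single_sub] at h1
    refine (Submodule.sub_mem_iff_left _ ?_).1 h1
    have h2 := D.single_eq_permOp (Equiv.swap 0 i) 0 ((D.X ^ (c + C.level)) e₀)
    rw [Equiv.swap_apply_left] at h2
    rw [h2]
    refine hS _ _ ?_
    have hcomm : D.ρ (F.as (indPerm (Equiv.swap 0 i) 0)⁻¹) ((D.X ^ (c + C.level)) e₀) =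
        (D.X ^ C.level) ((D.X ^ c) (D.ρ (F.as (indPerm (Equiv.swap 0 i) 0)⁻¹) e₀)) := by
      have : Commute D.X (D.ρ (F.as (indPerm (Equiv.swap 0 i) 0)⁻¹)) := D.x_comm _
      rw [← Module.End.mul_apply, ← Module.End.mul_apply, ← Module.End.mul_apply,
        ← pow_add, add_comm C.level, (this.pow_left _).eq]
    rw [hcomm]
    set e₁ := (D.X ^ c) (D.ρ (F.as (indPerm (Equiv.swap 0 i) 0)⁻¹) e₀)
    have he₁ : e₁ ∈ G (c + 1) := by
      rw [add_comm]; exact h.X_pow_mem _ _ _ (h.ρ_mem _ _ _ he₀)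
    have h3 := ih (h.chi_single_sub_mem c e₁ he₁)
    exact (Submodule.sub_mem_iff_right _ (Submodule.mem_sup_right (chi_mem_chiSub C _))).1 h3

theorem isCompl : IsCompl (fil n G C.level) (D.chiSub C) :=
  ⟨h.disjoint_fil_chiSub, codisjoint_iff.2 (eq_top_iff.2 fun v _ => by
    obtain ⟨a, ha⟩ := h.exists_mem_fil v
    exact h.fil_le_sup a ha)⟩

end IsFiltered

end StrandRep

end FrobSuperalgebra

/-! ### The trace functional on the induced module. -/

namespace FrobSuperalgebra

variable {k : Type u} [CommRing k] {F : FrobSuperalgebra k} {n : ℕ}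

namespace StrandRep

variable {E : Type*} [AddCommGroup E] [Module k E] {D : StrandRep F n E}

/-- The componentwise extension of an operator to the induced module. -/
def mapEnd (n : ℕ) (R : Module.End k E) : Module.End k (Fin (n + 1) → E) :=
  LinearMap.pi fun i => R ∘ₗ LinearMap.proj i

theorem mapEnd_apply (R : Module.End k E) (v : Fin (n + 1) → E) (i) : mapEnd n R v i = R (v i) :=
  rfl

theorem mapEnd_single (R : Module.End k E) (i : Fin (n + 1)) (e : E) :
    mapEnd n R (Pi.single i e) = Pi.single i (R e) := by
  funext j
  rw [mapEnd_apply]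
  by_cases h : j = i
  · subst h; simp
  · rw [Pi.single_eq_of_ne h, Pi.single_eq_of_ne h, map_zero]

/-- The action on the induced module is built componentwise from `ρ`, `X` and `Φ`, and one
polynomial generator together with the wreath product generates the algebra. Used for right
multiplications. -/
theorem mapEnd_indAction {R : Module.End k E} (hρ : ∀ z, Commute R (D.ρ z)) (hX : Commute R D.X)
    (hΦ : ∀ a, Commute R (D.Φ a)) (z : F.Affine (n + 1)) :
    Commute (mapEnd n R) (D.indAction z) := by
  have hS : ∀ π, Commute (mapEnd n R) (D.permOp π) := by
    intro π
    refine LinearMap.ext fun v => ?_; funext i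
    obtain ⟨i, rfl⟩ := π.surjective i
    rw [Module.End.mul_apply, Module.End.mul_apply, mapEnd_apply, permOp_apply, permOp_apply,
      mapEnd_apply]
    exact LinearMap.congr_fun (hρ _) (v i)
  have hf : ∀ j a, Commute (mapEnd n R) (D.wreath.Φ j a) := by
    intro j a
    refine LinearMap.ext fun v => ?_; funext i
    change R (D.slot i j a (v i)) = D.slot i j a (R (v i))
    rcases Fin.eq_self_or_eq_succAbove i j with rfl | ⟨l, rfl⟩
    · rw [slot_self]; exact LinearMap.congr_fun (hΦ a) (v j)
    · rw [slot_succAbove]; exact LinearMap.congr_fun (hρ (F.af l a)) (v i)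
  refine affine_ind_of_index (Fin.last n) (P := fun z => Commute (mapEnd n R) (D.indAction z))
    ?_ ?_ ?_ ?_ ?_ ?_ z
  · intro r
    rw [AlgHom.commutes]
    exact (Algebra.commutes r _).symm
  · rw [indAction_ax_last, lastX]
    refine Commute.add_right ?_ (Commute.sum_right _ _ _ fun i _ => ?_)
    · refine LinearMap.ext fun v => ?_; funext i
      change R (D.slotX i _ (v i)) = D.slotX i _ (R (v i))
      rcases Fin.eq_self_or_eq_succAbove i (Fin.last n) with h | ⟨l, h⟩
      · rw [h, slotX_self]; exact LinearMap.congr_fun hX _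
      · rw [h, slotX_succAbove]; exact LinearMap.congr_fun (hρ (F.ax l)) (v i)
    · refine Commute.mul_right (Commute.sum_right _ _ _ fun b _ => (hf _ _).mul_right (hf _ _))
        (Commute.mul_right ?_ (hS _))
      refine LinearMap.ext fun v => ?_
      rw [Module.End.mul_apply, Module.End.mul_apply, lastProj_apply, lastProj_apply,
        mapEnd_single, mapEnd_apply]
  · intro i a
    rw [indAction_af]; exact hf i a
  · intro π
    rw [indAction_as]; exact hS π
  · intro a b ha hb
    rw [map_add]; exact ha.add_right hb
  · intro a b ha hb
    rw [map_mul]; exact ha.mul_right hb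

namespace IsFiltered

variable {C : F.CycParam} {G : ℕ → Submodule k E} (h : D.IsFiltered C G)
  {M : Type*} [AddCommGroup M] [Module k M] (τ : E →ₗ[k] M)

/-- The functional on the induced module that is given by `τ` on the last component of elements
of low degree, and that vanishes on the submodule generated by the image of `χ`. -/
noncomputable def trInd : (Fin (n + 1) → E) →ₗ[k] M :=
  τ ∘ₗ LinearMap.proj (Fin.last n) ∘ₗ Submodule.projection _ _ h.isCompl

variable {τ}

theorem trInd_of_mem_fil {v} (hv : v ∈ fil n G C.level) : h.trInd τ v = τ (v (Fin.last n)) := by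
  have := Submodule.projection_apply_left h.isCompl ⟨v, hv⟩
  change τ (Submodule.projection _ _ h.isCompl v (Fin.last n)) = _
  rw [this]

theorem trInd_of_mem_chiSub {v} (hv : v ∈ D.chiSub C) : h.trInd τ v = 0 := by
  have := Submodule.projection_apply_right h.isCompl ⟨v, hv⟩
  change τ (Submodule.projection _ _ h.isCompl v (Fin.last n)) = _
  rw [this, Pi.zero_apply, map_zero]

theorem trInd_lastIncl {e : E} (he : e ∈ G C.level) : h.trInd τ (lastIncl n e) = τ e := by
  rw [h.trInd_of_mem_fil (single_mem_fil _ he)]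
  exact congrArg τ (Pi.single_eq_same _ _)

include h in
theorem eq_of_eqOn {N : Type*} [AddCommGroup N] [Module k N] {S T : (Fin (n + 1) → E) →ₗ[k] N}
    (h1 : ∀ i, ∀ e ∈ G C.level, S (Pi.single i e) = T (Pi.single i e))
    (h2 : ∀ v ∈ D.chiSub C, S v = T v) : S = T := by
  refine LinearMap.ext fun v => ?_
  obtain ⟨x, y, hx, hy, rfl⟩ := Submodule.codisjoint_iff_exists_add_eq.1 h.isCompl.codisjoint v
  have h3 : ∀ v ∈ fil n G C.level, (S - T) v ∈ (⊥ : Submodule k N) :=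
    fil_ind (S - T) fun i e he => by
      rw [LinearMap.sub_apply, h1 i e he, sub_self]; exact zero_mem _
  have h4 := h3 x hx
  rw [LinearMap.sub_apply, Submodule.mem_bot, sub_eq_zero] at h4
  rw [map_add, map_add, h4, h2 y hy]

/-- The operator preserves both summands of the splitting, hence commutes with taking remainders.
With `R` a right multiplication this becomes right linearity of the trace. -/
theorem trInd_mapEnd {R : Module.End k E} (hρ : ∀ z, Commute R (D.ρ z)) (hX : Commute R D.X)
    (hΦ : ∀ a, Commute R (D.Φ a)) (hG : ∀ a, ∀ e ∈ G a, R e ∈ G a) {r : Module.End k M}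
    (hr : ∀ e, τ (R e) = r (τ e)) (v) : h.trInd τ (mapEnd n R v) = r (h.trInd τ v) := by
  refine LinearMap.congr_fun (h.eq_of_eqOn (S := h.trInd τ ∘ₗ mapEnd n R)
    (T := r ∘ₗ h.trInd τ) (fun i e he => ?_) (fun v hv => ?_)) v
  · rw [LinearMap.comp_apply, LinearMap.comp_apply, mapEnd_single,
      h.trInd_of_mem_fil (single_mem_fil _ (hG _ _ he)), h.trInd_of_mem_fil (single_mem_fil _ he)]
    by_cases hi : Fin.last n = i
    · subst hi; rw [Pi.single_eq_same, Pi.single_eq_same, hr]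
    · rw [Pi.single_eq_of_ne hi, Pi.single_eq_of_ne hi, map_zero, map_zero]
  · rw [LinearMap.comp_apply, LinearMap.comp_apply, h.trInd_of_mem_chiSub hv, map_zero,
      h.trInd_of_mem_chiSub]
    refine chiSub_le C (mapEnd n R) (fun π w => ?_) v hv
    refine Submodule.subset_span ⟨π, mapEnd n R w, ?_⟩
    rw [← indAction_as, ← Module.End.mul_apply (mapEnd n R), ← Module.End.mul_apply (mapEnd n R * _),
      ← Module.End.mul_apply (D.indAction _), ← Module.End.mul_apply (D.indAction _ * _),
      (mapEnd_indAction hρ hX hΦ _).eq, mul_assoc, (mapEnd_indAction hρ hX hΦ _).eq, mul_assoc]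

include h in
theorem x_pow_single_sub_mem (i : Fin (n + 1)) (a : ℕ) {e : E} (he : e ∈ G 1) :
    D.indAction (F.ax i ^ a) (Pi.single i e) - Pi.single i ((D.X ^ a) e) ∈ fil n G a := by
  induction a with
  | zero => rw [pow_zero, pow_zero, map_one]; simp
  | succ a ih =>
    have h1 := h.x_mem_fil i _ _ ih
    have h2 := h.x_single_sub_mem i (h.X_pow_mem a _ _ he)
    rw [add_comm 1 a, ← Module.End.mul_apply D.X, ← pow_succ'] at h2
    rw [map_sub, ← Module.End.mul_apply, ← map_mul, ← pow_succ'] at h1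
    have := add_mem h1 h2
    rwa [sub_add_sub_cancel] at this

section

variable (hτ : ∀ e ∈ G (C.level - 1), τ e = 0)
include hτ

theorem trInd_of_mem_lowFil {v} (hv : v ∈ lowFil n G C.level) : h.trInd τ v = 0 := by
  rw [h.trInd_of_mem_fil hv.1]; exact hτ _ hv.2

/-- The products of dual generators have trace zero in off-diagonal position. -/
theorem trInd_pow_permOp {π : Equiv.Perm (Fin (n + 1))} (hπ : π (Fin.last n) ≠ Fin.last n)
    {a m : ℕ} (ham : a + m < C.level) {e : E} (he : e ∈ G (a + 1)) :
    h.trInd τ (D.indAction (F.ax (Fin.last n) ^ m) (D.permOp π (lastIncl n e))) = 0 := by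
  -- The vector starts outside the last component, and each factor of the last generator raises the
  -- bound by one; the last component always stays one degree behind. With `a + 1 + m ≤ d` there is
  -- no remainder to take.
  refine h.trInd_of_mem_lowFil hτ (h.lowFil_mono (a := a + 1 + m) (by omega) ?_)
  rw [permOp_single]
  induction m with
  | zero =>
    rw [pow_zero, map_one]
    exact single_mem_lowFil hπ (h.ρ_mem _ _ _ he)
  | succ m ih =>
    rw [pow_succ', map_mul]
    exact h.x_mem_lowFil _ _ _ (ih (by omega))

/-- The essential case of left linearity. If `i` is not the first position, `x_1` belongs to an old
strand and the result stays in component `i`. If it is the first position, the degree may reach `d`,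
and the remainder modulo `χ` must be shown not to contribute the power `d - 1` in the last
component. -/
theorem trInd_x_single_of_ne (hn : 0 < n) {i : Fin (n + 1)} (hi : i ≠ Fin.last n) {e : E}
    (he : e ∈ G C.level) : h.trInd τ (D.indAction (F.ax 0) (Pi.single i e)) = 0 := by
  have h0 : (0 : Fin (n + 1)) ≠ Fin.last n := fun h0 => by
    have := congrArg Fin.val h0
    rw [Fin.val_zero, Fin.val_last] at this
    omega
  by_cases hi0 : i = 0
  · subst hi0
    obtain hd | ⟨d, hd⟩ : C.level = 0 ∨ ∃ d, C.level = d + 1 := by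
      rcases C.level with _ | d
      exacts [Or.inl rfl, Or.inr ⟨d, rfl⟩]
    · rw [hd, h.zero, Submodule.mem_bot] at he
      rw [he, Pi.single_zero, map_zero, map_zero]
    rw [hd] at he
    obtain ⟨e₀, he₀, hlow⟩ := h.exists_pow d e he
    have h1 := h.x_mem_lowFil_of_ne h0 _ _ (single_mem_fil 0 hlow)
    have h2 := h.x_mem_lowFil_of_ne h0 _ _ (h.x_pow_single_sub_mem 0 d he₀)
    have hs : ∀ b, D.indAction (F.ax 0) (D.indAction (F.ax 0 ^ b) (Pi.single 0 e₀)) =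
        D.indAction (F.ax 0 ^ (b + 1)) (Pi.single 0 e₀) := fun b => by
      rw [pow_succ', map_mul, Module.End.mul_apply]
    have hmem : ∀ b, D.indAction (F.ax 0 ^ b) (Pi.single 0 e₀) ∈ lowFil n G (b + 1) := by
      intro b
      induction b with
      | zero => rw [pow_zero, map_one]; exact single_mem_lowFil h0 he₀
      | succ b ih => rw [← hs]; exact h.x_mem_lowFil 0 _ _ ih
    -- Apply `chi_filtration` to `lowFil` and the tower of exact powers of `x_1` on `e₀`. Hence
    -- `x_1^d e₀` differs from the image of `χ`, which has trace zero, by an element of `lowFil`,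
    -- which has trace zero too.
    have key : D.indAction (C.chi 0) (D.indAction (F.ax 0 ^ 0) (Pi.single 0 e₀)) -
        D.indAction (F.ax 0 ^ (0 + C.level)) (Pi.single 0 e₀) ∈ lowFil n G (0 + C.level) :=
      (C.chi_filtration 0 D.action.α D.action.one D.action.mul h.lowFil_mono
      (h.x_mem_lowFil 0) (fun c a v hv => by
        have := h.f_mem_lowFil 0 c a v hv
        rwa [← indAction_af] at this)
      (T := {fun a => D.indAction (F.ax 0 ^ a) (Pi.single 0 e₀)}) (by
        rintro _ rfl b
        refine ⟨hmem b, ?_⟩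
        change D.indAction (F.ax 0) (D.indAction (F.ax 0 ^ b) (Pi.single 0 e₀)) -
          D.indAction (F.ax 0 ^ (b + 1)) (Pi.single 0 e₀) ∈ _
        rw [hs, sub_self]; exact zero_mem _)).2 _ rfl 0
    rw [zero_add] at key
    rw [← hd] at h1 h2
    have e1 := h.trInd_of_mem_lowFil hτ key
    have e2 := h.trInd_of_mem_lowFil hτ h1
    have e3 := h.trInd_of_mem_lowFil hτ h2
    rw [map_sub, h.trInd_of_mem_chiSub (chi_mem_chiSub C _), zero_sub, neg_eq_zero] at e1
    rw [map_sub, map_sub, hs, ← hd, e1,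
      zero_sub, neg_eq_zero] at e3
    rw [Pi.single_sub, map_sub, map_sub, e3, sub_zero] at e2
    exact e2
  · obtain ⟨e', rfl, h'⟩ := D.single_eq_permOp_last i e
    have hπ : Equiv.swap i (Fin.last n) 0 = 0 :=
      Equiv.swap_apply_of_ne_of_ne (Ne.symm hi0) h0
    have he' := h.of_ρ_mem he
    obtain ⟨l, hl⟩ := Fin.exists_castSucc_eq.2 h0
    rw [h', ← indAction_as, ← Module.End.mul_apply, ← map_mul, ← as_mul_ax_zero hπ, map_mul,
      Module.End.mul_apply, ← hl, indAction_ax_castSucc_lastIncl, indAction_as, permOp_single,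
      Equiv.swap_apply_right, h.trInd_of_mem_fil (single_mem_fil _ (h.ρ_mem _ _ _
        (h.ρ_mem _ _ _ he'))), Pi.single_eq_of_ne hi.symm, map_zero]

/-- By the splitting it suffices to compare the two sides on each component in degree less than `d`
and on `chiSub`. The last component is an `𝒜_n(F)`-module through `ρ`, and `chiSub` is stable, so
what is left is that a generator sends the other components to trace zero. -/
theorem trInd_incl {act : F.Affine n →ₐ[k] Module.End k M}
    (hact : ∀ z e, τ (D.ρ z e) = act z (τ e)) (z : F.Affine n) :
    ∀ v, h.trInd τ (D.indAction (F.affineIncl n z) v) = act z (h.trInd τ v) := by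
  have single : ∀ i (e : E), e ∈ G C.level → i ≠ Fin.last n → h.trInd τ (Pi.single i e) = 0 := by
    intro i e he hi
    rw [h.trInd_of_mem_fil (single_mem_fil _ he), Pi.single_eq_of_ne hi.symm, map_zero]
  have key : ∀ z, (∀ i, i ≠ Fin.last n → ∀ e ∈ G C.level,
      h.trInd τ (D.indAction (F.affineIncl n z) (Pi.single i e)) = 0) →
      ∀ v, h.trInd τ (D.indAction (F.affineIncl n z) v) = act z (h.trInd τ v) := by
    intro z hz
    refine LinearMap.congr_fun (f := h.trInd τ ∘ₗ D.indAction (F.affineIncl n z))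
      (g := act z ∘ₗ h.trInd τ) (h.eq_of_eqOn (fun i e he => ?_) (fun v hv => ?_))
    · rw [LinearMap.comp_apply, LinearMap.comp_apply]
      by_cases hi : i = Fin.last n
      · subst hi
        rw [← lastIncl, indAction_incl, h.trInd_lastIncl he, h.trInd_lastIncl (h.ρ_mem _ _ _ he),
          hact]
      · rw [hz i hi e he, single i e he hi, map_zero]
    · rw [LinearMap.comp_apply, LinearMap.comp_apply, h.trInd_of_mem_chiSub hv, map_zero,
        h.trInd_of_mem_chiSub (indAction_mem_chiSub C _ _ hv)]
  -- Generating by the first polynomial generator alone is essential: it is the one to which `χ`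
  -- applies.
  refine affine_ind_zero (P := fun z => ∀ v, h.trInd τ (D.indAction (F.affineIncl n z) v) =
    act z (h.trInd τ v)) ?_ ?_ ?_ ?_ ?_ ?_ z
  · intro r v
    rw [AlgHom.commutes, AlgHom.commutes, AlgHom.commutes, Module.algebraMap_end_apply,
      Module.algebraMap_end_apply, map_smul]
  · intro hn
    refine key _ fun i hi e he => ?_
    rw [affineIncl, Affine.lift_ax]
    exact h.trInd_x_single_of_ne hτ hn hi he
  · intro j a
    refine key _ fun i hi e he => ?_
    rw [affineIncl, Affine.lift_af, afHom_apply, indAction_af, wreath_Φ_single]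
    exact single _ _ (h.slot_mem _ _ _ _ _ he) hi
  · intro π
    refine key _ fun i hi e he => ?_
    rw [affineIncl, Affine.lift_as]
    change h.trInd τ (D.indAction (F.as (permCastSucc n π)) _) = _
    rw [indAction_as, permOp_single]
    refine single _ _ (h.ρ_mem _ _ _ he) ?_
    rw [← permCastSucc_last π]
    exact (Equiv.injective _).ne hi
  · intro a b ha hb v
    simp only [map_add, LinearMap.add_apply, ha, hb]
  · intro a b ha hb v
    rw [map_mul, map_mul, map_mul, Module.End.mul_apply, Module.End.mul_apply, ha, hb]

end

end IsFiltered

end StrandRep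

end FrobSuperalgebra

/-! ### The strand representation over the cyclotomic algebra. -/

namespace FrobSuperalgebra

variable {k : Type u} [CommRing k] {F : FrobSuperalgebra k} {n : ℕ}

variable (F) in
/-- The operator multiplying a homogeneous element `f` by the sign of `f` and `q`. -/
noncomputable def sgnOp (q : Bideg) : Module.End k F.carrier :=
  (DirectSum.toModule k Bideg F.carrier fun p => ((p.sign q : ℤ) : k) • (F.gr p).subtype) ∘ₗ
    (DirectSum.decomposeLinearEquiv F.gr).toLinearMap

theorem sgnOp_of_mem {p : Bideg} (q : Bideg) {f : F.carrier} (hf : f ∈ F.gr p) :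
    F.sgnOp q f = ((p.sign q : ℤ) : k) • f := by
  lift f to F.gr p using hf
  simp [sgnOp]

theorem end_ext {M : Type*} [AddCommGroup M] [Module k M] {S T : F.carrier →ₗ[k] M}
    (h : ∀ p, ∀ f ∈ F.gr p, S f = T f) : S = T :=
  LinearMap.ext fun f => F.hom_ind (fun f => S f = T f) (by simp) h
    (fun f g hf hg => by rw [map_add, map_add, hf, hg]) f

theorem sgnOp_even (i : ℤ) : F.sgnOp (i, 0) = 1 :=
  end_ext fun p f hf => by
    rw [sgnOp_of_mem _ hf, Bideg.sign_even_right, Int.cast_one, one_smul]; rfl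

theorem sgnOp_add (q q' : Bideg) : F.sgnOp (q + q') = F.sgnOp q * F.sgnOp q' :=
  end_ext fun p f hf => by
    rw [Module.End.mul_apply, sgnOp_of_mem _ hf, sgnOp_of_mem _ hf, map_smul, sgnOp_of_mem _ hf,
      smul_smul, Bideg.sign_add_right, Int.cast_mul, mul_comm]

theorem sgnOp_nakayama (q : Bideg) : Commute (F.sgnOp q) F.nakayama :=
  end_ext fun p f hf => by
    rw [Module.End.mul_apply, Module.End.mul_apply, sgnOp_of_mem _ hf,
      sgnOp_of_mem _ (F.nakayama_mem hf), map_smul]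

theorem sgnOp_mulLeft (q : Bideg) {p : Bideg} {a : F.carrier} (ha : a ∈ F.gr p) :
    F.sgnOp q * LinearMap.mulLeft k a =
      ((p.sign q : ℤ) : k) • (LinearMap.mulLeft k a * F.sgnOp q) :=
  end_ext fun r f hf => by
    rw [Module.End.mul_apply, LinearMap.smul_apply, Module.End.mul_apply, sgnOp_of_mem _ hf,
      LinearMap.mulLeft_apply, sgnOp_of_mem _ (SetLike.mul_mem_graded ha hf), map_smul,
      LinearMap.mulLeft_apply, smul_smul, Bideg.sign_add_left, Int.cast_mul]

/-- The trace only sees the even bidegree `F.top`, where the sign is trivial. -/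
theorem tr_sgnOp (q : Bideg) : F.tr ∘ₗ F.sgnOp q = F.tr :=
  end_ext fun p f hf => by
    rw [LinearMap.comp_apply, sgnOp_of_mem _ hf, map_smul]
    by_cases h : p = F.top
    · subst h; rw [sign_top_left, Int.cast_one, one_smul]
    · rw [F.tr_homogeneous p h f hf, smul_zero]

/-- Componentwise application of an operator to finitely supported sequences. -/
noncomputable def finsuppEnd (V : Type*) [AddCommGroup V] [Module k V] :
    Module.End k V →ₐ[k] Module.End k (ℕ →₀ V) :=
  AlgHom.ofLinearMap
    { toFun := fun T => Finsupp.mapRange.linearMap T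
      map_add' := fun S T => LinearMap.ext fun e => Finsupp.ext fun j => by simp
      map_smul' := fun r T => LinearMap.ext fun e => Finsupp.ext fun j => by simp }
    (LinearMap.ext fun e => Finsupp.ext fun j => by simp)
    (fun S T => LinearMap.ext fun e => Finsupp.ext fun j => by simp)

theorem finsuppEnd_apply {V : Type*} [AddCommGroup V] [Module k V] (T : Module.End k V)
    (e : ℕ →₀ V) (j : ℕ) : finsuppEnd V T e j = T (e j) := by simp [finsuppEnd]

/-- The shift of finitely supported sequences. -/
noncomputable def finsuppShift (V : Type*) [AddCommGroup V] [Module k V] :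
    Module.End k (ℕ →₀ V) := Finsupp.lmapDomain V k Nat.succ

theorem finsuppShift_succ {V : Type*} [AddCommGroup V] [Module k V] (e : ℕ →₀ V) (j : ℕ) :
    finsuppShift (k := k) V e (j + 1) = e j :=
  Finsupp.mapDomain_apply Nat.succ_injective e j

theorem finsuppShift_zero {V : Type*} [AddCommGroup V] [Module k V] (e : ℕ →₀ V) :
    finsuppShift (k := k) V e 0 = 0 :=
  Finsupp.mapDomain_of_notMem_range e 0 (by simp)

theorem finsuppShift_commute {V : Type*} [AddCommGroup V] [Module k V] (T : Module.End k V) :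
    Commute (finsuppEnd V T) (finsuppShift V) :=
  LinearMap.ext fun e => Finsupp.ext fun j => by
    rw [Module.End.mul_apply, Module.End.mul_apply, finsuppEnd_apply]
    cases j with
    | zero => rw [finsuppShift_zero, finsuppShift_zero, map_zero]
    | succ j => rw [finsuppShift_succ, finsuppShift_succ, finsuppEnd_apply]

variable (k) in
/-- Sequences vanishing from index `a` on. -/
def degLT (V : Type*) [AddCommGroup V] [Module k V] (a : ℕ) : Submodule k (ℕ →₀ V) where
  carrier := {e | ∀ j, a ≤ j → e j = 0}
  zero_mem' := fun _ _ => rfl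
  add_mem' := fun h h' j hj => by rw [Finsupp.add_apply, h j hj, h' j hj, add_zero]
  smul_mem' := fun r _ h j hj => by rw [Finsupp.smul_apply, h j hj, smul_zero]

namespace CycParam

variable (C : F.CycParam)

variable (n) in
/-- The tensor product of `F` and the cyclotomic algebra, as a module. -/
abbrev Coeff : Type u := F.carrier ⊗[k] C.Cyc n

/-- An operator on the tensor factor `F`. -/
noncomputable abbrev opF : Module.End k F.carrier →ₐ[k] Module.End k (C.Coeff n) :=
  Module.End.rTensorAlgHom k F.carrier (C.Cyc n)

/-- An operator on the second tensor factor. -/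
noncomputable abbrev opC : Module.End k (C.Cyc n) →ₐ[k] Module.End k (C.Coeff n) :=
  Module.End.lTensorAlgHom k (C.Cyc n) F.carrier

theorem op_commute (S : Module.End k F.carrier) (T : Module.End k (C.Cyc n)) :
    Commute (C.opC T) (C.opF S) := TensorProduct.ext' fun _ _ => rfl

variable (n) in
/-- The action of `𝒜_n(F)` on the coefficients, with the sign rule. -/
noncomputable def coeffAct : F.Affine n →ₐ[k] Module.End k (C.Coeff n) :=
  -- The coaction splits `z` into homogeneous parts. Each part acts on the right tensor factor by
  -- multiplication, and its bidegree acts on `F` by the sign of passing `z` across `F`.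
  (AddMonoidAlgebra.liftNCAlgHom (C.opC.comp ((Algebra.lmul k (C.Cyc n)).comp (C.quot n)))
    { toFun := fun q => C.opF (F.sgnOp q.toAdd)
      map_one' := by
        change C.opF (F.sgnOp (0, 0)) = 1
        rw [sgnOp_even, map_one]
      map_mul' := fun q q' => by
        change C.opF (F.sgnOp (q.toAdd + q'.toAdd)) = _
        rw [sgnOp_add, map_mul] }
    (fun _ _ => C.op_commute _ _)).comp (F.affineCoact n)

theorem coeffAct_of_mem {p : Bideg} {z : F.Affine n} (hz : z ∈ F.affineGr n p) :
    C.coeffAct n z = C.opC (Algebra.lmul k _ (C.quot n z)) * C.opF (F.sgnOp p) := by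
  rw [coeffAct, AlgHom.comp_apply, affineCoact_of_mem F hz]
  exact AddMonoidAlgebra.liftNC_single _ _ _ _

theorem coeffAct_even {i : ℤ} {z : F.Affine n} (hz : z ∈ F.affineGr n (i, 0)) :
    C.coeffAct n z = C.opC (Algebra.lmul k _ (C.quot n z)) := by
  rw [coeffAct_of_mem C hz, sgnOp_even, map_one, mul_one]

theorem affine_hom_ind {P : F.Affine n → Prop} (h0 : P 0)
    (hm : ∀ p, ∀ z ∈ F.affineGr n p, P z) (ha : ∀ z w, P z → P w → P (z + w)) (z) : P z := by
  refine AddSubmonoid.closure_induction (motive := fun z _ => P z) ?_ h0 (fun z w _ _ => ha z w)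
    (F.affine_closure z)
  intro z hz
  obtain ⟨p, hp⟩ := Set.mem_iUnion.1 hz
  exact hm p z hp

theorem opF_nakayama_symm_commute (z : F.Affine n) :
    Commute (C.opF F.nakayamaEquiv.symm.toLinearMap) (C.coeffAct n z) := by
  refine affine_hom_ind (P := fun z => Commute (C.opF F.nakayamaEquiv.symm.toLinearMap)
    (C.coeffAct n z)) ?_ ?_ ?_ z
  · rw [map_zero]; exact Commute.zero_right _
  · intro p z hz
    rw [coeffAct_of_mem C hz]
    refine (C.op_commute _ _).symm.mul_right ?_
    change _ * _ = _ * _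
    rw [← map_mul, ← map_mul]
    congr 1
    refine LinearMap.ext fun f => ?_
    apply F.nakayamaEquiv.injective
    have := LinearMap.congr_fun (sgnOp_nakayama (F := F) p) (F.nakayamaEquiv.symm f)
    rw [Module.End.mul_apply, Module.End.mul_apply, nakayama_symm] at this
    change F.nakayama (F.nakayamaEquiv.symm _) = F.nakayama (F.sgnOp p (F.nakayamaEquiv.symm f))
    rw [nakayama_symm, this]
  · intro z w hz hw
    rw [map_add]; exact hz.add_right hw

/-- The left multiplication operators on the tensor factor `F`. -/
noncomputable abbrev mulF : F.carrier →ₐ[k] Module.End k (C.Coeff n) :=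
  C.opF.comp (Algebra.lmul k F.carrier)

variable (n) in
/-- The strand representation from which `𝒜_{n+1}^𝐂(F)` is constructed: the sequence with the
single entry `b ⊗ m` in position `a` stands for `b x^a m`. -/
noncomputable def strand : StrandRep F n (ℕ →₀ C.Coeff n) where
  ρ := (finsuppEnd _).comp (C.coeffAct n)
  -- From `f x = x ψ(f)` one gets `x b x^a = ψ⁻¹(b) x^{a+1}`: a shift together with `ψ⁻¹` on the
  -- coefficient.
  X := finsuppEnd _ (C.opF F.nakayamaEquiv.symm.toLinearMap) * finsuppShift _
  Φ := (finsuppEnd _).comp C.mulF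
  x_comm z := by
    have h1 : Commute (finsuppEnd _ (C.opF F.nakayamaEquiv.symm.toLinearMap))
        (finsuppEnd _ (C.coeffAct n z)) := (C.opF_nakayama_symm_commute z).map (finsuppEnd _)
    exact h1.mul_left (finsuppShift_commute _).symm
  f_x a := by
    have : C.mulF (n := n) a * C.opF F.nakayamaEquiv.symm.toLinearMap =
        C.opF F.nakayamaEquiv.symm.toLinearMap * C.mulF (F.nakayama a) := by
      change C.opF _ * C.opF _ = C.opF _ * C.opF _
      rw [← map_mul, ← map_mul]
      congr 1
      exact LinearMap.ext fun b => (F.nakayamaEquiv_symm_mul a b).symm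
    change finsuppEnd _ (C.mulF a) * (finsuppEnd _ (C.opF F.nakayamaEquiv.symm.toLinearMap) *
      finsuppShift _) = finsuppEnd _ (C.opF F.nakayamaEquiv.symm.toLinearMap) * finsuppShift _ *
      finsuppEnd _ (C.mulF (F.nakayama a))
    rw [← mul_assoc, ← map_mul, this, map_mul, mul_assoc, mul_assoc, (finsuppShift_commute _).eq]
  f_ax a i := by
    change finsuppEnd _ (C.mulF a) * finsuppEnd _ (C.coeffAct n (F.ax i)) =
      finsuppEnd _ (C.coeffAct n (F.ax i)) * finsuppEnd _ (C.mulF a)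
    rw [← map_mul, ← map_mul, C.coeffAct_even (F.ax_mem i)]
    exact congrArg _ (C.op_commute _ _).eq.symm
  f_as a π := by
    change finsuppEnd _ (C.mulF a) * finsuppEnd _ (C.coeffAct n (F.as π)) =
      finsuppEnd _ (C.coeffAct n (F.as π)) * finsuppEnd _ (C.mulF a)
    rw [← map_mul, ← map_mul, C.coeffAct_even (i := 0) (F.as_mem π)]
    exact congrArg _ (C.op_commute _ _).eq.symm
  superComm i p q a ha b hb := by
    change finsuppEnd _ (C.mulF a) * finsuppEnd _ (C.coeffAct n (F.af i b)) =
      ((p.sign q : ℤ) : k) • (finsuppEnd _ (C.coeffAct n (F.af i b)) * finsuppEnd _ (C.mulF a))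
    rw [← map_mul, ← map_mul, ← map_smul, C.coeffAct_of_mem (F.af_mem i hb)]
    congr 1
    change C.opF (Algebra.lmul k _ a) * (C.opC _ * C.opF _) =
      _ • (C.opC _ * C.opF _ * C.opF (Algebra.lmul k _ a))
    have h : F.sgnOp q * Algebra.lmul k _ a = ((p.sign q : ℤ) : k) •
      (Algebra.lmul k _ a * F.sgnOp q) := sgnOp_mulLeft q ha
    rw [mul_assoc, ← map_mul, h, map_smul, mul_smul_comm, smul_smul, ← Int.cast_mul,
      Bideg.sign_mul_sign, Int.cast_one, one_smul, map_mul, ← mul_assoc, ← mul_assoc,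
      (C.op_commute _ _).eq]

theorem strand_X_succ (e : ℕ →₀ C.Coeff n) (j : ℕ) :
    (C.strand n).X e (j + 1) = C.opF F.nakayamaEquiv.symm.toLinearMap (e j) := by
  change finsuppEnd _ _ (finsuppShift _ e) (j + 1) = _
  rw [finsuppEnd_apply, finsuppShift_succ]

theorem strand_X_zero (e : ℕ →₀ C.Coeff n) : (C.strand n).X e 0 = 0 := by
  change finsuppEnd _ _ (finsuppShift _ e) 0 = _
  rw [finsuppEnd_apply, finsuppShift_zero, map_zero]

theorem strand_X_single (b : C.Coeff n) (j : ℕ) : (C.strand n).X (Finsupp.single j b) =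
    Finsupp.single (j + 1) (C.opF F.nakayamaEquiv.symm.toLinearMap b) := by
  ext i
  cases i with
  | zero => rw [strand_X_zero, Finsupp.single_eq_of_ne (by omega)]
  | succ i =>
    rw [strand_X_succ]
    by_cases h : i = j
    · subst h; simp
    · rw [Finsupp.single_eq_of_ne h, Finsupp.single_eq_of_ne (by omega), map_zero]

theorem strand_X_pow_single (a : ℕ) (b : C.Coeff n) (j : ℕ) :
    ((C.strand n).X ^ a) (Finsupp.single j b) =
      Finsupp.single (j + a) (C.opF (F.nakayamaEquiv.symm.toLinearMap ^ a) b) := by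
  induction a with
  | zero => simp
  | succ a ih =>
    rw [pow_succ', Module.End.mul_apply, ih, strand_X_single, pow_succ', map_mul]; rfl

theorem strand_Φ_single (a : F.carrier) (b : C.Coeff n) (j : ℕ) :
    (C.strand n).Φ a (Finsupp.single j b) = Finsupp.single j (C.mulF a b) := by
  change Finsupp.mapRange.linearMap _ _ = _
  rw [Finsupp.mapRange.linearMap_apply, Finsupp.mapRange_single]
  rfl

theorem opF_nakayama_cancel (b : C.Coeff n) :
    C.opF F.nakayama (C.opF F.nakayamaEquiv.symm.toLinearMap b) = b := by
  rw [← Module.End.mul_apply, ← map_mul]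
  have : F.nakayama * F.nakayamaEquiv.symm.toLinearMap = 1 :=
    LinearMap.ext fun f => F.nakayama_symm f
  rw [this, map_one]; rfl

theorem opF_nakayama_cancel' (b : C.Coeff n) :
    C.opF F.nakayamaEquiv.symm.toLinearMap (C.opF F.nakayama b) = b := by
  rw [← Module.End.mul_apply, ← map_mul]
  have : F.nakayamaEquiv.symm.toLinearMap * F.nakayama = 1 :=
    LinearMap.ext fun f => F.symm_nakayama f
  rw [this, map_one]; rfl

theorem opF_pow_surjective (a : ℕ) (b : C.Coeff n) :
    ∃ b', C.opF (F.nakayamaEquiv.symm.toLinearMap ^ a) b' = b := by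
  induction a with
  | zero => exact ⟨b, by simp⟩
  | succ a ih =>
    obtain ⟨b', rfl⟩ := ih
    refine ⟨C.opF F.nakayama b', ?_⟩
    rw [pow_succ, map_mul, Module.End.mul_apply, opF_nakayama_cancel']

theorem single_mem_degLT {V : Type*} [AddCommGroup V] [Module k V] {j a : ℕ} (h : j < a) (v : V) :
    Finsupp.single j v ∈ degLT k V a :=
  fun i hi => Finsupp.single_eq_of_ne (by omega)

theorem strand_isFiltered : (C.strand n).IsFiltered C (degLT k (C.Coeff n)) where
  mono := fun a b hab e he j hj => he j (hab.trans hj)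
  zero := by
    refine (Submodule.eq_bot_iff _).2 fun e he => Finsupp.ext fun j => he j (Nat.zero_le j)
  exhaust e := ⟨e.support.sup id + 1, fun j hj => by
    by_contra h
    have := Finset.le_sup (f := id) (Finsupp.mem_support_iff.2 h)
    rw [id_eq] at this
    omega⟩
  ρ_mem z a e he j hj := by
    change finsuppEnd _ _ e j = 0
    rw [finsuppEnd_apply, he j hj, map_zero]
  Φ_mem c a e he j hj := by
    change finsuppEnd _ _ e j = 0
    rw [finsuppEnd_apply, he j hj, map_zero]
  X_mem a e he j hj := by
    cases j with
    | zero => exact C.strand_X_zero e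
    | succ j => rw [strand_X_succ, he j (by omega), map_zero]
  of_X_mem a e he j hj := by
    have := he (j + 1) (by omega)
    rw [strand_X_succ] at this
    rw [← C.opF_nakayama_cancel (e j), this, map_zero]
  exists_pow a e he := by
    obtain ⟨b, hb⟩ := C.opF_pow_surjective a (e a)
    refine ⟨Finsupp.single 0 b, single_mem_degLT Nat.zero_lt_one b, fun j hj => ?_⟩
    rw [strand_X_pow_single, hb, Finsupp.sub_apply, zero_add]
    by_cases h : j = a
    · subst h; rw [Finsupp.single_eq_same, sub_self]
    · rw [Finsupp.single_eq_of_ne h, sub_zero, he j (by omega)]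
  chi h := by
    obtain ⟨p, hp⟩ := C.chi_mem (⟨0, h⟩ : Fin n)
    change finsuppEnd _ (C.coeffAct n _) = 0
    rw [C.coeffAct_of_mem hp, C.quot_chi, map_zero, map_zero, zero_mul, map_zero]

variable (n) in
/-- The trace in the tensor factor `F`. -/
noncomputable def coeffTr : C.Coeff n →ₗ[k] C.Cyc n :=
  (TensorProduct.lid k (C.Cyc n)).toLinearMap ∘ₗ LinearMap.rTensor (C.Cyc n) F.tr

theorem coeffTr_tmul (f : F.carrier) (m : C.Cyc n) : C.coeffTr n (f ⊗ₜ m) = F.tr f • m := by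
  simp [coeffTr]

/-- The sign rule in the action disappears under the trace by `tr_sgnOp`. -/
theorem coeffTr_coeffAct (z : F.Affine n) (b : C.Coeff n) :
    C.coeffTr n (C.coeffAct n z b) = C.quot n z * C.coeffTr n b := by
  refine affine_hom_ind (P := fun z => C.coeffTr n (C.coeffAct n z b) = C.quot n z * C.coeffTr n b)
    (by simp) (fun p z hz => ?_) (fun z w hz hw => by
      rw [map_add, LinearMap.add_apply, map_add, map_add, add_mul, hz, hw]) z
  rw [coeffAct_of_mem C hz]
  induction b using TensorProduct.induction_on with
  | zero => simp
  | add b c hb hc => rw [map_add, map_add, map_add, mul_add, hb, hc]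
  | tmul f m =>
    have : F.tr (F.sgnOp p f) = F.tr f := LinearMap.congr_fun (tr_sgnOp p) f
    change C.coeffTr n (F.sgnOp p f ⊗ₜ (C.quot n z * m)) = _
    rw [coeffTr_tmul, coeffTr_tmul, this, mul_smul_comm]

theorem coeffTr_nakayama_pow (a : ℕ) (b : C.Coeff n) :
    C.coeffTr n (C.opF (F.nakayamaEquiv.symm.toLinearMap ^ a) b) = C.coeffTr n b := by
  induction a generalizing b with
  | zero => simp
  | succ a ih =>
    rw [pow_succ, map_mul, Module.End.mul_apply, ih]
    induction b using TensorProduct.induction_on with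
    | zero => simp
    | add b c hb hc => rw [map_add, map_add, map_add, hb, hc]
    | tmul f m =>
      change C.coeffTr n (F.nakayamaEquiv.symm f ⊗ₜ m) = _
      rw [coeffTr_tmul, coeffTr_tmul, ← F.tr_nakayama, nakayama_symm]

theorem coeffTr_mulRight (c : C.Cyc n) (b : C.Coeff n) :
    C.coeffTr n (C.opC (LinearMap.mulRight k c) b) = C.coeffTr n b * c := by
  induction b using TensorProduct.induction_on with
  | zero => simp
  | add b c hb hc => rw [map_add, map_add, map_add, add_mul, hb, hc]
  | tmul f m =>
    change C.coeffTr n (f ⊗ₜ (m * c)) = _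
    rw [coeffTr_tmul, coeffTr_tmul, smul_mul_assoc]

variable (n) in
/-- The trace of the coefficient of the highest power allowed by the cyclotomic relation. -/
noncomputable def strandTr : (ℕ →₀ C.Coeff n) →ₗ[k] C.Cyc n :=
  -- At level `0` the index is `0`, which is harmless: all remainders modulo `χ` are then zero.
  C.coeffTr n ∘ₗ Finsupp.lapply (C.level - 1)

theorem strandTr_apply (e : ℕ →₀ C.Coeff n) : C.strandTr n e = C.coeffTr n (e (C.level - 1)) := rfl

theorem strandTr_of_mem (e) (he : e ∈ degLT k (C.Coeff n) (C.level - 1)) : C.strandTr n e = 0 := by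
  rw [strandTr_apply, he _ le_rfl, map_zero]

theorem strandTr_ρ (z : F.Affine n) (e) : C.strandTr n ((C.strand n).ρ z e) =
    ((Algebra.lmul k (C.Cyc n)).comp (C.quot n)) z (C.strandTr n e) := by
  change C.coeffTr n (finsuppEnd _ (C.coeffAct n z) e _) = _
  rw [finsuppEnd_apply, coeffTr_coeffAct]; rfl

/-- Right multiplication on the strand representation. -/
noncomputable def strandRight (c : C.Cyc n) : Module.End k (ℕ →₀ C.Coeff n) :=
  finsuppEnd _ (C.opC (LinearMap.mulRight k c))

theorem strandRight_ρ (c : C.Cyc n) (z) : Commute (C.strandRight c) ((C.strand n).ρ z) := by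
  refine Commute.map (f := finsuppEnd (C.Coeff n)) ?_
  refine affine_hom_ind (P := fun z => Commute (C.opC (LinearMap.mulRight k c)) (C.coeffAct n z))
    (by rw [map_zero]; exact Commute.zero_right _) (fun p z hz => ?_)
    (fun z w hz hw => by rw [map_add]; exact hz.add_right hw) z
  rw [coeffAct_of_mem C hz]
  refine Commute.mul_right ?_ (C.op_commute _ _)
  refine Commute.map (f := C.opC) ?_
  exact LinearMap.ext fun m => mul_assoc _ _ _

theorem strandRight_Φ (c : C.Cyc n) (a) : Commute (C.strandRight c) ((C.strand n).Φ a) :=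
  Commute.map (f := finsuppEnd (C.Coeff n)) (C.op_commute _ _)

theorem strandRight_X (c : C.Cyc n) : Commute (C.strandRight c) (C.strand n).X :=
  Commute.mul_right (Commute.map (f := finsuppEnd (C.Coeff n)) (C.op_commute _ _))
    (finsuppShift_commute _)

theorem strandRight_mem (c : C.Cyc n) (a) (e) (he : e ∈ degLT k (C.Coeff n) a) :
    C.strandRight c e ∈ degLT k (C.Coeff n) a := fun j hj => by
  rw [strandRight, finsuppEnd_apply, he j hj, map_zero]

theorem strandTr_strandRight (c : C.Cyc n) (e) :
    C.strandTr n (C.strandRight c e) = LinearMap.mulRight k c (C.strandTr n e) := by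
  rw [strandTr_apply, strandRight, finsuppEnd_apply, coeffTr_mulRight]; rfl

end CycParam

end FrobSuperalgebra

/-! ### Homogeneous components and graded Frobenius extensions. -/

section Components

variable {M S : Type*} [AddCommGroup M] [SetLike S M] [AddSubmonoidClass S M] {𝓜 : Bideg → S}
  (h : DirectSum.IsInternal 𝓜)

theorem isInternal_induction (h : DirectSum.IsInternal 𝓜) {P : M → Prop} (h0 : P 0)
    (hm : ∀ p, ∀ m ∈ 𝓜 p, P m) (ha : ∀ x y, P x → P y → P (x + y)) (m : M) : P m := by
  refine AddSubmonoid.closure_induction (motive := fun m _ => P m) ?_ h0 (fun x y _ _ => ha x y)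
    (mem_closure_of_isInternal 𝓜 h m)
  intro z hz
  obtain ⟨p, hp⟩ := Set.mem_iUnion.1 hz
  exact hm p z hp

/-- The homogeneous component of bidegree `p`. -/
noncomputable def gradedComp (p : Bideg) : M →+ M :=
  (Finsupp.applyAddHom p).comp (coaction 𝓜 h)

theorem gradedComp_of_mem {p q : Bideg} {m : M} (hm : m ∈ 𝓜 q) :
    gradedComp h p m = if q = p then m else 0 := by
  rw [gradedComp, AddMonoidHom.comp_apply, coaction_of_mem _ _ hm, Finsupp.applyAddHom_apply,
    Finsupp.single_apply]

theorem gradedComp_same {p : Bideg} {m : M} (hm : m ∈ 𝓜 p) : gradedComp h p m = m := by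
  rw [gradedComp_of_mem h hm, if_pos rfl]

theorem gradedComp_mem (p : Bideg) (m : M) : gradedComp h p m ∈ 𝓜 p := by
  refine isInternal_induction h (P := fun m => gradedComp h p m ∈ 𝓜 p)
    (by rw [map_zero]; exact zero_mem _) (fun q m hm => ?_)
    (fun x y hx hy => by rw [map_add]; exact add_mem hx hy) m
  rw [gradedComp_of_mem h hm]
  split_ifs with hq
  · exact hq ▸ hm
  · exact zero_mem _

end Components

section FrobeniusExtension

variable {k : Type u} [CommRing k] {A : Type u} [Ring A] [Algebra k A] {A' : Type u} [Ring A']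
  [Algebra k A'] {𝒜 : Bideg → Submodule k A} {𝒜' : Bideg → Submodule k A'}

theorem gradedComp_mul [SetLike.GradedMonoid 𝒜] (h : DirectSum.IsInternal 𝒜) {p : Bideg} {a : A}
    (ha : a ∈ 𝒜 p) (r : Bideg) (m : A) : gradedComp h (p + r) (a * m) = a * gradedComp h r m := by
  refine isInternal_induction h (P := fun m => gradedComp h (p + r) (a * m) = a * gradedComp h r m)
    (by simp) (fun q m hm => ?_) (fun x y hx hy => by rw [mul_add, map_add, map_add, mul_add, hx, hy])
    m
  rw [gradedComp_of_mem h (SetLike.mul_mem_graded ha hm), gradedComp_of_mem h hm]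
  simp only [add_right_inj, mul_ite, mul_zero]

theorem gradedComp_mul' [SetLike.GradedMonoid 𝒜] (h : DirectSum.IsInternal 𝒜) {p : Bideg} {a : A}
    (ha : a ∈ 𝒜 p) (r : Bideg) (m : A) : gradedComp h (r + p) (m * a) = gradedComp h r m * a := by
  refine isInternal_induction h (P := fun m => gradedComp h (r + p) (m * a) = gradedComp h r m * a)
    (by simp) (fun q m hm => ?_) (fun x y hx hy => by rw [add_mul, map_add, map_add, add_mul, hx, hy])
    m
  rw [gradedComp_of_mem h (SetLike.mul_mem_graded hm ha), gradedComp_of_mem h hm]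
  simp only [add_left_inj, ite_mul, zero_mul]

/-- A graded Frobenius extension: a homomorphism of graded algebras together with a homogeneous
trace map of degree `-D`, which is a bimodule map, and dual bases. -/
structure GradedFrobExt (φ : A →ₐ[k] A') (𝒜 : Bideg → Submodule k A)
    (𝒜' : Bideg → Submodule k A') (D : Bideg) (I : Type u) [Fintype I] where
  tr : A' →+ A
  tr_mem : ∀ p, ∀ z ∈ 𝒜' p, tr z ∈ 𝒜 (p - D)
  tr_left : ∀ a z, tr (φ a * z) = a * tr z
  tr_right : ∀ z a, tr (z * φ a) = tr z * a
  left : I → A'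
  right : I → A'
  deg : I → Bideg
  left_mem : ∀ i, left i ∈ 𝒜' (deg i)
  right_mem : ∀ i, right i ∈ 𝒜' (D - deg i)
  sum_left : ∀ z, ∑ i, left i * φ (tr (right i * z)) = z
  sum_right : ∀ z, ∑ i, φ (tr (z * left i)) * right i = z

/-- The homogeneous part of degree `-D` of an additive map. -/
noncomputable def homogeneousPart (h : DirectSum.IsInternal 𝒜) (h' : DirectSum.IsInternal 𝒜')
    (D : Bideg) (tr : A' →+ A) : A' →+ A :=
  (Finsupp.liftAddHom fun q => (gradedComp h (q - D)).comp tr).comp (coaction 𝒜' h')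

theorem homogeneousPart_of_mem (h : DirectSum.IsInternal 𝒜) (h' : DirectSum.IsInternal 𝒜')
    (D : Bideg) (tr : A' →+ A) {q : Bideg} {z : A'} (hz : z ∈ 𝒜' q) :
    homogeneousPart h h' D tr z = gradedComp h (q - D) (tr z) := by
  rw [homogeneousPart, AddMonoidHom.comp_apply, coaction_of_mem _ _ hz,
    Finsupp.liftAddHom_apply_single, AddMonoidHom.comp_apply]

/-- An entry of `G - 1` is nonzero only if `l` strictly increases from row to column, so `G - 1` is
nilpotent. The coefficients need not commute. -/
theorem isUnit_of_unitriangular {R I : Type*} [Ring R] [Fintype I] [DecidableEq I]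
    (G : Matrix I I R) (l : I → ℕ) (hG : ∀ i j, l j ≤ l i → G i j = if i = j then 1 else 0) :
    IsUnit G := by
  have hN : ∀ m i j, l j < l i + m → ((G - 1) ^ m) i j = 0 := by
    intro m
    induction m with
    | zero =>
      intro i j hij
      rw [pow_zero, Matrix.one_apply_ne]
      rintro rfl
      omega
    | succ m ih =>
      intro i j hij
      rw [pow_succ, Matrix.mul_apply]
      refine Finset.sum_eq_zero fun x _ => ?_
      by_cases hx : l x < l i + m
      · rw [ih i x hx, zero_mul]
      · rw [Matrix.sub_apply, Matrix.one_apply, hG x j (by omega), sub_self, mul_zero]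
  have : IsNilpotent (G - 1) := ⟨Finset.univ.sup l + 1, Matrix.ext fun i j => hN _ i j (by
    have := Finset.le_sup (f := l) (Finset.mem_univ j)
    omega)⟩
  simpa using this.isUnit_one_add

/-- A bimodule map and two generating systems that are in duality up to a unitriangular matrix
yield a graded Frobenius extension. -/
theorem GradedFrobExt.nonempty_of_unitriangular [SetLike.GradedMonoid 𝒜] [SetLike.GradedMonoid 𝒜']
    (h : DirectSum.IsInternal 𝒜) (h' : DirectSum.IsInternal 𝒜') {φ : A →ₐ[k] A'}
    (hφ : ∀ p, ∀ a ∈ 𝒜 p, φ a ∈ 𝒜' p) (D : Bideg) {I : Type u} [Fintype I] [DecidableEq I]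
    (tr : A' →+ A) (tr_left : ∀ a z, tr (φ a * z) = a * tr z)
    (tr_right : ∀ z a, tr (z * φ a) = tr z * a) (x y : I → A') (deg : I → Bideg)
    (hx : ∀ i, x i ∈ 𝒜' (deg i)) (hy : ∀ i, y i ∈ 𝒜' (D - deg i))
    (span_left : ∀ z, z ∈ AddSubgroup.closure {w | ∃ i a, w = x i * φ a})
    (span_right : ∀ z, z ∈ AddSubgroup.closure {w | ∃ i a, w = φ a * y i})
    (l : I → ℕ) (hG : ∀ i j, l j ≤ l i → tr (y i * x j) = if i = j then 1 else 0) :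
    Nonempty (GradedFrobExt φ 𝒜 𝒜' D I) := by
  -- The given trace is not assumed homogeneous. Its part of degree `-D` is still a bimodule map,
  -- because `φ` preserves degrees.
  set T := homogeneousPart h h' D tr with hT
  have T_mem : ∀ {q z}, z ∈ 𝒜' q → T z = gradedComp h (q - D) (tr z) :=
    fun hz => homogeneousPart_of_mem h h' D tr hz
  have T_left : ∀ a z, T (φ a * z) = a * T z := by
    intro a z
    refine isInternal_induction h (P := fun a => T (φ a * z) = a * T z) (by simp) (fun p a ha => ?_)
      (fun a b ha hb => by simp only [map_add, add_mul, ha, hb]) a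
    refine isInternal_induction h' (P := fun z => T (φ a * z) = a * T z) (by simp)
      (fun q z hz => ?_) (fun a b ha hb => by simp only [map_add, mul_add, ha, hb]) z
    rw [T_mem hz, T_mem (SetLike.mul_mem_graded (hφ p a ha) hz), tr_left, add_sub_assoc,
      gradedComp_mul h ha]
  have T_right : ∀ z a, T (z * φ a) = T z * a := by
    intro z a
    refine isInternal_induction h (P := fun a => T (z * φ a) = T z * a) (by simp) (fun p a ha => ?_)
      (fun a b ha hb => by simp only [map_add, mul_add, ha, hb]) a
    refine isInternal_induction h' (P := fun z => T (z * φ a) = T z * a) (by simp)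
      (fun q z hz => ?_) (fun a b ha hb => by simp only [map_add, add_mul, ha, hb]) z
    rw [T_mem hz, T_mem (SetLike.mul_mem_graded hz (hφ p a ha)), tr_right, add_sub_right_comm,
      gradedComp_mul' h ha]
  set G : Matrix I I A := Matrix.of fun i j => T (y i * x j) with hGdef
  -- The prescribed entries survive: the product `y i * x i` has degree `D`, and its trace `1` has
  -- degree `0`.
  have hG' : ∀ i j, l j ≤ l i → G i j = if i = j then 1 else 0 := by
    intro i j hij
    rw [hGdef, Matrix.of_apply, T_mem (SetLike.mul_mem_graded (hy i) (hx j)), hG i j hij]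
    split_ifs with e
    · subst e
      rw [sub_add_cancel, sub_self]
      exact gradedComp_same h (SetLike.GradedOne.one_mem (A := 𝒜))
    · rw [map_zero]
  obtain ⟨H, hH1, hH2⟩ : ∃ H : Matrix I I A, G * H = 1 ∧ H * G = 1 := by
    obtain ⟨U, hU⟩ := isUnit_of_unitriangular G l hG'
    exact ⟨(U⁻¹ : (Matrix I I A)ˣ), by rw [← hU]; exact U.mul_inv, by rw [← hU]; exact U.inv_mul⟩
  -- The inverse Gram matrix turns `y` into a system exactly dual to `x`.
  set y' : I → A' := fun i => ∑ j, φ (H i j) * y j with hy'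
  have dual : ∀ i j, T (y' i * x j) = if i = j then 1 else 0 := by
    intro i j
    have := congrFun (congrFun hH2 i) j
    rw [Matrix.mul_apply, Matrix.one_apply] at this
    rw [hy', ← this, Finset.sum_mul, map_sum]
    exact Finset.sum_congr rfl fun c _ => by rw [mul_assoc, T_left]; rfl
  have sum_right : ∀ z, ∑ i, φ (T (z * x i)) * y' i = z := by
    intro z
    have key : ∀ j, ∑ i, φ (T (y j * x i)) * y' i = y j := by
      intro j
      have : ∀ c, ∑ i, φ (G j i) * φ (H i c) = if j = c then 1 else 0 := by
        intro c
        have := congrFun (congrFun hH1 j) c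
        rw [Matrix.mul_apply, Matrix.one_apply] at this
        simp only [← map_mul, ← map_sum]
        rw [this]
        split_ifs <;> simp
      calc ∑ i, φ (T (y j * x i)) * y' i = ∑ i, ∑ c, φ (G j i) * φ (H i c) * y c :=
            Finset.sum_congr rfl fun i _ => by
              rw [hy', Finset.mul_sum]
              exact Finset.sum_congr rfl fun c _ => (mul_assoc _ _ _).symm
        _ = ∑ c, (if j = c then 1 else 0) * y c := by
            rw [Finset.sum_comm]
            exact Finset.sum_congr rfl fun c _ => by rw [← Finset.sum_mul, this]
        _ = y j := by simp
    refine AddSubgroup.closure_induction (p := fun z _ => ∑ i, φ (T (z * x i)) * y' i = z)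
      ?_ (by simp) ?_ ?_ (span_right z)
    · rintro _ ⟨j, a, rfl⟩
      conv_rhs => rw [← key j]
      rw [Finset.mul_sum]
      exact Finset.sum_congr rfl fun i _ => by rw [mul_assoc, T_left, map_mul, mul_assoc]
    · intro z w _ _ hz hw
      simp only [add_mul, map_add, Finset.sum_add_distrib, hz, hw]
    · intro z _ hz
      simp only [neg_mul, map_neg, Finset.sum_neg_distrib, hz]
  have sum_left : ∀ z, ∑ i, x i * φ (T (y' i * z)) = z := by
    intro z
    refine AddSubgroup.closure_induction (p := fun z _ => ∑ i, x i * φ (T (y' i * z)) = z)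
      ?_ (by simp) ?_ ?_ (span_left z)
    · rintro _ ⟨j, a, rfl⟩
      rw [Finset.sum_eq_single_of_mem j (Finset.mem_univ _)]
      · rw [← mul_assoc, T_right, dual, if_pos rfl, one_mul]
      · intro i _ hi
        rw [← mul_assoc, T_right, dual, if_neg hi, zero_mul, map_zero, mul_zero]
    · intro z w _ _ hz hw
      simp only [mul_add, map_add, Finset.sum_add_distrib, hz, hw]
    · intro z _ hz
      simp only [mul_neg, map_neg, Finset.sum_neg_distrib, hz]
  have T_comp : ∀ r z, T (gradedComp h' r z) = gradedComp h (r - D) (T z) := by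
    intro r z
    refine isInternal_induction h' (P := fun z => T (gradedComp h' r z) = gradedComp h (r - D) (T z))
      (by simp) (fun q z hz => ?_) (fun a b ha hb => by simp only [map_add, ha, hb]) z
    have hTz : T z ∈ 𝒜 (q - D) := by rw [T_mem hz]; exact gradedComp_mem h _ _
    rw [gradedComp_of_mem h' hz, gradedComp_of_mem h hTz]
    simp only [sub_left_inj]
    split_ifs <;> simp
  have y'_mem : ∀ i, y' i ∈ 𝒜' (D - deg i) := by
    intro i
    -- The homogeneous component of `y' i` has the same products with all `x j` under `T` as `y' i`
    -- itself, and `sum_right` recovers an element from these.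
    have : gradedComp h' (D - deg i) (y' i) = y' i := by
      rw [← sum_right (gradedComp h' (D - deg i) (y' i))]
      have : ∀ j, T (gradedComp h' (D - deg i) (y' i) * x j) = if i = j then 1 else 0 := by
        intro j
        rw [← gradedComp_mul' h' (hx j), T_comp, dual]
        split_ifs with e
        · subst e
          rw [sub_add_cancel, sub_self]
          exact gradedComp_same h (SetLike.GradedOne.one_mem (A := 𝒜))
        · rw [map_zero]
      simp [this]
    rw [← this]; exact gradedComp_mem h' _ _
  exact ⟨{
    tr := T
    tr_mem := fun p z hz => by rw [T_mem hz]; exact gradedComp_mem h _ _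
    tr_left := T_left
    tr_right := T_right
    left := x
    right := y'
    deg := deg
    left_mem := hx
    right_mem := y'_mem
    sum_left := sum_left
    sum_right := sum_right }⟩

end FrobeniusExtension

/-! ### The trace and the dual generators of the cyclotomic algebra. -/

namespace FrobSuperalgebra

variable {k : Type u} [CommRing k] {F : FrobSuperalgebra k} {n : ℕ}

theorem af_castSucc_mul_af_last (l : Fin n) (a b : F.carrier) :
    F.af l.castSucc a * F.af (Fin.last n) b ∈ Submodule.span k
      {w | ∃ a' b', w = F.af (Fin.last n) b' * F.af l.castSucc a'} := by
  refine F.hom_ind (fun a => F.af l.castSucc a * F.af (Fin.last n) b ∈ Submodule.span k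
    {w | ∃ a' b', w = F.af (Fin.last n) b' * F.af l.castSucc a'}) ?_ (fun p a ha => ?_) ?_ a
  · rw [← afHom_apply, map_zero, zero_mul]; exact zero_mem _
  · refine F.hom_ind (fun b => F.af l.castSucc a * F.af (Fin.last n) b ∈ Submodule.span k
      {w | ∃ a' b', w = F.af (Fin.last n) b' * F.af l.castSucc a'}) ?_ (fun q b hb => ?_) ?_ b
    · rw [← afHom_apply F (Fin.last n), map_zero, mul_zero]; exact zero_mem _
    · have := (F.affRep (n + 1)).superComm l.castSucc (Fin.last n) (Fin.castSucc_ne_last l)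
        p q a ha b hb
      rw [affRep_Φ, affRep_Φ] at this
      rw [this]
      exact Submodule.smul_mem _ _ (Submodule.subset_span ⟨a, b, rfl⟩)
    · intro f g hf hg
      rw [← afHom_apply F (Fin.last n), map_add, mul_add]; exact add_mem hf hg
  · intro f g hf hg
    rw [← afHom_apply F l.castSucc, map_add, add_mul]; exact add_mem hf hg

theorem af_last_mul_af_castSucc (l : Fin n) (a b : F.carrier) :
    F.af (Fin.last n) b * F.af l.castSucc a ∈ Submodule.span k
      {w | ∃ a' b', w = F.af l.castSucc a' * F.af (Fin.last n) b'} := by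
  refine F.hom_ind (fun a => F.af (Fin.last n) b * F.af l.castSucc a ∈ Submodule.span k
    {w | ∃ a' b', w = F.af l.castSucc a' * F.af (Fin.last n) b'}) ?_ (fun p a ha => ?_) ?_ a
  · rw [← afHom_apply F l.castSucc, map_zero, mul_zero]; exact zero_mem _
  · refine F.hom_ind (fun b => F.af (Fin.last n) b * F.af l.castSucc a ∈ Submodule.span k
      {w | ∃ a' b', w = F.af l.castSucc a' * F.af (Fin.last n) b'}) ?_ (fun q b hb => ?_) ?_ b
    · rw [← afHom_apply F (Fin.last n), map_zero, zero_mul]; exact zero_mem _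
    · have := (F.affRep (n + 1)).superComm (Fin.last n) l.castSucc (Fin.castSucc_ne_last l).symm
        q p b hb a ha
      rw [affRep_Φ, affRep_Φ] at this
      rw [this]
      exact Submodule.smul_mem _ _ (Submodule.subset_span ⟨a, b, rfl⟩)
    · intro f g hf hg
      rw [← afHom_apply F (Fin.last n), map_add, add_mul]; exact add_mem hf hg
  · intro f g hf hg
    rw [← afHom_apply F l.castSucc, map_add, mul_add]; exact add_mem hf hg

theorem affineIncl_ax (l : Fin n) : F.affineIncl n (F.ax l) = F.ax l.castSucc := by
  rw [affineIncl, Affine.lift_ax]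

theorem affineIncl_af (l : Fin n) (a) : F.affineIncl n (F.af l a) = F.af l.castSucc a := by
  rw [affineIncl, Affine.lift_af, afHom_apply]

theorem affineIncl_as (π) : F.affineIncl n (F.as π) = F.as (permCastSucc n π) := by
  rw [affineIncl, Affine.lift_as]; rfl

theorem nakayama_pow_surjective (m : ℕ) : Function.Surjective (F.nakayama ^ m) := by
  rw [Module.End.coe_pow]; exact F.nakayama_bijective.2.iterate m

/-- A permutation is a product of a transposition and a permutation fixing the last point. -/
theorem exists_swap_mul_permCastSucc (π : Equiv.Perm (Fin (n + 1))) :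
    ∃ i σ, π = Equiv.swap i (Fin.last n) * permCastSucc n σ := by
  refine ⟨π (Fin.last n), indPerm ((Equiv.swap (π (Fin.last n)) (Fin.last n))⁻¹ * π) (Fin.last n), ?_⟩
  rw [← eq_permCastSucc, mul_inv_cancel_left]
  rw [Equiv.Perm.mul_apply, Equiv.swap_inv, Equiv.swap_apply_left]

theorem as_permCastSucc_comm (σ : Equiv.Perm (Fin n)) (m : ℕ) (f : F.carrier) :
    F.as (permCastSucc n σ) * (F.ax (Fin.last n) ^ m * F.af (Fin.last n) f) =
      F.ax (Fin.last n) ^ m * F.af (Fin.last n) f * F.as (permCastSucc n σ) := by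
  have h1 : Commute (F.as (permCastSucc n σ)) (F.ax (Fin.last n)) :=
    as_mul_ax_last (permCastSucc_last σ)
  have h2 : Commute (F.as (permCastSucc n σ)) (F.af (Fin.last n) f) := by
    have := as_mul_af (permCastSucc n σ) (Fin.last n) f
    rwa [permCastSucc_last] at this
  exact (h1.pow_right m).mul_right h2

namespace CycParam

variable (C : F.CycParam)

theorem incl_quot (a : F.Affine n) :
    C.incl n (C.quot n a) = C.quot (n + 1) (F.affineIncl n a) := by
  rw [incl, lift_quot]; rfl

variable (n) in
/-- The action of the cyclotomic algebra on the quotient of the induced module. -/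
noncomputable def cycAct : C.Cyc (n + 1) →ₐ[k]
    Module.End k ((Fin (n + 1) → ℕ →₀ C.Coeff n) ⧸ (C.strand n).chiSub C) :=
  C.lift (AlgHom.ofLinearMap
    { toFun := fun z => Submodule.mapQ _ _ ((C.strand n).indAction z)
        (StrandRep.indAction_mem_chiSub C z)
      map_add' := fun z w => by
        refine Submodule.linearMap_qext _ (LinearMap.ext fun v => ?_)
        simp
      map_smul' := fun r z => by
        refine Submodule.linearMap_qext _ (LinearMap.ext fun v => ?_)
        simp }
    (by
      refine Submodule.linearMap_qext _ (LinearMap.ext fun v => ?_)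
      simp)
    (fun z w => by
      refine Submodule.linearMap_qext _ (LinearMap.ext fun v => ?_)
      simp)) (fun h => by
      refine Submodule.linearMap_qext _ (LinearMap.ext fun v => ?_)
      exact (Submodule.Quotient.mk_eq_zero _).2 (StrandRep.chi_mem_chiSub C v))

theorem cycAct_quot (z : F.Affine (n + 1)) (v) : C.cycAct n (C.quot (n + 1) z)
    (Submodule.Quotient.mk v) = Submodule.Quotient.mk ((C.strand n).indAction z v) := by
  rw [cycAct, lift_quot]; rfl

variable (n) in
/-- The generator of the strand representation. -/
noncomputable def strandOne : ℕ →₀ C.Coeff n := Finsupp.single 0 (1 ⊗ₜ 1)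

variable (n) in
/-- The trace map from `𝒜_{n+1}^𝐂(F)` to `𝒜_n^𝐂(F)`. -/
noncomputable def trace : C.Cyc (n + 1) →ₗ[k] C.Cyc n :=
  -- Apply the element to the generator of the induced module and evaluate `trInd`, which is defined
  -- on the quotient because it vanishes on `chiSub`.
  Submodule.liftQ _ (C.strand_isFiltered.trInd (C.strandTr n))
    (fun _ hv => C.strand_isFiltered.trInd_of_mem_chiSub hv) ∘ₗ
  (C.cycAct n).toLinearMap.flip (Submodule.Quotient.mk (StrandRep.lastIncl n (C.strandOne n)))

theorem trace_quot (z : F.Affine (n + 1)) : C.trace n (C.quot (n + 1) z) =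
    C.strand_isFiltered.trInd (C.strandTr n)
      ((C.strand n).indAction z (StrandRep.lastIncl n (C.strandOne n))) := by
  change Submodule.liftQ _ (C.strand_isFiltered.trInd (C.strandTr n))
    (fun _ hv => C.strand_isFiltered.trInd_of_mem_chiSub hv)
    (C.cycAct n (C.quot (n + 1) z) (Submodule.Quotient.mk _)) = _
  rw [cycAct_quot]; rfl

theorem trace_incl_mul (a : C.Cyc n) (z : C.Cyc (n + 1)) :
    C.trace n (C.incl n a * z) = a * C.trace n z := by
  obtain ⟨a, rfl⟩ := C.quot_surjective a
  obtain ⟨z, rfl⟩ := C.quot_surjective z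
  rw [incl_quot, ← map_mul, trace_quot, trace_quot, map_mul, Module.End.mul_apply,
    C.strand_isFiltered.trInd_incl C.strandTr_of_mem C.strandTr_ρ]
  rfl

/-- On the generator `1 ⊗ 1` the left action agrees with right multiplication, since `1` is even and
no sign arises. Right multiplication in turn commutes with the whole action of `𝒜_{n+1}(F)`, which
yields right linearity of the trace. -/
theorem strand_ρ_strandOne (a : F.Affine n) :
    (C.strand n).ρ a (C.strandOne n) = C.strandRight (C.quot n a) (C.strandOne n) := by
  have : C.coeffAct n a (1 ⊗ₜ 1) = 1 ⊗ₜ C.quot n a := by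
    refine affine_hom_ind (P := fun a => C.coeffAct n a (1 ⊗ₜ 1) = 1 ⊗ₜ C.quot n a) (by simp)
      (fun p a ha => ?_) (fun a b ha hb => by
        rw [map_add, LinearMap.add_apply, ha, hb, map_add, TensorProduct.tmul_add]) a
    rw [C.coeffAct_of_mem ha]
    change F.sgnOp p 1 ⊗ₜ[k] (C.quot n a * 1) = _
    rw [sgnOp_of_mem p (SetLike.GradedOne.one_mem (A := F.gr)), mul_one, Bideg.sign_comm]
    simp [Bideg.sign]
  change Finsupp.mapRange.linearMap _ _ = Finsupp.mapRange.linearMap _ _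
  rw [strandOne, Finsupp.mapRange.linearMap_apply, Finsupp.mapRange_single,
    Finsupp.mapRange.linearMap_apply, Finsupp.mapRange_single]
  congr 1
  refine this.trans ?_
  change _ = (1 : F.carrier) ⊗ₜ[k] (1 * C.quot n a)
  rw [one_mul]

theorem trace_mul_incl (z : C.Cyc (n + 1)) (a : C.Cyc n) :
    C.trace n (z * C.incl n a) = C.trace n z * a := by
  obtain ⟨a, rfl⟩ := C.quot_surjective a
  obtain ⟨z, rfl⟩ := C.quot_surjective z
  rw [incl_quot, ← map_mul, trace_quot, trace_quot, map_mul, Module.End.mul_apply,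
    StrandRep.indAction_incl, strand_ρ_strandOne, StrandRep.lastIncl, ← StrandRep.mapEnd_single,
    ← Module.End.mul_apply, ← (StrandRep.mapEnd_indAction (C.strandRight_ρ _) (C.strandRight_X _)
      (C.strandRight_Φ _) z).eq, Module.End.mul_apply,
    C.strand_isFiltered.trInd_mapEnd (C.strandRight_ρ _) (C.strandRight_X _) (C.strandRight_Φ _)
      (C.strandRight_mem _) (C.strandTr_strandRight _)]
  rfl

variable (n) in
/-- The index set of the generators of `𝒜_{n+1}^𝐂(F)` over `𝒜_n^𝐂(F)`. -/
abbrev GenIdx : Type u := Fin (n + 1) × Fin C.level × F.ι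

/-- Generators from the left. -/
noncomputable def genLeft (x : C.GenIdx n) : F.Affine (n + 1) :=
  F.as (Equiv.swap x.1 (Fin.last n)) *
    (F.af (Fin.last n) (F.basis x.2.2) * F.ax (Fin.last n) ^ (x.2.1 : ℕ))

/-- Generators from the right. -/
noncomputable def genRight (x : C.GenIdx n) : F.Affine (n + 1) :=
  F.ax (Fin.last n) ^ (C.level - 1 - x.2.1) * F.af (Fin.last n) (F.dualBasis x.2.2) *
    F.as (Equiv.swap x.1 (Fin.last n))

/-- The bidegree of the generators. -/
def genDeg (x : C.GenIdx n) : Bideg := F.basisDeg x.2.2 + (x.2.1 : ℕ) • F.top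

theorem genLeft_mem (x : C.GenIdx n) : C.genLeft x ∈ F.affineGr (n + 1) (C.genDeg x) := by
  have := SetLike.mul_mem_graded (F.as_mem (Equiv.swap x.1 (Fin.last n)))
    (SetLike.mul_mem_graded (F.af_mem (Fin.last n) (F.basis_mem x.2.2))
      (SetLike.pow_mem_graded (x.2.1 : ℕ) (F.ax_mem (Fin.last n))))
  rwa [zero_add] at this

theorem genRight_mem (x : C.GenIdx n) :
    C.genRight x ∈ F.affineGr (n + 1) (C.level • F.top - C.genDeg x) := by
  have := SetLike.mul_mem_graded (SetLike.mul_mem_graded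
    (SetLike.pow_mem_graded (C.level - 1 - x.2.1 : ℕ) (F.ax_mem (Fin.last n)))
    (F.af_mem (Fin.last n) (F.dualBasis_mem x.2.2))) (F.as_mem (Equiv.swap x.1 (Fin.last n)))
  -- The summand `1` accounts for the `F.top` in the bidegree of the dual basis element.
  have hl : C.level = (C.level - 1 - x.2.1) + 1 + x.2.1 := by have := x.2.1.2; omega
  have hd : C.level • F.top - C.genDeg x =
      (C.level - 1 - x.2.1 : ℕ) • F.top + (F.top - F.basisDeg x.2.2) + 0 := by
    conv_lhs => rw [hl]
    rw [genDeg, add_smul, add_smul, one_smul]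
    abel
  rw [hd]
  exact this

/-- For equal positions the product is `x^{d-1-a} bᵛ b' x^{a'}`, whose degree is `d - 1` only if `a'
= a`, and then the trace is `tr (bᵛ b')`. For different positions the vector starts outside the last
component. The bound `a' ≤ a` keeps the degree below `d`, so no reduction modulo `χ` occurs. -/
theorem trace_gen (x y : C.GenIdx n) (h : (y.2.1 : ℕ) ≤ x.2.1) :
    C.trace n (C.quot (n + 1) (C.genRight x) * C.quot (n + 1) (C.genLeft y)) =
      if x = y then 1 else 0 := by
  obtain ⟨i, a, b⟩ := x
  obtain ⟨j, a', b'⟩ := y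
  change (a' : ℕ) ≤ a at h
  have ha := a.2
  rw [← map_mul, trace_quot]
  have hX : ((C.strand n).X ^ (a' : ℕ)) (C.strandOne n) = Finsupp.single (a' : ℕ) (1 ⊗ₜ 1) := by
    have h1 : ∀ m : ℕ, (F.nakayamaEquiv.symm.toLinearMap ^ m) (1 : F.carrier) = 1 := by
      intro m
      induction m with
      | zero => rfl
      | succ m ih =>
        have : F.nakayamaEquiv.symm.toLinearMap (1 : F.carrier) = 1 := by
          rw [LinearEquiv.coe_coe, LinearEquiv.symm_apply_eq, nakayamaEquiv_apply, nakayama_one]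
        rw [pow_succ, Module.End.mul_apply, this, ih]
    rw [strandOne, strand_X_pow_single, zero_add]
    congr 1
    change (F.nakayamaEquiv.symm.toLinearMap ^ (a' : ℕ)) (1 : F.carrier) ⊗ₜ[k] (1 : C.Cyc n) = _
    rw [h1]
  have hv : (C.strand n).indAction (F.af (Fin.last n) (F.basis b') * F.ax (Fin.last n) ^ (a' : ℕ))
      (StrandRep.lastIncl n (C.strandOne n)) =
      StrandRep.lastIncl n (Finsupp.single (a' : ℕ) (F.basis b' ⊗ₜ 1)) := by
    have hp : ∀ m : ℕ, (C.strand n).indAction (F.ax (Fin.last n) ^ m)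
        (StrandRep.lastIncl n (C.strandOne n)) =
        StrandRep.lastIncl n (((C.strand n).X ^ m) (C.strandOne n)) := by
      intro m
      induction m with
      | zero => rw [pow_zero, pow_zero, map_one]; rfl
      | succ m ih =>
        rw [pow_succ', pow_succ', map_mul, Module.End.mul_apply, ih,
          StrandRep.indAction_ax_last_lastIncl, Module.End.mul_apply]
    rw [map_mul, Module.End.mul_apply, hp, hX, StrandRep.indAction_af, StrandRep.f_last_lastIncl,
      strand_Φ_single]
    congr 2
    change (F.basis b' * 1) ⊗ₜ[k] (1 : C.Cyc n) = _
    rw [mul_one]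
  have he : ∀ f : F.carrier, Finsupp.single (a' : ℕ) (f ⊗ₜ[k] (1 : C.Cyc n)) ∈
      degLT k (C.Coeff n) (a' + 1) := fun f => single_mem_degLT (Nat.lt_succ_self _) _
  rw [genRight, genLeft]
  dsimp only
  set π := Equiv.swap i (Fin.last n) * Equiv.swap j (Fin.last n) with hπ
  -- Moving the dual basis element past the permutations lets it act directly on the last component,
  -- as `trInd_pow_permOp` requires in the off-diagonal case.
  have hprod : F.ax (Fin.last n) ^ (C.level - 1 - a) * F.af (Fin.last n) (F.dualBasis b) *
      F.as (Equiv.swap i (Fin.last n)) * (F.as (Equiv.swap j (Fin.last n)) *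
        (F.af (Fin.last n) (F.basis b') * F.ax (Fin.last n) ^ (a' : ℕ))) =
      F.ax (Fin.last n) ^ (C.level - 1 - a) * (F.as π * F.af (π⁻¹ (Fin.last n)) (F.dualBasis b) *
        (F.af (Fin.last n) (F.basis b') * F.ax (Fin.last n) ^ (a' : ℕ))) := by
    rw [as_mul_af, show π (π⁻¹ (Fin.last n)) = Fin.last n from π.apply_symm_apply _, hπ, as_mul]
    simp only [mul_assoc]
  rw [hprod, map_mul, Module.End.mul_apply, map_mul, Module.End.mul_apply, hv, map_mul,
    Module.End.mul_apply, StrandRep.indAction_as, StrandRep.indAction_af]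
  by_cases hij : i = j
  · subst hij
    have hπ1 : π = 1 := by rw [hπ, Equiv.swap_mul_self]
    have h1 : (C.strand n).permOp 1 = 1 := by rw [← StrandRep.wreath_S, map_one]
    rw [hπ1, inv_one, Equiv.Perm.one_apply, StrandRep.f_last_lastIncl, strand_Φ_single, h1,
      Module.End.one_apply]
    have hp : ∀ (m : ℕ) (e : ℕ →₀ C.Coeff n), (C.strand n).indAction (F.ax (Fin.last n) ^ m)
        (StrandRep.lastIncl n e) = StrandRep.lastIncl n (((C.strand n).X ^ m) e) := by
      intro m e
      induction m with
      | zero => rw [pow_zero, pow_zero, map_one]; rfl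
      | succ m ih =>
        rw [pow_succ', pow_succ', map_mul, Module.End.mul_apply, ih,
          StrandRep.indAction_ax_last_lastIncl, Module.End.mul_apply]
    rw [hp, strand_X_pow_single, C.strand_isFiltered.trInd_lastIncl
      (single_mem_degLT (by omega) _), strandTr_apply]
    by_cases haa : a = a'
    · subst haa
      have e1 : (a : ℕ) + (C.level - 1 - a) = C.level - 1 := by omega
      rw [e1, Finsupp.single_eq_same, coeffTr_nakayama_pow]
      change C.coeffTr n ((F.dualBasis b * F.basis b') ⊗ₜ[k] (1 : C.Cyc n)) = _
      rw [coeffTr_tmul, tr_dualBasis_mul]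
      by_cases hb : b = b'
      · subst hb; simp
      · rw [if_neg hb, zero_smul, if_neg]
        simpa using hb
    · have : (a' : ℕ) ≠ a := fun e => haa (Fin.ext e.symm)
      rw [Finsupp.single_eq_of_ne (by omega), map_zero, if_neg]
      simp [haa]
  · have hπl : π (Fin.last n) ≠ Fin.last n := by
      rw [hπ, Equiv.Perm.mul_apply, Equiv.swap_apply_right]
      intro e
      by_cases hj : j = Fin.last n
      · subst hj
        rw [Equiv.swap_apply_right] at e
        exact hij e
      · rw [Equiv.swap_apply_of_ne_of_ne (Ne.symm hij) hj] at e
        exact hj e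
    obtain ⟨l, hl⟩ : ∃ l : Fin n, l.castSucc = π⁻¹ (Fin.last n) := by
      refine Fin.exists_castSucc_eq.2 fun e => hπl ?_
      conv_lhs => rw [← e]
      exact π.apply_symm_apply _
    rw [← hl, StrandRep.f_castSucc_lastIncl, if_neg (by simp [hij])]
    exact C.strand_isFiltered.trInd_pow_permOp C.strandTr_of_mem hπl (a := a') (by omega)
      (C.strand_isFiltered.ρ_mem _ _ _ (he _))

end CycParam

end FrobSuperalgebra

/-! ### Generation over the smaller algebra. -/

theorem mem_closure_of_mem_span {k M : Type*} [Ring k] [AddCommGroup M] [Module k M] {s : Set M}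
    (hs : ∀ r : k, ∀ w ∈ s, r • w ∈ s) {z : M} (hz : z ∈ Submodule.span k s) :
    z ∈ AddSubgroup.closure s := by
  refine Submodule.span_induction (p := fun z _ => z ∈ AddSubgroup.closure s)
    (fun w hw => AddSubgroup.subset_closure hw) (zero_mem _) (fun x y _ _ => add_mem)
    (fun r x _ hx => ?_) hz
  refine AddSubgroup.closure_induction (p := fun x _ => r • x ∈ AddSubgroup.closure s)
    (fun w hw => AddSubgroup.subset_closure (hs r w hw)) (by simp)
    (fun x y _ _ hx hy => by rw [smul_add]; exact add_mem hx hy)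
    (fun x _ hx => by rw [smul_neg]; exact neg_mem hx) hx

namespace FrobSuperalgebra

variable {k : Type u} [CommRing k] {F : FrobSuperalgebra k} {n : ℕ}

namespace CycParam

variable (C : F.CycParam)

theorem incl_quot_ax (l : Fin n) : C.incl n (C.quot n (F.ax l)) =
    C.quot (n + 1) (F.ax l.castSucc) := by rw [incl_quot, affineIncl_ax]

theorem incl_quot_af (l : Fin n) (a) : C.incl n (C.quot n (F.af l a)) =
    C.quot (n + 1) (F.af l.castSucc a) := by rw [incl_quot, affineIncl_af]

theorem incl_quot_as (π : Equiv.Perm (Fin n)) : C.incl n (C.quot n (F.as π)) =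
    C.quot (n + 1) (F.as (permCastSucc n π)) := by rw [incl_quot, affineIncl_as]

/-- Apply `AffineAction.mem_fil_level` to left multiplication, with `V₀` spanned by the products of
`F` in the last slot with `𝒜_n^𝐂(F)`. This space is stable under all copies of `F` and under the
polynomial generators other than the last, and it contains `1`. -/
theorem span_genLeft (z : C.Cyc (n + 1)) : z ∈ AddSubgroup.closure
    {w | ∃ (i : C.GenIdx n) (a : C.Cyc n), w = C.quot (n + 1) (C.genLeft i) * C.incl n a} := by
  refine mem_closure_of_mem_span (k := k) (by
    rintro r _ ⟨i, a, rfl⟩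
    exact ⟨i, r • a, by rw [map_smul, mul_smul_comm]⟩) ?_
  set W := Submodule.span k
    {w | ∃ (i : C.GenIdx n) (a : C.Cyc n), w = C.quot (n + 1) (C.genLeft i) * C.incl n a} with hW
  set V₀ : Submodule k (C.Cyc (n + 1)) := Submodule.span k
    {w | ∃ (b : F.carrier) (c : C.Cyc n), w = C.quot (n + 1) (F.af (Fin.last n) b) * C.incl n c}
    with hV₀
  have hmem : ∀ b c, C.quot (n + 1) (F.af (Fin.last n) b) * C.incl n c ∈ V₀ :=
    fun b c => Submodule.subset_span ⟨b, c, rfl⟩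
  let A : F.AffineAction n (C.Cyc (n + 1)) :=
    AffineAction.ofHom ((Algebra.lmul k (C.Cyc (n + 1))).comp (C.quot (n + 1)))
  have hA : ∀ z w, A.α z w = C.quot (n + 1) z * w := fun _ _ => rfl
  have hind : ∀ T : C.Cyc (n + 1), (∀ b c, T * (C.quot (n + 1) (F.af (Fin.last n) b) * C.incl n c)
      ∈ V₀) → ∀ v ∈ V₀, T * v ∈ V₀ := by
    intro T hT
    have : V₀ ≤ V₀.comap (LinearMap.mulLeft k T) := Submodule.span_le.2 (by
      rintro _ ⟨b, c, rfl⟩; exact hT b c)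
    exact this
  have key := A.mem_fil_level (V₀ := V₀) (fun j a v hv => by
      rw [hA]
      refine hind _ (fun b c => ?_) v hv
      induction j using Fin.lastCases with
      | last => rw [← mul_assoc, ← map_mul, ← F.afHom_apply, ← F.afHom_apply, ← map_mul,
          F.afHom_apply]; exact hmem _ _
      | cast l =>
        rw [← mul_assoc, ← map_mul]
        refine Submodule.span_induction (p := fun w _ => C.quot (n + 1) w * C.incl n c ∈ V₀) ?_
          (by simp) (fun x y _ _ hx hy => by rw [map_add, add_mul]; exact add_mem hx hy)
          (fun r x _ hx => by rw [map_smul, smul_mul_assoc]; exact V₀.smul_mem r hx)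
          (af_castSucc_mul_af_last l a b)
        rintro _ ⟨a', b', rfl⟩
        rw [map_mul, mul_assoc, ← incl_quot_af, ← map_mul]
        exact hmem _ _) (fun j hj v hv => by
      rw [hA]
      refine hind _ (fun b c => ?_) v hv
      obtain ⟨l, rfl⟩ := Fin.exists_castSucc_eq.2 hj
      have : F.ax l.castSucc * F.af (Fin.last n) b = F.af (Fin.last n) b * F.ax l.castSucc :=
        (af_mul_ax_ne (Fin.castSucc_ne_last l) b).symm
      rw [← mul_assoc, ← map_mul, this, map_mul, mul_assoc, ← incl_quot_ax, ← map_mul]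
      exact hmem _ _) C (LinearMap.ext fun w => by
        rw [hA, show C.quot (n + 1) (C.chi 0) = 0 from C.quot_chi n.succ_pos, zero_mul]; rfl)
    (Classical.choose (C.quot_surjective z)) 1 (by
      have := hmem 1 1
      rwa [← F.afHom_apply, map_one, map_one, map_one, mul_one] at this)
  rw [hA, Classical.choose_spec (C.quot_surjective z), mul_one] at key
  refine (?_ : A.fil V₀ C.level ≤ W) key
  refine Submodule.span_le.2 ?_
  rintro _ ⟨π, m, hm, v, hv, rfl⟩
  have hpow : ∀ v, (A.α (F.ax (Fin.last n)) ^ m) v = C.quot (n + 1) (F.ax (Fin.last n) ^ m) * v := by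
    intro v
    have : A.α (F.ax (Fin.last n)) ^ m = A.α (F.ax (Fin.last n) ^ m) :=
      (map_pow ((Algebra.lmul k (C.Cyc (n + 1))).comp (C.quot (n + 1))) _ _).symm
    rw [this, hA]
  have hS : ∀ v, A.S π v = C.quot (n + 1) (F.as π) * v := fun _ => rfl
  rw [SetLike.mem_coe, hpow, hS]
  refine Submodule.span_induction (p := fun v _ => C.quot (n + 1) (F.as π) *
    (C.quot (n + 1) (F.ax (Fin.last n) ^ m) * v) ∈ W) ?_ (by simp)
    (fun x y _ _ hx hy => by rw [mul_add, mul_add]; exact add_mem hx hy)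
    (fun r x _ hx => by rw [mul_smul_comm, mul_smul_comm]; exact W.smul_mem r hx) hv
  rintro _ ⟨f, c, rfl⟩
  obtain ⟨i, σ, rfl⟩ := exists_swap_mul_permCastSucc π
  -- Write `f = ψ^m(f')`, so that `x^m f = f' x^m` has the order used in `genLeft`; the permutation
  -- `σ` of the old strands moves to the right into `𝒜_n^𝐂(F)`.
  obtain ⟨f', hf'⟩ := F.nakayama_pow_surjective m f
  have e1 : F.as (Equiv.swap i (Fin.last n) * permCastSucc n σ) *
      (F.ax (Fin.last n) ^ m * F.af (Fin.last n) f) = F.as (Equiv.swap i (Fin.last n)) *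
        (F.af (Fin.last n) f' * F.ax (Fin.last n) ^ m) * F.as (permCastSucc n σ) := by
    rw [as_mul, mul_assoc, as_permCastSucc_comm, ← hf', ← af_mul_ax_pow]
    simp only [mul_assoc]
  have e2 : C.quot (n + 1) (F.as (Equiv.swap i (Fin.last n) * permCastSucc n σ)) *
      (C.quot (n + 1) (F.ax (Fin.last n) ^ m) *
        (C.quot (n + 1) (F.af (Fin.last n) f) * C.incl n c)) =
      C.quot (n + 1) (F.as (Equiv.swap i (Fin.last n)) *
        (F.af (Fin.last n) f' * F.ax (Fin.last n) ^ m)) * C.incl n (C.quot n (F.as σ) * c) := by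
    rw [← mul_assoc (C.quot (n + 1) (F.ax _ ^ m)), ← map_mul (C.quot (n + 1)), ← mul_assoc,
      ← map_mul (C.quot (n + 1)), e1, map_mul, map_mul (C.incl n), incl_quot_as, mul_assoc]
  rw [e2]
  rw [← F.basis.sum_repr f']
  rw [← F.afHom_apply, map_sum, Finset.sum_mul, Finset.mul_sum, map_sum, Finset.sum_mul]
  refine sum_mem fun b _ => ?_
  rw [map_smul, smul_mul_assoc, mul_smul_comm, map_smul, smul_mul_assoc]
  exact W.smul_mem _ (Submodule.subset_span ⟨(i, ⟨m, hm⟩, b), _, rfl⟩)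

/-- The mirror image, with right multiplication as the action and the coefficients expanded in the
dual basis. -/
theorem span_genRight (z : C.Cyc (n + 1)) : z ∈ AddSubgroup.closure
    {w | ∃ (i : C.GenIdx n) (a : C.Cyc n), w = C.incl n a * C.quot (n + 1) (C.genRight i)} := by
  refine mem_closure_of_mem_span (k := k) (by
    rintro r _ ⟨i, a, rfl⟩
    exact ⟨i, r • a, by rw [map_smul, smul_mul_assoc]⟩) ?_
  set W := Submodule.span k
    {w | ∃ (i : C.GenIdx n) (a : C.Cyc n), w = C.incl n a * C.quot (n + 1) (C.genRight i)} with hW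
  set V₀ : Submodule k (C.Cyc (n + 1)) := Submodule.span k
    {w | ∃ (b : F.carrier) (c : C.Cyc n), w = C.incl n c * C.quot (n + 1) (F.af (Fin.last n) b)}
    with hV₀
  have hmem : ∀ b c, C.incl n c * C.quot (n + 1) (F.af (Fin.last n) b) ∈ V₀ :=
    fun b c => Submodule.subset_span ⟨b, c, rfl⟩
  let A : F.AffineAction n (C.Cyc (n + 1)) :=
    AffineAction.ofAntiHom ((LinearMap.mul k (C.Cyc (n + 1))).flip ∘ₗ (C.quot (n + 1)).toLinearMap)
      (LinearMap.ext fun w => by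
        change w * C.quot (n + 1) 1 = w
        rw [map_one, mul_one])
      (fun z w => LinearMap.ext fun v => by
        change v * C.quot (n + 1) (z * w) = v * C.quot (n + 1) z * C.quot (n + 1) w
        rw [map_mul, mul_assoc])
  have hA : ∀ z w, A.α z w = w * C.quot (n + 1) z := fun _ _ => rfl
  have hind : ∀ T : C.Cyc (n + 1), (∀ b c, C.incl n c * C.quot (n + 1) (F.af (Fin.last n) b) * T
      ∈ V₀) → ∀ v ∈ V₀, v * T ∈ V₀ := by
    intro T hT
    have : V₀ ≤ V₀.comap (LinearMap.mulRight k T) := Submodule.span_le.2 (by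
      rintro _ ⟨b, c, rfl⟩; exact hT b c)
    exact this
  have key := A.mem_fil_level (V₀ := V₀) (fun j a v hv => by
      rw [hA]
      refine hind _ (fun b c => ?_) v hv
      induction j using Fin.lastCases with
      | last => rw [mul_assoc, ← map_mul, ← F.afHom_apply, ← F.afHom_apply, ← map_mul,
          F.afHom_apply]; exact hmem _ _
      | cast l =>
        rw [mul_assoc, ← map_mul]
        refine Submodule.span_induction (p := fun w _ => C.incl n c * C.quot (n + 1) w ∈ V₀) ?_
          (by simp) (fun x y _ _ hx hy => by rw [map_add, mul_add]; exact add_mem hx hy)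
          (fun r x _ hx => by rw [map_smul, mul_smul_comm]; exact V₀.smul_mem r hx)
          (af_last_mul_af_castSucc l a b)
        rintro _ ⟨a', b', rfl⟩
        rw [map_mul, ← mul_assoc, ← incl_quot_af, ← map_mul]
        exact hmem _ _) (fun j hj v hv => by
      rw [hA]
      refine hind _ (fun b c => ?_) v hv
      obtain ⟨l, rfl⟩ := Fin.exists_castSucc_eq.2 hj
      rw [mul_assoc, ← map_mul, af_mul_ax_ne (Fin.castSucc_ne_last l) b, map_mul, ← mul_assoc,
        ← incl_quot_ax, ← map_mul]
      exact hmem _ _) C (LinearMap.ext fun w => by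
        rw [hA, show C.quot (n + 1) (C.chi 0) = 0 from C.quot_chi n.succ_pos, mul_zero]; rfl)
    (Classical.choose (C.quot_surjective z)) 1 (by
      have := hmem 1 1
      rwa [← F.afHom_apply, map_one, map_one, map_one, mul_one] at this)
  rw [hA, Classical.choose_spec (C.quot_surjective z), one_mul] at key
  refine (?_ : A.fil V₀ C.level ≤ W) key
  refine Submodule.span_le.2 ?_
  rintro _ ⟨π, m, hm, v, hv, rfl⟩
  have hpow : ∀ (m : ℕ) v, (A.α (F.ax (Fin.last n)) ^ m) v =
      v * C.quot (n + 1) (F.ax (Fin.last n) ^ m) := by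
    intro m v
    induction m with
    | zero => rw [pow_zero, pow_zero, map_one, mul_one]; rfl
    | succ m ih => rw [pow_succ', pow_succ, Module.End.mul_apply, ih, hA, map_mul, mul_assoc]
  have hS : ∀ v, A.S π v = v * C.quot (n + 1) (F.as π⁻¹) := fun _ => rfl
  rw [SetLike.mem_coe, hpow, hS]
  refine Submodule.span_induction (p := fun v _ => v * C.quot (n + 1) (F.ax (Fin.last n) ^ m) *
    C.quot (n + 1) (F.as π⁻¹) ∈ W) ?_ (by simp)
    (fun x y _ _ hx hy => by rw [add_mul, add_mul]; exact add_mem hx hy)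
    (fun r x _ hx => by rw [smul_mul_assoc, smul_mul_assoc]; exact W.smul_mem r hx) hv
  rintro _ ⟨f, c, rfl⟩
  obtain ⟨i, σ, rfl⟩ := exists_swap_mul_permCastSucc π
  set f' := (F.nakayama ^ m) f
  have e1 : F.af (Fin.last n) f * F.ax (Fin.last n) ^ m *
      F.as (Equiv.swap i (Fin.last n) * permCastSucc n σ)⁻¹ = F.as (permCastSucc n σ⁻¹) *
        (F.ax (Fin.last n) ^ m * F.af (Fin.last n) f' * F.as (Equiv.swap i (Fin.last n))) := by
    rw [mul_inv_rev, Equiv.swap_inv, ← map_inv, as_mul, af_mul_ax_pow, ← mul_assoc,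
      ← as_permCastSucc_comm, mul_assoc]
  have e2 : C.incl n c * C.quot (n + 1) (F.af (Fin.last n) f) *
      C.quot (n + 1) (F.ax (Fin.last n) ^ m) *
        C.quot (n + 1) (F.as (Equiv.swap i (Fin.last n) * permCastSucc n σ)⁻¹) =
      C.incl n (c * C.quot n (F.as σ⁻¹)) * C.quot (n + 1)
        (F.ax (Fin.last n) ^ m * F.af (Fin.last n) f' * F.as (Equiv.swap i (Fin.last n))) := by
    rw [mul_assoc (C.incl n c), ← map_mul (C.quot (n + 1)), mul_assoc (C.incl n c),
      ← map_mul (C.quot (n + 1)), e1, map_mul, map_mul (C.incl n), incl_quot_as,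
      ← mul_assoc (C.incl n c)]
  rw [e2]
  rw [← F.sum_tr_mul_basis f']
  rw [← F.afHom_apply, map_sum, Finset.mul_sum, Finset.sum_mul, map_sum, Finset.mul_sum]
  refine sum_mem fun b _ => ?_
  rw [map_smul, mul_smul_comm, smul_mul_assoc, map_smul, mul_smul_comm]
  refine W.smul_mem _ (Submodule.subset_span
    -- `genRight` carries the complementary exponent, so the power `m < d` belongs to the index `d -
    -- 1 - m`.
    ⟨(i, ⟨C.level - 1 - m, by omega⟩, b), c * C.quot n (F.as σ⁻¹), ?_⟩)
  rw [genRight]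
  dsimp only
  rw [show C.level - 1 - (C.level - 1 - m) = m by omega, F.afHom_apply]

variable (n) in
/-- The algebra `𝒜_{n+1}^𝐂(F)` is a graded Frobenius extension of `𝒜_n^𝐂(F)`. -/
theorem nonempty_gradedFrobExt : Nonempty (GradedFrobExt (C.incl n) (C.cycGr n) (C.cycGr (n + 1))
    (C.level • F.top) (C.GenIdx n)) := by
  classical
  exact GradedFrobExt.nonempty_of_unitriangular C.cycGr_isInternal C.cycGr_isInternal C.incl_mem _
    (C.trace n).toAddMonoidHom C.trace_incl_mul C.trace_mul_incl
    (fun i => C.quot (n + 1) (C.genLeft i)) (fun i => C.quot (n + 1) (C.genRight i)) C.genDeg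
    (fun i => ⟨_, C.genLeft_mem i, rfl⟩) (fun i => ⟨_, C.genRight_mem i, rfl⟩)
    C.span_genLeft C.span_genRight (fun i => i.2.1) C.trace_gen

end CycParam

end FrobSuperalgebra

/-! ### Induction and restriction along a Frobenius extension. -/

namespace BalTensor

variable {k : Type u} [CommRing k] {A : Type u} [Ring A] [Algebra k A] {A' : Type u} [Ring A']
  [Algebra k A'] (φ : A →ₐ[k] A') {M : Type u} [AddCommGroup M] [Module A M]

/-- The additive map `m ↦ a' ⊗ m`. -/
def tmulHom (a' : A') : M →+ BalTensor φ M := AddMonoidHom.mk' (tmul φ a') (tmul_add φ a')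

theorem sum_tmul {J : Type*} (s : Finset J) (a : J → A') (m : M) :
    tmul φ (∑ j ∈ s, a j) m = ∑ j ∈ s, tmul φ (a j) m :=
  map_sum (AddMonoidHom.mk' (fun a => tmul φ a m) fun a b => add_tmul φ a b m) a s

theorem tmul_sum {J : Type*} (s : Finset J) (a : A') (m : J → M) :
    tmul φ a (∑ j ∈ s, m j) = ∑ j ∈ s, tmul φ a (m j) := map_sum (tmulHom φ a) m s

theorem finite [Module.Finite A M] : Module.Finite A' (BalTensor φ M) := by
  obtain ⟨s, hs⟩ := ‹Module.Finite A M›.fg_top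
  refine ⟨Submodule.fg_def.2 ⟨tmul φ 1 '' s, s.finite_toSet.image _, eq_top_iff.2 fun z _ => ?_⟩⟩
  have key : ∀ m : M, tmul φ 1 m ∈ Submodule.span A' (tmul φ 1 '' (s : Set M)) := by
    intro m
    refine Submodule.span_induction (p := fun m _ => tmul φ 1 m ∈
      Submodule.span A' (tmul φ 1 '' (s : Set M))) (fun m hm => Submodule.subset_span ⟨m, hm, rfl⟩)
      ?_ (fun x y _ _ hx hy => by rw [tmul_add]; exact add_mem hx hy) (fun a m _ hm => ?_)
      (hs ▸ Submodule.mem_top : m ∈ Submodule.span A (s : Set M))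
    · exact (congrArg (· ∈ _) (map_zero (tmulHom φ 1))).mpr (zero_mem _)
    · rw [← tmul_smul, one_mul, ← mul_one (φ a), ← smul_tmul']
      exact Submodule.smul_mem _ _ hm
  refine induction φ z (zero_mem _) (fun a m => ?_) (fun x y => add_mem)
  rw [← mul_one a, ← smul_tmul']
  exact Submodule.smul_mem _ _ (key m)

/-- The `A'`-linear map `A' ⊗_A M → N` induced by a semilinear map `M → N`. -/
def liftLin {N : Type u} [AddCommGroup N] [Module A' N] (g : M →ₛₗ[(φ : A →+* A')] N) :
    BalTensor φ M →ₗ[A'] N where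
  toFun := lift φ (AddMonoidHom.mk' (fun a' => AddMonoidHom.mk' (fun m => a' • g m)
      (fun m n => by rw [map_add, smul_add]))
      (fun a b => by ext m; exact add_smul a b (g m)))
      (fun a' a m => by
        change (a' * φ a) • g m = a' • g (a • m)
        rw [LinearMap.map_smulₛₗ, mul_smul]; rfl)
  map_add' := map_add _
  map_smul' b z := by
    refine induction φ z (by simp) (fun a m => mul_smul b a (g m)) (fun x y hx hy => ?_)
    rw [smul_add, map_add, hx, hy, map_add, smul_add]

theorem linearMap_ext {N : Type u} [AddCommGroup N] [Module A' N] {f g : BalTensor φ M →ₗ[A'] N}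
    (hfg : ∀ m, f (tmul φ 1 m) = g (tmul φ 1 m)) : f = g := by
  refine LinearMap.ext fun z => induction φ z (by simp) (fun a m => ?_)
    (fun x y hx hy => by rw [map_add, hx, hy, map_add])
  rw [← mul_one a, ← smul_tmul', map_smul, map_smul, hfg]

/-- The semilinear map `m ↦ 1 ⊗ m`. -/
def unit : M →ₛₗ[(φ : A →+* A')] BalTensor φ M where
  toFun := tmul φ 1
  map_add' := tmul_add φ 1
  map_smul' a m := by rw [← tmul_smul, one_mul, ← mul_one (φ a), ← smul_tmul']; rfl

theorem lift_mem_gr {𝒜 : Bideg → Submodule k A} {𝒜' : Bideg → Submodule k A'} {M : GrSMod 𝒜}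
    {N : Type*} [AddCommGroup N] (T : BalTensor φ M.carrier →+ N) {p : Bideg} (S : AddSubgroup N)
    (hT : ∀ q r : Bideg, q + r = p → ∀ a' ∈ 𝒜' q, ∀ m ∈ M.gr r, T (tmul φ a' m) ∈ S)
    {z : BalTensor φ M.carrier} (hz : z ∈ gr φ 𝒜' M p) : T z ∈ S := by
  refine (AddSubgroup.closure_le (S.comap T)).2 ?_ hz
  rintro _ ⟨q, r, a', ha', m, hm, hp, rfl⟩
  exact hT q r hp a' ha' m hm

end BalTensor

section Adjunctions

open BalTensor

variable {k : Type u} [CommRing k] {A : Type u} [Ring A] [Algebra k A] {A' : Type u} [Ring A']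
  [Algebra k A'] {𝒜 : Bideg → Submodule k A} {𝒜' : Bideg → Submodule k A'} {φ : A →ₐ[k] A'}
  (hφ : ∀ p, ∀ a ∈ 𝒜 p, φ a ∈ 𝒜' p) (h : DirectSum.IsInternal 𝒜)
  (h' : DirectSum.IsInternal 𝒜')

/-- A homomorphism `M → Res N`, as a semilinear map. -/
def GrSMod.Hom.toSemilin {M : GrSMod 𝒜} {N : GrSMod 𝒜'} (g : M ⟶ (GrSMod.res φ hφ).obj N) :
    M.carrier →ₛₗ[(φ : A →+* A')] N.carrier where
  toFun := g.toLin
  map_add' := g.toLin.map_add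
  map_smul' := g.toLin.map_smul

/-- The bijection between homomorphisms `A' ⊗_A M → N` and homomorphisms `M → Res N`. -/
def GrSMod.indHomEquiv [SetLike.GradedMonoid 𝒜'] (M : GrSMod 𝒜) (N : GrSMod 𝒜') :
    ((GrSMod.ind φ hφ h h').obj M ⟶ N) ≃ (M ⟶ (GrSMod.res φ hφ).obj N) where
  toFun g :=
    { toLin :=
        letI := Module.compHom N.carrier φ.toRingHom
        { toFun := fun m => g.toLin (unit φ m)
          map_add' := (LinearMap.comp g.toLin (unit φ)).map_add
          map_smul' := (LinearMap.comp g.toLin (unit φ)).map_smulₛₗ }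
      map_mem := fun {p m} hm => g.map_mem (AddSubgroup.subset_closure
        ⟨0, p, 1, SetLike.GradedOne.one_mem (A := 𝒜'), m, hm, zero_add p, rfl⟩) }
  invFun g :=
    { toLin := liftLin φ (GrSMod.Hom.toSemilin hφ g)
      map_mem := fun {p z} hz => by
        refine lift_mem_gr φ (liftLin φ (GrSMod.Hom.toSemilin hφ g)).toAddMonoidHom (N.gr p)
          (fun q r hp a' ha' m hm => ?_) hz
        subst hp
        exact N.smul_mem ha' (g.map_mem hm) }
  left_inv g := GrSMod.Hom.ext (linearMap_ext φ fun m => one_smul A' _)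
  right_inv g := GrSMod.Hom.ext (LinearMap.ext fun m =>
    one_smul A' (GrSMod.Hom.toSemilin hφ g m))

/-- Induction is left adjoint to restriction. -/
def GrSMod.indResAdjunction [SetLike.GradedMonoid 𝒜'] : GrSMod.ind φ hφ h h' ⊣ GrSMod.res φ hφ :=
  Adjunction.mkOfHomEquiv
    { homEquiv := GrSMod.indHomEquiv hφ h h'
      homEquiv_naturality_left_symm := fun _ _ => GrSMod.Hom.ext (linearMap_ext φ fun _ => rfl)
      homEquiv_naturality_right := fun _ _ => rfl }

namespace GradedFrobExt

variable {D : Bideg} {I : Type u} [Fintype I] (E : GradedFrobExt φ 𝒜 𝒜' D I)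
  {M : Type u} [AddCommGroup M] [Module A M]

/-- The map `a' ⊗ m ↦ tr(a') m`. -/
def trTensor : BalTensor φ M →+ M :=
  lift φ (AddMonoidHom.mk' (fun a' => AddMonoidHom.mk' (fun m => E.tr a' • m)
    (fun m n => smul_add _ m n)) (fun a b => by ext m; simp [add_smul]))
    (fun a' a m => by
      change E.tr (a' * φ a) • m = E.tr a' • a • m
      rw [E.tr_right, mul_smul])

theorem trTensor_tmul (a' : A') (m : M) : E.trTensor (tmul φ a' m) = E.tr a' • m := rfl

theorem trTensor_smul (a : A) (z : BalTensor φ M) : E.trTensor (φ a • z) = a • E.trTensor z := by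
  refine induction φ z ?_ (fun b m => ?_) (fun x y hx hy => ?_)
  · simp
  · rw [smul_tmul', trTensor_tmul, trTensor_tmul, E.tr_left, mul_smul]
  · rw [smul_add, map_add, hx, hy, map_add, smul_add]

/-- The dual basis identity in `A' ⊗_A M`: for `z = b ⊗ m` the traces move across the tensor sign
and `sum_left` reassembles `b`. -/
theorem sum_left_tmul (z : BalTensor φ M) :
    ∑ i, tmul φ (E.left i) (E.trTensor (E.right i • z)) = z := by
  refine induction φ z ?_ (fun b m => ?_) (fun x y hx hy => ?_)
  · exact Finset.sum_eq_zero fun i _ => by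
      rw [smul_zero, map_zero]; exact map_zero (tmulHom φ (E.left i))
  · simp only [smul_tmul', trTensor_tmul, ← tmul_smul]
    rw [← sum_tmul, E.sum_left]
  · simp only [smul_add, map_add, tmul_add, Finset.sum_add_distrib, hx, hy]

theorem trTensor_map {N : Type u} [AddCommGroup N] [Module A N] (f : M →ₗ[A] N)
    (z : BalTensor φ M) : E.trTensor (BalTensor.map φ f z) = f (E.trTensor z) := by
  refine induction φ z ?_ (fun b m => ?_) (fun x y hx hy => ?_)
  · simp
  · rw [map_tmul, trTensor_tmul, trTensor_tmul, map_smul]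
  · rw [map_add, map_add, hx, hy, map_add, map_add]

include E in
-- If `z` is in the kernel of the induced map of `g`, then each coefficient `tr(y_i z)` is in the
-- kernel of `g`, hence lifts along `f`; the lifts reassemble to a preimage of `z` by
-- `sum_left_tmul`.
theorem exact_map {N P : Type u} [AddCommGroup N] [Module A N] [AddCommGroup P] [Module A P]
    {f : M →ₗ[A] N} {g : N →ₗ[A] P} (hfg : Function.Exact f g) :
    Function.Exact (BalTensor.map φ f) (BalTensor.map φ g) := by
  intro z
  constructor
  · intro hz
    have : ∀ i, ∃ m, f m = E.trTensor (E.right i • z) := fun i => (hfg _).1 (by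
      rw [← trTensor_map, map_smul, hz, smul_zero, map_zero])
    choose m hm using this
    refine ⟨∑ i, tmul φ (E.left i) (m i), ?_⟩
    rw [map_sum]
    simp only [map_tmul, hm]
    exact E.sum_left_tmul z
  · rintro ⟨z, rfl⟩
    rw [← BalTensor.map_comp, hfg.linearMap_comp_eq_zero]
    exact LinearMap.congr_fun (linearMap_ext φ (g := 0) fun m => map_zero (tmulHom φ 1)) z

include E in
-- By `sum_right` the finitely many `y_i` generate `A'` as a left `A`-module, so their products with
-- generators over `A'` generate over `A`.
theorem finite_restrictScalars {N : Type u} [AddCommGroup N] [Module A' N] [Module A N]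
    (hN : ∀ (a : A) (n : N), a • n = φ a • n) [Module.Finite A' N] : Module.Finite A N := by
  obtain ⟨s, hs⟩ := ‹Module.Finite A' N›.fg_top
  set G : Set N := Set.image2 (fun i m => E.right i • m) Set.univ (s : Set N) with hG
  refine ⟨Submodule.fg_def.2 ⟨G, Set.finite_univ.image2 _ s.finite_toSet,
    eq_top_iff.2 fun n _ => ?_⟩⟩
  suffices H : ∀ a' : A', a' • n ∈ Submodule.span A G by simpa using H 1
  refine Submodule.span_induction (p := fun n _ => ∀ a' : A', a' • n ∈ Submodule.span A G)
    (fun m hm a' => ?_) (by simp) (fun x y _ _ hx hy a' => by rw [smul_add]; exact add_mem (hx a') (hy a'))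
    (fun b x _ hx a' => by rw [smul_smul]; exact hx _)
    (hs ▸ Submodule.mem_top : n ∈ Submodule.span A' (s : Set N))
  rw [← E.sum_right a', Finset.sum_smul]
  refine sum_mem fun i _ => ?_
  rw [mul_smul, ← hN]
  exact Submodule.smul_mem _ _ (Submodule.subset_span ⟨i, Set.mem_univ i, m, hm, rfl⟩)

variable {N : Type u} [AddCommGroup N] [Module A' N]

/-- The `A'`-linear map `N → A' ⊗_A M` induced by an `A`-linear map `N → M`. -/
def coindLift (g : N →+ M) (hg : ∀ a n, g (φ a • n) = a • g n) : N →ₗ[A'] BalTensor φ M where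
  toFun n := ∑ i, tmul φ (E.left i) (g (E.right i • n))
  map_add' m n := by simp only [smul_add, map_add, tmul_add, Finset.sum_add_distrib]
  map_smul' b n := by
    -- Expand `y_i b` in the `y_j` by `sum_right`. The coefficients `tr(y_i b x_j)` then cross the
    -- tensor sign, and summing over `i` gives `b x_j` by `sum_left`.
    have h1 : ∀ i, g (E.right i • b • n) =
        ∑ j, E.tr (E.right i * b * E.left j) • g (E.right j • n) := by
      intro i
      rw [smul_smul]
      conv_lhs => rw [← E.sum_right (E.right i * b), Finset.sum_smul, map_sum]
      exact Finset.sum_congr rfl fun j _ => by rw [mul_smul, hg]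
    simp only [h1, tmul_sum, ← tmul_smul, RingHom.id_apply, Finset.smul_sum, smul_tmul']
    rw [Finset.sum_comm]
    refine Finset.sum_congr rfl fun j _ => ?_
    rw [← sum_tmul]
    simp only [mul_assoc]
    rw [E.sum_left]

theorem coindLift_apply (g : N →+ M) (hg : ∀ a n, g (φ a • n) = a • g n) (n : N) :
    E.coindLift g hg n = ∑ i, tmul φ (E.left i) (g (E.right i • n)) := rfl

theorem trTensor_coindLift (g : N →+ M) (hg : ∀ a n, g (φ a • n) = a • g n) (n : N) :
    E.trTensor (E.coindLift g hg n) = g n := by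
  simp only [coindLift_apply, map_sum, trTensor_tmul, ← hg]
  rw [← map_sum]
  simp only [← mul_smul]
  rw [← Finset.sum_smul]
  have := E.sum_right 1
  simp only [one_mul] at this
  rw [this, one_smul]

/-- The bijection between homomorphisms `Res N → M` and homomorphisms `N → (A' ⊗_A M){s}`. -/
def resHomEquiv [SetLike.GradedMonoid 𝒜'] {s : ℤ} (E : GradedFrobExt φ 𝒜 𝒜' (s, 0) I) (N : GrSMod 𝒜') (M : GrSMod 𝒜) :
    ((GrSMod.res φ hφ).obj N ⟶ M) ≃
      (N ⟶ (GrSMod.shift 𝒜' s).obj ((GrSMod.ind φ hφ h h').obj M)) where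
  toFun g :=
    { toLin := E.coindLift (N := N.carrier) g.toLin.toAddMonoidHom g.toLin.map_smul
      map_mem := fun {p n} hn => by
        change ∑ i, tmul φ (E.left i) (g.toLin (E.right i • n)) ∈
          BalTensor.gr φ 𝒜' M (p.1 + s, p.2)
        refine sum_mem fun i _ => ?_
        refine AddSubgroup.subset_closure ⟨E.deg i, (s, 0) - E.deg i + p, E.left i, E.left_mem i, _,
          g.map_mem (N.smul_mem (E.right_mem i) hn), ?_, rfl⟩
        rw [← add_assoc, add_sub_cancel, add_comm]
        exact Prod.ext rfl (add_zero _) }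
  invFun g :=
    { toLin :=
        letI := ((GrSMod.res φ hφ).obj N).module
        { toFun := fun n => E.trTensor (g.toLin n)
          map_add' := (E.trTensor.comp g.toLin.toAddMonoidHom).map_add
          map_smul' := fun a n => (congrArg E.trTensor (g.toLin.map_smul (φ a) n)).trans
            (E.trTensor_smul a _) }
      map_mem := fun {p n} hn => by
        refine lift_mem_gr φ E.trTensor (M.gr p) (fun q r hp a' ha' m hm => ?_) (g.map_mem hn)
        have := M.smul_mem (E.tr_mem q a' ha') hm
        have hp' : q - (s, 0) + r = p := by
          rw [sub_add_eq_add_sub, hp]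
          exact Prod.ext (add_sub_cancel_right _ _) (sub_zero _)
        rw [hp'] at this
        exact this }
  left_inv g := GrSMod.Hom.ext (LinearMap.ext fun n =>
    E.trTensor_coindLift (N := N.carrier) g.toLin.toAddMonoidHom g.toLin.map_smul n)
  right_inv g := GrSMod.Hom.ext (LinearMap.ext fun n =>
    (Finset.sum_congr rfl fun i _ => congrArg (fun z => tmul φ (E.left i) (E.trTensor z))
      (g.toLin.map_smul (E.right i) n)).trans (E.sum_left_tmul _))

/-- Up to a degree shift, induction is right adjoint to restriction. -/
def resIndAdjunction [SetLike.GradedMonoid 𝒜'] {s : ℤ} (E : GradedFrobExt φ 𝒜 𝒜' (s, 0) I) :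
    GrSMod.res φ hφ ⊣ GrSMod.ind φ hφ h h' ⋙ GrSMod.shift 𝒜' s :=
  Adjunction.mkOfHomEquiv
    { homEquiv := E.resHomEquiv hφ h h'
      homEquiv_naturality_left_symm := fun _ _ => rfl
      homEquiv_naturality_right := fun f g => GrSMod.Hom.ext (LinearMap.ext fun n =>
        (map_sum (BalTensor.map φ g.toLin)
          (fun i => tmul φ (E.left i) (f.toLin (E.right i • n))) _).symm) }

end GradedFrobExt

/-- An adjunction between functors preserving finite generation restricts to the categories of
finitely generated graded supermodules. -/
noncomputable def FGMod.restrictAdjunction {L : GrSMod 𝒜 ⥤ GrSMod 𝒜'} {R : GrSMod 𝒜' ⥤ GrSMod 𝒜}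
    (adj : L ⊣ R) (hL : ∀ M, GrSMod.IsFG 𝒜 M → GrSMod.IsFG 𝒜' (L.obj M))
    (hR : ∀ M, GrSMod.IsFG 𝒜' M → GrSMod.IsFG 𝒜 (R.obj M)) :
    FGMod.restrict L hL ⊣ FGMod.restrict R hR :=
  adj.restrictFullyFaithful (GrSMod.IsFG 𝒜).fullyFaithfulι (GrSMod.IsFG 𝒜').fullyFaithfulι
    (Iso.refl _) (Iso.refl _)

end Adjunctions

/-! ### The theorem. -/

theorem mainTheorem12 {k : Type u} [CommRing k] (hk : ringChar k ≠ 2)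
    (F : FrobSuperalgebra.{u} k)
    (hθ : 0 < F.theta) (hchar : ¬ ringChar k ∣ F.theta)
    (hdiag : ∃ (ι : Type u) (b : Module.Basis ι k F.carrier),
      ∀ i, ∃ r : k, F.nakayama (b i) = r • b i)
    (C : F.CycParam) (n : ℕ) :
    -- induction and restriction preserve finite generation
    ∃ (hInd : ∀ M, GrSMod.IsFG (C.cycGr n) M → GrSMod.IsFG (C.cycGr (n + 1)) ((C.ind n).obj M))
      (hRes : ∀ M, GrSMod.IsFG (C.cycGr (n + 1)) M → GrSMod.IsFG (C.cycGr n) ((C.res n).obj M)),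
      -- the induction functor between the module categories is exact
      (∀ {M N P : FGMod (C.cycGr n)} (f : M ⟶ N) (g : N ⟶ P),
        Function.Exact f.hom.toLin g.hom.toLin →
        Function.Exact ((FGMod.restrict (C.ind n) hInd).map f).hom.toLin
          ((FGMod.restrict (C.ind n) hInd).map g).hom.toLin) ∧
      -- it is left adjoint to restriction
      Nonempty (FGMod.restrict (C.ind n) hInd ⊣ FGMod.restrict (C.res n) hRes) ∧
      -- and, up to the degree shift by `d δ`, right adjoint to restriction
      Nonempty (FGMod.restrict (C.res n) hRes ⊣
        FGMod.restrict (C.ind n) hInd ⋙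
          FGMod.shift (C.cycGr (n + 1)) ((C.level : ℤ) * F.δ)) := by
  obtain ⟨E⟩ := C.nonempty_gradedFrobExt n
  -- The trace has even degree `-dδ`, so the shift affects only the integer degree and not the
  -- parity.
  rw [show C.level • F.top = ((C.level : ℤ) * F.δ, 0) by
    simp [FrobSuperalgebra.top]] at E
  have hInd : ∀ M, GrSMod.IsFG (C.cycGr n) M →
      GrSMod.IsFG (C.cycGr (n + 1)) ((C.ind n).obj M) := fun M hM => by
    have : Module.Finite _ M.carrier := hM
    exact BalTensor.finite (C.incl n)
  have hRes : ∀ M, GrSMod.IsFG (C.cycGr (n + 1)) M →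
      GrSMod.IsFG (C.cycGr n) ((C.res n).obj M) := fun M hM => by
    have : Module.Finite _ M.carrier := hM
    let _ : Module (C.Cyc n) M.carrier := ((C.res n).obj M).module
    exact E.finite_restrictScalars (N := M.carrier) fun _ _ => rfl
  refine ⟨hInd, hRes, fun f g hfg => E.exact_map hfg, ⟨FGMod.restrictAdjunction
    (GrSMod.indResAdjunction C.incl_mem C.cycGr_isInternal C.cycGr_isInternal) hInd hRes⟩, ⟨?_⟩⟩
  -- The right adjoint is a composite of functors on the finitely generated categories, so the
  -- adjunction is restricted directly along the full embeddings rather than through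
  -- `FGMod.restrictAdjunction`.
  exact (E.resIndAdjunction C.incl_mem C.cycGr_isInternal C.cycGr_isInternal).restrictFullyFaithful
    (GrSMod.IsFG _).fullyFaithfulι (GrSMod.IsFG _).fullyFaithfulι (Iso.refl _) (Iso.refl _)
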